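/- All graphs are finite and simple. Let $u,v$ be vertices of a graph $G$, and let $d(x,y)$ be the number of edges of a shortest path of $G$ between $x$ and $y$ ($\infty$ if there is none). A vertex $x$ is $uv$-straight if $d(u,x)+d(x,v)=d(u,v)$. A $uv$-NSP (non-shortest path) is an induced path from $u$ to $v$ with more than $d(u,v)$ edges. Theorem. There is an algorithm (one program for a unit-cost random access machine whose memory consists of variables and two-dimensional arrays of natural numbers, and whose arithmetic operations are successor, predecessor and comparison) and a constant $C$ with the following property. Given the number $n\ge 1$ of vertices and the adjacency matrix of any graph $G$ with vertex set $\{0,\dots,n-1\}$, together with any vertices $u,v$ of $G$ such that every vertex of $G$ is $uv$-straight, the algorithm halts after at most $C\,n^{16}$ steps, and outputs either a $uv$-NSP of $G$, as the sequence of its vertices, or the (correct) answer that $G$ has no $uv$-NSP. -/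

import Mathlib

/-- `p` is a non-shortest path from `u` to `v`: it is an induced path, and its length is larger
than the distance from `u` to `v`. -/
def IsNSP {V : Type*} (G : SimpleGraph V) {u v : V} (p : G.Walk u v) : Prop :=
  p.IsPath ∧ p.IsChordless ∧ G.edist u v < (p.length : ℕ∞)

/-- `x` is `uv`-straight: `d(u, x) + d(x, v) = d(u, v)`, where the distance of two vertices in
different components is infinite. -/
def IsStraight {V : Type*} (G : SimpleGraph V) (u v x : V) : Prop :=
  G.edist u x + G.edist x v = G.edist u v

/-! ### The machine model

A random access machine of unit cost, programmed with structured control flow.  The only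
arithmetic is successor, predecessor and comparison, so after `t` steps no cell holds a number that
is larger than `t` plus the largest number in the input and the program: all numbers in a run of
polynomial length have `O(log n)` bits, and unit cost hides no arithmetic on long numbers.  -/

namespace RAM

/-- A memory: natural-number variables `x₀, x₁, …` and two-dimensional arrays `A₀, A₁, …`, of which
a program mentions only finitely many, each by a fixed name. -/
structure State where
  /-- `var x` is the content of the variable with name `x`. -/
  var : ℕ → ℕ
  /-- `arr a i j` is the content of the cell `(i, j)` of the array with name `a`. -/
  arr : ℕ → ℕ → ℕ → ℕ

/-- Expressions.  Truth values are `1` and `0`. -/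
inductive Expr where
  | const (k : ℕ) : Expr
  | var (x : ℕ) : Expr
  | read (a : ℕ) (i j : Expr) : Expr
  | succ (e : Expr) : Expr
  | pred (e : Expr) : Expr
  | lt (e f : Expr) : Expr
  | eq (e f : Expr) : Expr

/-- The value of an expression (the predecessor of `0` is `0`). -/
def Expr.eval (σ : State) : Expr → ℕ
  | .const k => k
  | .var x => σ.var x
  | .read a i j => σ.arr a (i.eval σ) (j.eval σ)
  | .succ e => e.eval σ + 1
  | .pred e => e.eval σ - 1
  | .lt e f => if e.eval σ < f.eval σ then 1 else 0
  | .eq e f => if e.eval σ = f.eval σ then 1 else 0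

/-- The number of steps for the evaluation of an expression: one for each operation in it. -/
def Expr.cost : Expr → ℕ
  | .const _ => 1
  | .var _ => 1
  | .read _ i j => i.cost + j.cost + 1
  | .succ e => e.cost + 1
  | .pred e => e.cost + 1
  | .lt e f => e.cost + f.cost + 1
  | .eq e f => e.cost + f.cost + 1

/-- Programs. -/
inductive Prog where
  /-- do nothing -/
  | skip : Prog
  /-- `x := e` -/
  | assign (x : ℕ) (e : Expr) : Prog
  /-- `a[i, j] := e` -/
  | store (a : ℕ) (i j e : Expr) : Prog
  /-- first `p`, then `q` -/
  | seq (p q : Prog) : Prog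
  /-- `p` if `b ≠ 0`, and `q` if `b = 0` -/
  | branch (b : Expr) (p q : Prog) : Prog
  /-- as long as `b ≠ 0`, repeat `p` -/
  | loop (b : Expr) (p : Prog) : Prog

/-- The memory after `x := k`. -/
def State.setVar (σ : State) (x k : ℕ) : State where
  var := Function.update σ.var x k
  arr := σ.arr

/-- The memory after `a[i, j] := k`. -/
def State.setArr (σ : State) (a i j k : ℕ) : State where
  var := σ.var
  arr := Function.update σ.arr a
    (Function.update (σ.arr a) i (Function.update (σ.arr a i) j k))

/-- `Exec p σ t τ`: the program `p`, started with memory `σ`, halts after exactly `t` steps with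
memory `τ`. -/
inductive Exec : Prog → State → ℕ → State → Prop where
  | skip (σ : State) : Exec .skip σ 1 σ
  | assign (x : ℕ) (e : Expr) (σ : State) :
      Exec (.assign x e) σ (e.cost + 1) (σ.setVar x (e.eval σ))
  | store (a : ℕ) (i j e : Expr) (σ : State) :
      Exec (.store a i j e) σ (i.cost + j.cost + e.cost + 1)
        (σ.setArr a (i.eval σ) (j.eval σ) (e.eval σ))
  | seq {p q : Prog} {ρ σ τ : State} {s t : ℕ} (hp : Exec p ρ s σ) (hq : Exec q σ t τ) :
      Exec (.seq p q) ρ (s + t) τ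
  | branch_true {b : Expr} {p q : Prog} {σ τ : State} {t : ℕ} (hb : b.eval σ ≠ 0)
      (hp : Exec p σ t τ) : Exec (.branch b p q) σ (b.cost + 1 + t) τ
  | branch_false {b : Expr} {p q : Prog} {σ τ : State} {t : ℕ} (hb : b.eval σ = 0)
      (hq : Exec q σ t τ) : Exec (.branch b p q) σ (b.cost + 1 + t) τ
  | loop_true {b : Expr} {p : Prog} {ρ σ τ : State} {s t : ℕ} (hb : b.eval ρ ≠ 0)
      (hp : Exec p ρ s σ) (hl : Exec (.loop b p) σ t τ) :
      Exec (.loop b p) ρ (b.cost + 1 + s + t) τ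
  | loop_false {b : Expr} {p : Prog} {σ : State} (hb : b.eval σ = 0) :
      Exec (.loop b p) σ (b.cost + 1) σ

open Classical in
/-- The initial memory for a graph `G` with vertices `0, …, n - 1` and two of its vertices `u, v`:
the variables `x₀, x₁, x₂` hold `n, u, v`, the array `A₀` holds the adjacency matrix of `G`, and
every other cell is `0`. -/
noncomputable def input {n : ℕ} (G : SimpleGraph (Fin n)) (u v : Fin n) : State where
  var x := if x = 0 then n else if x = 1 then u else if x = 2 then v else 0
  arr a i j :=
    if a = 0 ∧ ∃ (hi : i < n) (hj : j < n), G.Adj ⟨i, hi⟩ ⟨j, hj⟩ then 1 else 0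

/-- The memory holds the walk `p`: the variable `x₁` holds its length `ℓ`, and the cells
`A₁[0, 0], …, A₁[ℓ, 0]` hold its vertices in order. -/
def State.Holds {n : ℕ} {G : SimpleGraph (Fin n)} {u v : Fin n} (σ : State) (p : G.Walk u v) :
    Prop :=
  σ.var 1 = p.length ∧ ∀ i ≤ p.length, σ.arr 1 i 0 = (p.getVert i : ℕ)

/-- The final memory is a correct answer to the search for a non-shortest path: either `x₀ = 1` and
the memory holds such a path, or `x₀ = 0` and there is none. -/
def State.AnswersNSP {n : ℕ} (σ : State) (G : SimpleGraph (Fin n)) (u v : Fin n) : Prop :=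
  (σ.var 0 = 1 ∧ ∃ p : G.Walk u v, IsNSP G p ∧ σ.Holds p) ∨
    (σ.var 0 = 0 ∧ ¬ ∃ p : G.Walk u v, IsNSP G p)

end RAM

/-! ### Induced paths in a layered graph -/

/-! Arrange the vertices in levels by their distance `h` from `u`, and let `k` be the distance
between `u` and `v`. Straightness says that every vertex lies on a shortest path from `u` to `v`. So
the shortest paths are those that climb one level with each edge, and from every vertex one can
climb to `v` and descend to `u` (`isLayering_dist`). Suppose that an NSP exists and let `p` be one
with the fewest edges, `m` say. It climbs from `u` to `p d`, and again from `p j` to `v`. Minimality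
enters in one form only: the vertices of any walk from `u` to `v` with fewer than `m` edges contain
a shortest path from `u` to `v` (`IsDetour.shortest`).

It is not necessary to find `p` itself. Five vertices of `p` are guessed: `p d`, `p j`, `p (j + 1)`
and the vertices of the ascending end of `p` at levels `d - 1` and `d`, if they exist. Then the two
ends of `p` are replaced by arbitrary rails: a shortest path `x` from `u` to `p d` and a shortest
path `y` from `p (j + 1)` to `v` that do not touch, where `y` passes through the guessed vertices
and `x` avoids `p j` and its neighbours before it reaches `p d`. The crucial claim is that the
middle of `p` remains compatible with any rails (`IsRails.y_apart`, `IsRails.x_apart_middle`). A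
contact would give a walk with fewer than `m` edges, and a shortest path among its vertices would
need a chord of `p` or a contact that is already excluded.

Now delete all vertices off the rails that touch them too early, and the upper neighbours of `p d`.
The walk along `x`, the middle of `p` and `y` survives (`IsRails.walkIn_corridor`), but no shortest
path of the whole graph does, because it would have to follow `x` and would get stuck at `p d`
(`not_ascends_corridor`). Hence a path with the fewest edges in the remaining corridor is an NSP,
and breadth-first search finds one.

The rails are found by breadth-first search too, in a digraph on pairs of vertices of the same
level. Touching vertices differ by at most one level, so all conditions on the rails can be tested
on single steps of such pairs (`isRails_of_steps`), and `p` itself shows that a suitable pair of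
paths exists (`IsDetour.exists_steps`). A wrong guess does no harm, as a path is reported only if
its label exceeds that of a shortest path (`Cmd.output_found`). The running time comes from the
nesting depth of bounded loops (`Cmd.exec`). -/

section Layered

variable {V : Type*} {G : SimpleGraph V}

/-- Two vertices touch if they are equal or adjacent. -/
def Touch (G : SimpleGraph V) (x y : V) : Prop := x = y ∨ G.Adj x y

theorem Touch.symm {x y : V} (h : Touch G x y) : Touch G y x :=
  h.imp Eq.symm SimpleGraph.Adj.symm

/-- There is a walk from `x` to `y` in `Y` with at most `l` edges. -/
def WalkIn (G : SimpleGraph V) (Y : Set V) (l : ℕ) (x y : V) : Prop :=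
  ∃ w : G.Walk x y, w.length ≤ l ∧ ∀ z ∈ w.support, z ∈ Y

namespace WalkIn

variable {Y : Set V} {l l' : ℕ} {x y z : V}

theorem trans (h₁ : WalkIn G Y l x y) (h₂ : WalkIn G Y l' y z) : WalkIn G Y (l + l') x z := by
  obtain ⟨w₁, hl₁, hs₁⟩ := h₁
  obtain ⟨w₂, hl₂, hs₂⟩ := h₂
  refine ⟨w₁.append w₂, by rw [SimpleGraph.Walk.length_append]; omega, fun z hz => ?_⟩
  rw [SimpleGraph.Walk.mem_support_append_iff] at hz
  exact hz.elim (hs₁ z) (hs₂ z)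

theorem symm (h : WalkIn G Y l x y) : WalkIn G Y l y x := by
  obtain ⟨w, hl, hs⟩ := h
  exact ⟨w.reverse, by simpa using hl, fun z hz => hs z (by simpa using hz)⟩

theorem mono (h : WalkIn G Y l x y) (hl : l ≤ l') : WalkIn G Y l' x y := by
  obtain ⟨w, hw, hs⟩ := h
  exact ⟨w, hw.trans hl, hs⟩

theorem of_touch (h : Touch G x y) (hx : x ∈ Y) (hy : y ∈ Y) : WalkIn G Y 1 x y := by
  rcases h with rfl | h
  · exact ⟨.nil, by simp, by simpa using hx⟩
  · exact ⟨.cons h .nil, by simp, by simp [hx, hy]⟩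

theorem of_seq {f : ℕ → V} {a b : ℕ} (hab : a ≤ b)
    (hadj : ∀ i, a ≤ i → i < b → G.Adj (f i) (f (i + 1)))
    (hY : ∀ i, a ≤ i → i ≤ b → f i ∈ Y) : WalkIn G Y (b - a) (f a) (f b) := by
  induction b, hab using Nat.le_induction with
  | base => exact ⟨.nil, by simp, by simpa using hY a le_rfl le_rfl⟩
  | succ b hb ih =>
    have h₁ := ih (fun i h₁ h₂ => hadj i h₁ (by omega)) (fun i h₁ h₂ => hY i h₁ (by omega))
    exact (h₁.trans (of_touch (Or.inr (hadj b hb (by omega))) (hY b hb (by omega))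
      (hY (b + 1) (by omega) le_rfl))).mono (by omega)

end WalkIn

/-- `h` is the distance from `u`, the distance from `u` to `v` is `k`, and every vertex is on a
shortest path from `u` to `v`. -/
structure IsLayering (G : SimpleGraph V) (u v : V) (h : V → ℕ) (k : ℕ) : Prop where
  bot : h u = 0
  eq_bot : ∀ x, h x = 0 → x = u
  top : h v = k
  eq_top : ∀ x, h x = k → x = v
  le_top : ∀ x, h x ≤ k
  adj : ∀ x y, G.Adj x y → h x ≤ h y + 1
  down : ∀ x, 0 < h x → ∃ y, G.Adj y x ∧ h y + 1 = h x
  up : ∀ x, h x < k → ∃ y, G.Adj x y ∧ h y = h x + 1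

/-- The sequence `f` climbs one level with each step, and `f i` has level `i`. -/
structure Ascends (G : SimpleGraph V) (h : V → ℕ) (f : ℕ → V) (a b : ℕ) : Prop where
  level : ∀ i, a ≤ i → i ≤ b → h (f i) = i
  adj : ∀ i, a ≤ i → i < b → G.Adj (f i) (f (i + 1))

variable {u v : V} {h : V → ℕ} {k : ℕ}

theorem IsLayering.touch_le (hL : IsLayering G u v h k) {x y : V} (hxy : Touch G x y) :
    h x ≤ h y + 1 := by
  rcases hxy with rfl | hxy
  · omega
  · exact hL.adj _ _ hxy

/-- There is a shortest path from `u` to any vertex. -/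
theorem IsLayering.exists_ascends_to (hL : IsLayering G u v h k) (x : V) :
    ∃ f, Ascends G h f 0 (h x) ∧ f (h x) = x := by
  induction hx : h x generalizing x with
  | zero =>
    exact ⟨fun _ => x, ⟨fun i _ hi => by simp at hi; simp [hi, hx], fun i _ hi => by omega⟩, rfl⟩
  | succ n ih =>
    obtain ⟨y, hyx, hy⟩ := hL.down x (by omega)
    obtain ⟨f, hf, hfy⟩ := ih y (by omega)
    refine ⟨fun i => if i ≤ n then f i else x, ⟨fun i _ hi => ?_, fun i _ hi => ?_⟩, by simp⟩
    · by_cases hin : i ≤ n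
      · simpa [hin] using hf.level i (by omega) hin
      · simp only [hin, if_false]; omega
    · by_cases hin : i + 1 ≤ n
      · simpa [hin, show i ≤ n by omega] using hf.adj i (by omega) (by omega)
      · obtain rfl : i = n := by omega
        simpa [hfy] using hyx

/-- There is a shortest path from any vertex to `v`. -/
theorem IsLayering.exists_ascends_from (hL : IsLayering G u v h k) (x : V) :
    ∃ f, Ascends G h f (h x) k ∧ f (h x) = x := by
  induction hx : k - h x generalizing x with
  | zero =>
    have := hL.le_top x
    exact ⟨fun _ => x, ⟨fun i _ _ => by omega, fun i _ _ => by omega⟩, rfl⟩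
  | succ n ih =>
    obtain ⟨y, hxy, hy⟩ := hL.up x (by omega)
    obtain ⟨f, hf, hfy⟩ := ih y (by omega)
    refine ⟨fun i => if i ≤ h x then x else f i, ⟨fun i _ hi => ?_, fun i _ hi => ?_⟩, by simp⟩
    · by_cases hin : i ≤ h x
      · simp only [hin, if_true]; omega
      · simpa [hin] using hf.level i (by omega) hi
    · by_cases hin : i ≤ h x
      · obtain rfl : i = h x := by omega
        have : ¬ h x + 1 ≤ h x := by omega
        rw [if_pos le_rfl, if_neg this, ← hy, hfy]
        exact hxy
      · simpa [hin, show ¬ i + 1 ≤ h x by omega] using hf.adj i (by omega) (by omega)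

theorem Ascends.bot (hL : IsLayering G u v h k) {f : ℕ → V} {b : ℕ} (hf : Ascends G h f 0 b) :
    f 0 = u := hL.eq_bot _ (hf.level 0 le_rfl (by omega))

theorem Ascends.top (hL : IsLayering G u v h k) {f : ℕ → V} {a : ℕ} (ha : a ≤ k)
    (hf : Ascends G h f a k) : f k = v := hL.eq_top _ (hf.level k ha le_rfl)

/-- A shortest non-shortest path `p`, of length `m`.  It ascends up to `p d`, but not to
`p (d + 1)`, and it ascends from `p j` on, but not from `p (j - 1)`. -/
structure IsDetour (G : SimpleGraph V) (u v : V) (h : V → ℕ) (k : ℕ) (p : ℕ → V) (m d j : ℕ) :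
    Prop where
  first : p 0 = u
  last : p m = v
  adj : ∀ i < m, G.Adj (p i) (p (i + 1))
  induced : ∀ i l, i + 1 < l → l ≤ m → ¬ Touch G (p i) (p l)
  head : ∀ i ≤ d, h (p i) = i
  turn : h (p (d + 1)) ≤ d
  tail : ∀ i, j ≤ i → i ≤ m → h (p i) + m = k + i
  bend : h (p j) ≤ h (p (j - 1))
  d_lt_j : d < j
  j_lt_m : j < m
  d_lt_k : d < k
  shortest : ∀ Y l, WalkIn G Y l u v → l < m → ∃ f, Ascends G h f 0 k ∧ ∀ i ≤ k, f i ∈ Y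

/-- Shortest paths `x`, from `u` to `p d`, and `y`, from `p (j + 1)` to `v`, that do not touch
and have some vertices in common with `p`. -/
structure IsRails (G : SimpleGraph V) (h : V → ℕ) (k : ℕ) (p : ℕ → V) (m d j c : ℕ)
    (x y : ℕ → V) : Prop where
  level : c + m = k + j + 1
  x_asc : Ascends G h x 0 d
  x_last : x d = p d
  y_asc : Ascends G h y c k
  y_first : y c = p (j + 1)
  apart : ∀ i l, i ≤ d → c ≤ l → l ≤ k → ¬ Touch G (x i) (y l)
  agree : ∀ l, c ≤ l → l ≤ k → l + 1 = d ∨ l = d → y l = p (j + 1 + (l - c))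
  x_apart : ∀ i < d, ¬ Touch G (x i) (p j)

variable {p : ℕ → V} {m d j c : ℕ} {x y : ℕ → V}

/-! ### Metric properties of a shortest non-shortest path. -/

namespace IsDetour

/-- Here `c` is the level of `p (j + 1)`. It is at least two because `p j` is not `u`: otherwise the
edge from `p j` to `p (j + 1)` would be a chord of `p` at `p 0`. -/
theorem c_pos (hL : IsLayering G u v h k) (hP : IsDetour G u v h k p m d j)
    (hc : c + m = k + j + 1) : 2 ≤ c ∧ c ≤ k := by
  have h₁ := hP.tail j le_rfl hP.j_lt_m.le
  have h₂ := hP.j_lt_m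
  have h₃ : h (p j) ≠ 0 := fun h0 => by
    refine hP.induced 0 (j + 1) (by have := hP.d_lt_j; omega) h₂ ?_
    rw [hP.first, ← hL.eq_bot _ h0]
    exact Or.inr (hP.adj j h₂)
  omega

/-- The length of a detour. -/
theorem two_mul_le (hL : IsLayering G u v h k) (hP : IsDetour G u v h k p m d j)
    (hc : c + m = k + j + 1) : 2 * d + 1 ≤ j + c := by
  -- An edge lowers the level by at most one, and `p` has to get from level `d` at `p d` to level `c
  -- - 1` at `p j` within `j - d` edges.
  have key : ∀ i, d + i ≤ m → d ≤ h (p (d + i)) + i := by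
    intro i
    induction i with
    | zero => intro _; have := hP.head d le_rfl; simp [this]
    | succ i ih =>
      intro hi
      have h₁ := ih (by omega)
      have h₂ := hL.adj _ _ (hP.adj (d + i) (by omega))
      have : d + (i + 1) = d + i + 1 := by omega
      rw [this]; omega
  have h₁ := hP.tail j le_rfl hP.j_lt_m.le
  have h₂ := hP.d_lt_j
  have h₃ := key (j - d) (by have := hP.j_lt_m; omega)
  rw [show d + (j - d) = j by omega] at h₃
  omega

/-- An ascending path in an initial piece of a detour runs along it. -/
theorem eq_of_ascends (hL : IsLayering G u v h k) (hP : IsDetour G u v h k p m d j)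
    {f : ℕ → V} {b : ℕ} (hf : Ascends G h f 0 b) (hmem : ∀ i ≤ b, ∃ l ≤ j, f i = p l) :
    ∀ i ≤ b, f i = p i ∧ i ≤ j := by
  intro i
  induction i using Nat.strong_induction_on with
  | _ i ih =>
    intro hi
    have hm := hP.j_lt_m
    obtain ⟨l, hl, hfl⟩ := hmem i hi
    rcases i with _ | i
    · exact ⟨by rw [hP.first]; exact hf.bot hL, by omega⟩
    obtain ⟨h₁, h₂⟩ := ih i (by omega) (by omega)
    have hadj := hf.adj i (by omega) (by omega)
    have hlev := hf.level (i + 1) (by omega) hi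
    rw [h₁, hfl] at hadj
    -- As `p` is induced, a neighbour of `p i` on `p` is `p (i - 1)` or `p (i + 1)`. The former
    -- equals `f (i - 1)` by induction, so its level is too small.
    have h₃ : ¬ i + 1 < l := fun hil => hP.induced i l hil (by omega) (Or.inr hadj)
    have h₄ : ¬ l + 1 < i := fun hil => hP.induced l i hil (by omega) (Or.inr hadj.symm)
    have h₅ : l ≠ i := by rintro rfl; exact hadj.ne rfl
    have h₆ : l + 1 ≠ i := by
      rintro rfl
      have h₇ := hf.level l (by omega) (by omega)
      rw [(ih l (by omega) (by omega)).1, ← hfl] at h₇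
      omega
    obtain rfl : l = i + 1 := by omega
    exact ⟨hfl, hl⟩

end IsDetour

theorem exists_greatest {Q : ℕ → Prop} {l n : ℕ} (hl : l ≤ n) (hQ : Q l) :
    ∃ b ≤ n, Q b ∧ ∀ i, b < i → i ≤ n → ¬ Q i := by
  classical
  exact ⟨Nat.findGreatest Q n, Nat.findGreatest_le n, Nat.findGreatest_spec hl hQ,
    fun i h₁ h₂ => Nat.findGreatest_is_greatest h₁ h₂⟩

theorem exists_least {Q : ℕ → Prop} {l : ℕ} (hQ : Q l) :
    ∃ b ≤ l, Q b ∧ ∀ i < b, ¬ Q i := by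
  classical
  exact ⟨Nat.find ⟨l, hQ⟩, Nat.find_min' ⟨l, hQ⟩ hQ, Nat.find_spec ⟨l, hQ⟩,
    fun i hi => Nat.find_min ⟨l, hQ⟩ hi⟩

/-! ### Arbitrary rails are compatible with the middle of the detour. -/

namespace IsRails

/-- The last vertex of `y` that touches the part of `p` up to `p j` is close to the ascending
start of `p`. -/
theorem contact (hL : IsLayering G u v h k) (hP : IsDetour G u v h k p m d j)
    (hR : IsRails G h k p m d j c x y) {b : ℕ} (hcb : c < b) (hbk : b ≤ k)
    (hb : ∃ i ≤ j, Touch G (y b) (p i))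
    (hmax : ∀ l, b < l → l ≤ k → ∀ i ≤ j, ¬ Touch G (y l) (p i)) :
    b + 2 ≤ d ∧ Touch G (y b) (p (b - 1)) := by
  obtain ⟨i₀, hi₀, ht₀⟩ := hb
  have hm := hP.j_lt_m
  have hc := hR.level
  have hyk : y k = v := hR.y_asc.top hL (by omega)
  -- The walk along `p` to `p i₀`, across to `y b` and up to `v` has fewer than `m` edges because `c
  -- < b`. So its vertices contain a shortest path `f`.
  let Y : Set V := {z | (∃ i ≤ j, z = p i) ∨ ∃ l, b ≤ l ∧ l ≤ k ∧ z = y l}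
  have hw : WalkIn G Y (i₀ - 0 + 1 + (k - b)) u v := by
    rw [← hP.first, ← hyk]
    refine ((WalkIn.of_seq (Nat.zero_le _) (fun i _ hi => hP.adj i (by omega))
      fun i _ hi => Or.inl ⟨i, by omega, rfl⟩).trans (WalkIn.of_touch ht₀.symm
      (Or.inl ⟨i₀, hi₀, rfl⟩) (Or.inr ⟨b, le_rfl, hbk, rfl⟩))).trans
      (WalkIn.of_seq hbk (fun i h₁ h₂ => hR.y_asc.adj i (by omega) h₂)
      fun i h₁ h₂ => Or.inr ⟨i, h₁, h₂, rfl⟩)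
  obtain ⟨f, hf, hfY⟩ := hP.shortest Y _ hw (by omega)
  have hfk : f k = y k := by rw [hyk]; exact hf.top hL (by omega)
  -- This `n` is the level at which `f` first uses `y`. Before that `f` climbs along `p`, hence
  -- within the ascending start of `p`, and by the choice of `b` it can enter `y` only at `y b`.
  obtain ⟨n, hnk, ⟨hbn, hfn⟩, hmin⟩ :=
    exists_least (Q := fun n => b ≤ n ∧ f n = y n) (l := k) ⟨hbk, hfk⟩
  have hp : ∀ i < n, ∃ l ≤ j, f i = p l := by
    intro i hi
    rcases hfY i (by omega) with h₁ | ⟨l, h₁, h₂, h₃⟩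
    · exact h₁
    · have h₄ := hf.level i (by omega) (by omega)
      rw [h₃, hR.y_asc.level l (by omega) h₂] at h₄
      subst h₄
      exact absurd ⟨h₁, h₃⟩ (hmin l hi)
  obtain ⟨n, rfl⟩ : ∃ n', n = n' + 1 := ⟨n - 1, by omega⟩
  have hadj := hf.adj n (by omega) (by omega)
  have hfp := hP.eq_of_ascends hL (b := n) ⟨fun i h₁ h₂ => hf.level i h₁ (by omega),
    fun i h₁ h₂ => hf.adj i h₁ (by omega)⟩ (fun i hi => hp i (by omega))
  obtain ⟨h₁, h₂⟩ := hfp n le_rfl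
  rw [h₁, hfn] at hadj
  have hnb : n + 1 = b := by
    by_contra hne
    exact hmax (n + 1) (by omega) hnk n h₂ (Or.inr hadj.symm)
  have hnd : n ≤ d := by
    by_contra hnd
    have h₃ := hf.level (d + 1) (by omega) (by omega)
    rw [(hfp (d + 1) (by omega)).1] at h₃
    have := hP.turn
    omega
  subst hnb
  -- If `b` were `d - 1` or `d`, then `y b` would be a vertex of `p` beyond `p (j + 1)`, which
  -- touches nothing on `p` up to `p j`. This is the purpose of the guesses at these two levels.
  have hag : ¬ (n + 1 + 1 = d ∨ n + 1 = d) := by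
    intro hnd
    rw [hR.agree (n + 1) (by omega) hbk hnd] at ht₀
    exact hP.induced _ _ (by omega) (by omega) ht₀.symm
  have hn : n ≠ d := by
    rintro rfl
    refine hR.apart n (n + 1) le_rfl (by omega) hbk ?_
    rw [hR.x_last]
    exact Or.inr hadj
  exact ⟨by omega, Or.inr hadj.symm⟩

/-- Otherwise one could climb `x` to `p d`, descend along `p` to `p g`, cross to `y b` and climb to
`v`. This takes fewer than `m` edges, by `2 * d < j + c` and `c < b ≤ g`. A shortest path among
these vertices first enters `y` either from `x`, against `apart`, or from some `p i` with `g ≤ i`,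
and then it arrives above level `b`, against the maximality of `b`. -/
theorem not_touch_above (hL : IsLayering G u v h k) (hP : IsDetour G u v h k p m d j)
    (hR : IsRails G h k p m d j c x y) {b : ℕ} (hcb : c < b) (hbk : b ≤ k)
    (hmax : ∀ l, b < l → l ≤ k → ∀ i ≤ j, ¬ Touch G (y l) (p i)) {g : ℕ} (hbg : b ≤ g)
    (hgd : g ≤ d) : ¬ Touch G (y b) (p g) := by
  intro ht
  have hm := hP.j_lt_m
  have hdj := hP.d_lt_j
  have hc := hR.level
  have h2d := hP.two_mul_le hL hc
  have hyk : y k = v := hR.y_asc.top hL (by omega)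
  let Y : Set V := {z | (∃ i ≤ d, z = x i) ∨ (∃ i, g ≤ i ∧ i ≤ d ∧ z = p i) ∨
    ∃ l, b ≤ l ∧ l ≤ k ∧ z = y l}
  have hw : WalkIn G Y (d - 0 + (d - g) + 1 + (k - b)) u v := by
    rw [← hR.x_asc.bot hL, ← hyk]
    refine (((WalkIn.of_seq (Nat.zero_le _) hR.x_asc.adj fun i _ hi => Or.inl ⟨i, hi, rfl⟩).trans
      ?_).trans (WalkIn.of_touch ht.symm (Or.inr (Or.inl ⟨g, le_rfl, hgd, rfl⟩))
      (Or.inr (Or.inr ⟨b, le_rfl, hbk, rfl⟩)))).trans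
      (WalkIn.of_seq hbk (fun i h₁ h₂ => hR.y_asc.adj i (by omega) h₂)
      fun i h₁ h₂ => Or.inr (Or.inr ⟨i, h₁, h₂, rfl⟩))
    rw [hR.x_last]
    exact (WalkIn.of_seq hgd (fun i _ hi => hP.adj i (by omega))
      fun i h₁ h₂ => Or.inr (Or.inl ⟨i, h₁, h₂, rfl⟩)).symm
  obtain ⟨f, hf, hfY⟩ := hP.shortest Y _ hw (by omega)
  have hfk : f k = y k := by rw [hyk]; exact hf.top hL (by omega)
  obtain ⟨n, hnk, ⟨hbn, hfn⟩, hmin⟩ :=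
    exists_least (Q := fun n => b ≤ n ∧ f n = y n) (l := k) ⟨hbk, hfk⟩
  obtain ⟨n, rfl⟩ : ∃ n', n = n' + 1 := ⟨n - 1, by omega⟩
  have hadj := hf.adj n (by omega) (by omega)
  have hlev := hf.level n (by omega) (by omega)
  rw [hfn] at hadj
  rcases hfY n (by omega) with ⟨i, h₁, h₂⟩ | ⟨i, h₁, h₂, h₃⟩ | ⟨l, h₁, h₂, h₃⟩
  · rw [h₂] at hadj
    exact hR.apart i (n + 1) h₁ (by omega) hnk (Or.inr hadj)
  · rw [h₃] at hadj hlev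
    rw [hP.head i h₂] at hlev
    rcases Nat.lt_or_ge b (n + 1) with h₄ | h₄
    · exact hmax (n + 1) h₄ hnk i (by omega) (Or.inr hadj.symm)
    · omega
  · rw [h₃, hR.y_asc.level l (by omega) h₂] at hlev
    subst hlev
    exact hmin l (by omega) ⟨h₁, h₃⟩

/-- The path `y` does not touch `p`, other than at its first vertex and in the ascending end
of `p`. -/
theorem y_apart (hL : IsLayering G u v h k) (hP : IsDetour G u v h k p m d j)
    (hR : IsRails G h k p m d j c x y) {l i : ℕ} (hcl : c < l) (hlk : l ≤ k) (hi : i ≤ j) :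
    ¬ Touch G (y l) (p i) := by
  intro ht
  obtain ⟨b, hbk, ⟨hcb, hb⟩, hmax⟩ := exists_greatest
    (Q := fun l => c < l ∧ ∃ i ≤ j, Touch G (y l) (p i)) hlk ⟨hcl, i, hi, ht⟩
  replace hmax : ∀ l, b < l → l ≤ k → ∀ i ≤ j, ¬ Touch G (y l) (p i) :=
    fun l h₁ h₂ i h₃ h₄ => hmax l h₁ h₂ ⟨by omega, i, h₃, h₄⟩
  obtain ⟨hbd, hb1⟩ := hR.contact hL hP hcb hbk hb hmax
  have hm := hP.j_lt_m
  have hdj := hP.d_lt_j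
  have hdk := hP.d_lt_k
  have hc := hR.level
  have h2d := hP.two_mul_le hL hc
  have h2c := hP.c_pos hL hc
  have hyk : y k = v := hR.y_asc.top hL (by omega)
  have hpj : h (p j) = c - 1 := by have := hP.tail j le_rfl hm.le; omega
  -- The competing walk climbs `D` to `p j`, follows `p` up to level `d - 1`, where `p` and `y`
  -- agree, descends along `y` to `y b`, crosses to `p (b - 1)`, climbs `p` to `p d` and ends along
  -- `S`. It has `k + 2 * d - 2 * b` edges, and this is less than `m`.
  obtain ⟨D, hD, hDj⟩ := hL.exists_ascends_to (p j)
  obtain ⟨S, hS, hSd⟩ := hL.exists_ascends_from (p d)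
  rw [hpj] at hD hDj
  rw [hP.head d le_rfl] at hS hSd
  have hyd := hR.agree (d - 1) (by omega) (by omega) (by omega)
  rw [show j + 1 + (d - 1 - c) = j + d - c by omega] at hyd
  let B : Set V := {z | (∃ i, b - 1 ≤ i ∧ i ≤ d ∧ z = p i) ∨ ∃ i, d ≤ i ∧ i ≤ k ∧ z = S i}
  let Y : Set V := {z | (∃ i ≤ c - 1, z = D i) ∨ (∃ i, j ≤ i ∧ i ≤ j + d - c ∧ z = p i) ∨
    (∃ l, b ≤ l ∧ l ≤ d - 1 ∧ z = y l) ∨ z ∈ B}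
  have hw : WalkIn G Y (c - 1 - 0 + (j + d - c - j) + (d - 1 - b) + 1 + (d - (b - 1)) + (k - d))
      u v := by
    rw [← hD.bot hL, ← hS.top hL (by omega)]
    refine (WalkIn.trans (WalkIn.trans (y := y (d - 1)) ((WalkIn.of_seq (Nat.zero_le _) hD.adj
      fun i _ hi => Or.inl ⟨i, hi, rfl⟩).trans ?_) ?_)
      (WalkIn.of_touch hb1 (Or.inr (Or.inr (Or.inl ⟨b, le_rfl, by omega, rfl⟩)))
      (Or.inr (Or.inr (Or.inr (Or.inl ⟨b - 1, le_rfl, by omega, rfl⟩)))))).trans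
      (WalkIn.of_seq (by omega) (fun i _ hi => hP.adj i (by omega))
      fun i h₁ h₂ => Or.inr (Or.inr (Or.inr (Or.inl ⟨i, h₁, h₂, rfl⟩)))) |>.trans ?_
    · rw [hDj, hyd]
      exact WalkIn.of_seq (by omega) (fun i _ hi => hP.adj i (by omega))
        fun i h₁ h₂ => Or.inr (Or.inl ⟨i, h₁, h₂, rfl⟩)
    · exact (WalkIn.of_seq (by omega) (fun i h₁ h₂ => hR.y_asc.adj i (by omega) (by omega))
        fun i h₁ h₂ => Or.inr (Or.inr (Or.inl ⟨i, h₁, h₂, rfl⟩))).symm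
    · rw [← hSd]
      exact WalkIn.of_seq (by omega) (fun i h₁ h₂ => hS.adj i h₁ h₂)
        fun i h₁ h₂ => Or.inr (Or.inr (Or.inr (Or.inr ⟨i, h₁, h₂, rfl⟩)))
  obtain ⟨f, hf, hfY⟩ := hP.shortest Y _ hw (by omega)
  have hfk : f k ∈ B := by
    rw [hf.top hL (by omega), ← hS.top hL (by omega)]
    exact Or.inr ⟨k, by omega, le_rfl, rfl⟩
  -- Consider where the shortest path `f` first enters `B`. The walk outside `B` stays below level
  -- `d`, so the entry is a vertex `p n` with `n ≤ d`. The edge leading to it is a chord of `p`, or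
  -- a contact with `y` that the choice of `b` or `not_touch_above` excludes.
  obtain ⟨n, hnk, hfn, hmin⟩ := exists_least (Q := fun n => f n ∈ B) hfk
  have hn := hf.level n (by omega) hnk
  have hBn : (b - 1 ≤ n ∧ n ≤ d ∧ f n = p n) ∨ d < n := by
    rcases hfn with ⟨i, h₁, h₂, h₃⟩ | ⟨i, h₁, h₂, h₃⟩
    · rw [h₃, hP.head i h₂] at hn
      subst hn
      exact Or.inl ⟨h₁, h₂, h₃⟩
    · rw [h₃, hS.level i h₁ h₂] at hn
      subst hn
      rcases Nat.lt_or_ge d i with h₄ | h₄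
      · exact Or.inr h₄
      · obtain rfl : i = d := by omega
        exact Or.inl ⟨by omega, h₄, by rw [h₃, hSd]⟩
  obtain ⟨n, rfl⟩ : ∃ n', n = n' + 1 := ⟨n - 1, by omega⟩
  have hadj := hf.adj n (by omega) (by omega)
  have hlev := hf.level n (by omega) (by omega)
  rcases hfY n (by omega) with ⟨i, h₁, h₂⟩ | ⟨i, h₁, h₂, h₃⟩ | ⟨l, h₁, h₂, h₃⟩ | h₁
  · rw [h₂, hD.level i (by omega) h₁] at hlev
    subst hlev
    obtain rfl : i = c - 1 := by omega
    rcases hBn with ⟨_, h₄, h₅⟩ | h₄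
    · rw [h₂, hDj, h₅] at hadj
      exact hP.induced _ _ (by omega) (by omega) (Or.inr hadj.symm)
    · omega
  · have h₆ := hP.tail i h₁ (by omega)
    rw [← h₃, hlev] at h₆
    rcases hBn with ⟨_, h₄, h₅⟩ | h₄
    · rw [h₃, h₅] at hadj
      exact hP.induced _ _ (by omega) (by omega) (Or.inr hadj.symm)
    · omega
  · rw [h₃, hR.y_asc.level l (by omega) (by omega)] at hlev
    subst hlev
    rcases hBn with ⟨_, h₄, h₅⟩ | h₄
    · rw [h₃, h₅] at hadj
      rcases Nat.lt_or_ge b l with h₆ | h₆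
      · exact hmax l h₆ (by omega) _ (by omega) (Or.inr hadj)
      · obtain rfl : l = b := by omega
        exact hR.not_touch_above hL hP hcb hbk hmax (Nat.le_succ _) h₄ (Or.inr hadj)
    · omega
  · exact hmin n (by omega) h₁

/-- The path `x` does not touch `p` between `p d` and `p (j + 1)`. -/
theorem x_apart_middle (hL : IsLayering G u v h k) (hP : IsDetour G u v h k p m d j)
    (hR : IsRails G h k p m d j c x y) {a i : ℕ} (ha : a < d) (hdi : d < i) (hi : i ≤ j) :
    ¬ Touch G (x a) (p i) := by
  intro ht
  have hm := hP.j_lt_m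
  have hdk := hP.d_lt_k
  have hc := hR.level
  have h2c := hP.c_pos hL hc
  have hyk : y k = v := hR.y_asc.top hL (by omega)
  -- A contact gives the walk along `x` to `x a`, across to `p i`, on to `p (j + 1)` and up along
  -- `y`. It has fewer than `m` edges because `a + 1 < i`.
  let T : Set V := {z | ∃ l, c ≤ l ∧ l ≤ k ∧ z = y l}
  let Y : Set V := {z | (∃ i ≤ a, z = x i) ∨ (∃ l, i ≤ l ∧ l ≤ j ∧ z = p l) ∨ z ∈ T}
  have hpT : p (j + 1) ∈ T := ⟨c, le_rfl, by omega, hR.y_first.symm⟩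
  have hw : WalkIn G Y (a - 0 + 1 + (j + 1 - i) + (k - c)) u v := by
    rw [← hR.x_asc.bot hL, ← hyk]
    refine (((WalkIn.of_seq (Nat.zero_le _) (fun i h₁ h₂ => hR.x_asc.adj i h₁ (by omega))
      fun i _ hi => Or.inl ⟨i, hi, rfl⟩).trans (WalkIn.of_touch ht (Or.inl ⟨a, le_rfl, rfl⟩)
      (Or.inr (Or.inl ⟨i, le_rfl, hi, rfl⟩)))).trans (WalkIn.of_seq (f := p) (b := j + 1) (by omega)
      (fun l _ hl => hP.adj l (by omega)) fun l h₁ h₂ => ?_)).trans ?_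
    · rcases Nat.lt_or_ge j l with h₃ | h₃
      · obtain rfl : l = j + 1 := by omega
        exact Or.inr (Or.inr hpT)
      · exact Or.inr (Or.inl ⟨l, h₁, h₃, rfl⟩)
    · rw [← hR.y_first]
      exact WalkIn.of_seq (by omega) hR.y_asc.adj
        fun l h₁ h₂ => Or.inr (Or.inr ⟨l, h₁, h₂, rfl⟩)
  obtain ⟨f, hf, hfY⟩ := hP.shortest Y _ hw (by omega)
  have hf0 : f 0 = x 0 := by rw [hf.bot hL, hR.x_asc.bot hL]
  have hfk : f k ∈ T := ⟨k, by omega, le_rfl, by rw [hyk]; exact hf.top hL (by omega)⟩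
  obtain ⟨n, hnk, ⟨hna, hfn⟩, hmax⟩ := exists_greatest (Q := fun n => n ≤ a ∧ f n = x n)
    (Nat.zero_le k) ⟨Nat.zero_le a, hf0⟩
  have hx : ∀ e, n < e → e ≤ k → ¬ ∃ i ≤ a, f e = x i := by
    rintro e h₁ h₂ ⟨i, h₃, h₄⟩
    have h₅ := hf.level e (by omega) h₂
    rw [h₄, hR.x_asc.level i (by omega) (by omega)] at h₅
    subst h₅
    exact hmax i h₁ h₂ ⟨h₃, h₄⟩
  obtain ⟨e, hek, ⟨hne, l, hcl, hlk, hel⟩, hmin⟩ := exists_least (Q := fun e => n < e ∧ f e ∈ T)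
    (l := k) ⟨by omega, hfk⟩
  obtain ⟨e, rfl⟩ : ∃ e', e = e' + 1 := ⟨e - 1, by omega⟩
  have hadj := hf.adj e (by omega) (by omega)
  have hlev := hf.level (e + 1) (by omega) (by omega)
  rw [hel, hR.y_asc.level l hcl hlk] at hlev
  subst hlev
  have hen : n ≠ e := by
    rintro rfl
    rw [hfn, hel] at hadj
    exact hR.apart n (n + 1) (by omega) hcl hlk (Or.inr hadj)
  have hmid : ∀ e', n < e' → e' ≤ e → ∃ l, i ≤ l ∧ l ≤ j ∧ f e' = p l := by
    intro e' h₁ h₂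
    rcases hfY e' (by omega) with h₃ | h₃ | h₃
    · exact absurd h₃ (hx e' h₁ (by omega))
    · exact h₃
    · exact absurd ⟨h₁, h₃⟩ (hmin e' (by omega))
  obtain ⟨l, hil, hlj, hfe⟩ := hmid e (by omega) le_rfl
  rw [hfe, hel] at hadj
  -- By `y_apart`, a path coming from the middle of `p` can enter `y` only at `y c`, that is at `p
  -- (j + 1)`, and therefore only from `p j`.
  have hce : c = e + 1 := by
    by_contra hce
    exact hR.y_apart hL hP (by omega) hlk hlj (Or.inr hadj.symm)
  rw [← hce, hR.y_first] at hadj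
  obtain rfl : l = j := by
    by_contra hlj'
    exact hP.induced l (j + 1) (by omega) (by omega) (Or.inr hadj)
  obtain ⟨e, rfl⟩ : ∃ e', e = e' + 1 := ⟨e - 1, by omega⟩
  have hadj' := hf.adj e (by omega) (by omega)
  rw [hfe] at hadj'
  -- The predecessor of `p j` on `f` is either `p (j - 1)`, which is not below `p j` by `bend`, or a
  -- vertex of `x`, which does not touch `p j` by `x_apart`.
  rcases Nat.lt_or_ge n e with h₁ | h₁
  · obtain ⟨l', h₂, h₃, h₄⟩ := hmid e h₁ (by omega)
    have h₅ := hf.level e (by omega) (by omega)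
    have h₆ := hf.level (e + 1) (by omega) (by omega)
    rw [hfe] at h₆
    rw [h₄] at hadj' h₅
    have h₇ : ¬ l' + 1 < l := fun h₈ => hP.induced l' l h₈ hm.le (Or.inr hadj')
    have h₈ : l' ≠ l := by rintro rfl; exact hadj'.ne rfl
    have h₉ := hP.bend
    rw [show l - 1 = l' by omega] at h₉
    omega
  · obtain rfl : e = n := by omega
    rw [hfn] at hadj'
    exact hR.x_apart e (by omega) (Or.inr hadj')

end IsRails

/-- The vertices of the paths `x` and `y`, and those that do not touch them too early and are not
above `x d`. -/
def Corridor (G : SimpleGraph V) (h : V → ℕ) (k d c : ℕ) (x y : ℕ → V) : Set V :=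
  {z | (∃ i ≤ d, x i = z) ∨ (∃ l, c ≤ l ∧ l ≤ k ∧ y l = z) ∨
    ((∀ i < d, ¬ Touch G (x i) z) ∧ (∀ l, c < l → l ≤ k → ¬ Touch G (y l) z) ∧
      ¬ (G.Adj (x d) z ∧ d < h z))}

/-- The walk is `p` with its two ends replaced by `x` and `y`. Its middle survives the deletions by
`x_apart_middle` and `y_apart`. The only neighbour of `p d` in the middle is `p (d + 1)`, which is
not above level `d` by `turn`. -/
theorem IsRails.walkIn_corridor (hL : IsLayering G u v h k) (hP : IsDetour G u v h k p m d j)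
    (hR : IsRails G h k p m d j c x y) : WalkIn G (Corridor G h k d c x y) m u v := by
  have hm := hP.j_lt_m
  have hdj := hP.d_lt_j
  have hc := hR.level
  have h2c := hP.c_pos hL hc
  rw [← hR.x_asc.bot hL, ← hR.y_asc.top hL (by omega)]
  refine (((WalkIn.of_seq (Nat.zero_le d) hR.x_asc.adj fun i _ hi => Or.inl ⟨i, hi, rfl⟩).trans
    (z := y c) ?_).trans (l' := k - c) ?_).mono
    (show d - 0 + (j + 1 - d) + (k - c) ≤ m by omega)
  · rw [hR.x_last, hR.y_first]
    refine WalkIn.of_seq (by omega) (fun i _ hi => hP.adj i (by omega)) fun i h₁ h₂ => ?_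
    rcases Nat.lt_or_ge d i with h₃ | h₃
    · rcases Nat.lt_or_ge j i with h₄ | h₄
      · exact Or.inr (Or.inl ⟨c, le_rfl, h2c.2, by rw [hR.y_first]; congr 1; omega⟩)
      · refine Or.inr (Or.inr ⟨fun i' hi' => hR.x_apart_middle hL hP hi' h₃ h₄,
          fun l h₅ h₆ => hR.y_apart hL hP h₅ h₆ h₄, ?_⟩)
        rintro ⟨h₅, h₆⟩
        rw [hR.x_last] at h₅
        have h₇ : ¬ d + 1 < i := fun h₈ => hP.induced d i h₈ (by omega) (Or.inr h₅)
        have h₈ := hP.turn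
        rw [show d + 1 = i by omega] at h₈
        omega
    · obtain rfl : i = d := by omega
      exact Or.inl ⟨i, le_rfl, hR.x_last⟩
  · exact WalkIn.of_seq (by omega) hR.y_asc.adj fun l h₁ h₂ => Or.inr (Or.inl ⟨l, h₁, h₂, rfl⟩)

/-- Below level `d` the only vertex of the corridor to which `x i` can climb is `x (i + 1)`. So an
ascending path follows `x` to `x d`, and there all upper neighbours have been deleted. -/
theorem not_ascends_corridor (hL : IsLayering G u v h k) (hdk : d < k)
    (hx : Ascends G h x 0 d)
    (hxy : ∀ i l, i ≤ d → c ≤ l → l ≤ k → ¬ Touch G (x i) (y l)) {f : ℕ → V}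
    (hf : Ascends G h f 0 k) (hmem : ∀ i ≤ k, f i ∈ Corridor G h k d c x y) : False := by
  have key : ∀ i ≤ d, f i = x i := by
    intro i
    induction i with
    | zero => intro _; rw [hf.bot hL, hx.bot hL]
    | succ i ih =>
      intro hi
      have hadj := hf.adj i (by omega) (by omega)
      have hlev := hf.level (i + 1) (by omega) (by omega)
      rw [ih (by omega)] at hadj
      rcases hmem (i + 1) (by omega) with ⟨i', h₁, h₂⟩ | ⟨l, h₁, h₂, h₃⟩ | ⟨h₁, _⟩
      · rw [← h₂, hx.level i' (by omega) h₁] at hlev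
        rw [← h₂, hlev]
      · rw [← h₃] at hadj
        exact absurd (Or.inr hadj) (hxy i l (by omega) h₁ h₂)
      · exact absurd (Or.inr hadj) (h₁ i (by omega))
  have hadj := hf.adj d (by omega) hdk
  have hlev := hf.level (d + 1) (by omega) hdk
  rw [key d le_rfl] at hadj
  rcases hmem (d + 1) (by omega) with ⟨i', h₁, h₂⟩ | ⟨l, h₁, h₂, h₃⟩ | ⟨_, _, h₁⟩
  · rw [← h₂, hx.level i' (by omega) h₁] at hlev
    omega
  · rw [← h₃] at hadj
    exact hxy d l le_rfl h₁ h₂ (Or.inr hadj)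
  · exact h₁ ⟨hadj, by omega⟩

end Layered

/-! ### Non-shortest paths as sequences -/

section Sequences

variable {V : Type*} {G : SimpleGraph V}

theorem exists_walk_of_seq (f : ℕ → V) (l : ℕ) (hf : ∀ i < l, G.Adj (f i) (f (i + 1))) :
    ∃ w : G.Walk (f 0) (f l), w.length = l ∧ ∀ i ≤ l, w.getVert i = f i := by
  induction l generalizing f with
  | zero => exact ⟨.nil, rfl, fun i hi => by obtain rfl : i = 0 := by omega
                                             rfl⟩
  | succ l ih =>
    obtain ⟨w, hw, hg⟩ := ih (fun i => f (i + 1)) fun i hi => hf (i + 1) (by omega)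
    refine ⟨.cons (hf 0 (by omega)) w, by simp [hw], fun i hi => ?_⟩
    rcases i with _ | i
    · simp
    · simpa using hg i (by omega)

variable {u v : V}

/-- A walk without shortcuts is an induced path. -/
theorem isPath_of_induced {w : G.Walk u v}
    (hw : ∀ i l, i + 1 < l → l ≤ w.length → ¬ Touch G (w.getVert i) (w.getVert l)) :
    w.IsPath ∧ w.IsChordless := by
  have hne : ∀ i l, i < l → l ≤ w.length → w.getVert i ≠ w.getVert l := by
    intro i l hil hl h
    rcases Nat.lt_or_ge (i + 1) l with h₁ | h₁
    · exact hw i l h₁ hl (Or.inl h)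
    · obtain rfl : l = i + 1 := by omega
      exact (w.adj_getVert_succ (by omega)).ne h
  refine ⟨(SimpleGraph.Walk.IsPath.getVert_injOn_iff w).1 fun i hi l hl h => ?_,
    SimpleGraph.Walk.isChordless_iff_forall_mem_edges.2 fun a b ha hb hab => ?_⟩
  · by_contra hil
    rcases Nat.lt_or_gt_of_ne hil with h₁ | h₁
    · exact hne i l h₁ hl h
    · exact hne l i h₁ hi h.symm
  · obtain ⟨i, rfl, hi⟩ := SimpleGraph.Walk.mem_support_iff_exists_getVert.1 ha
    obtain ⟨l, rfl, hl⟩ := SimpleGraph.Walk.mem_support_iff_exists_getVert.1 hb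
    rw [SimpleGraph.Walk.mk_mem_edges_iff_exists]
    rcases Nat.lt_trichotomy i l with h₁ | rfl | h₁
    · have h₂ : ¬ i + 1 < l := fun h₃ => hw i l h₃ hl (Or.inr hab)
      obtain rfl : l = i + 1 := by omega
      exact ⟨i, by omega, rfl⟩
    · exact (hab.ne rfl).elim
    · have h₂ : ¬ l + 1 < i := fun h₃ => hw l i h₃ hi (Or.inr hab.symm)
      obtain rfl : i = l + 1 := by omega
      exact ⟨l, by omega, Sym2.eq_swap⟩

/-- An induced path has no shortcuts. -/
theorem induced_of_isPath {w : G.Walk u v} (hp : w.IsPath) (hc : w.IsChordless) (i l : ℕ)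
    (hil : i + 1 < l) (hl : l ≤ w.length) : ¬ Touch G (w.getVert i) (w.getVert l) := by
  have hinj : ∀ a b, a ≤ w.length → b ≤ w.length → w.getVert a = w.getVert b → a = b :=
    fun a b ha hb h => hp.getVert_injOn ha hb h
  rintro (h | h)
  · have := hinj i l (by omega) hl h
    omega
  · have h₁ := hc.mem_edges (w.getVert_mem_support i) (w.getVert_mem_support l) h
    obtain ⟨e, he, h₂⟩ := (SimpleGraph.Walk.mk_mem_edges_iff_exists w).1 h₁
    rcases Sym2.eq_iff.1 h₂ with ⟨h₃, h₄⟩ | ⟨h₃, h₄⟩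
    · have := hinj e i (by omega) (by omega) h₃
      have := hinj (e + 1) l (by omega) hl h₄
      omega
    · have := hinj e l (by omega) hl h₃
      have := hinj (e + 1) i (by omega) (by omega) h₄
      omega

/-- A shortest walk inside a set of vertices has no shortcuts. -/
theorem WalkIn.exists_induced {Y : Set V} {l : ℕ} (h : WalkIn G Y l u v) :
    ∃ w : G.Walk u v, w.length ≤ l ∧ (∀ i, w.getVert i ∈ Y) ∧
      ∀ i l, i + 1 < l → l ≤ w.length → ¬ Touch G (w.getVert i) (w.getVert l) := by
  obtain ⟨n, hn, ⟨w, hw, hY⟩, hmin⟩ := exists_least (Q := fun l => WalkIn G Y l u v) h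
  have hwn : w.length = n := by
    by_contra hne
    exact hmin w.length (by omega) ⟨w, le_rfl, hY⟩
  have hYg : ∀ i, w.getVert i ∈ Y := fun i => hY _ (w.getVert_mem_support i)
  refine ⟨w, by omega, hYg, fun i l hil hl ht => ?_⟩
  have h₁ : WalkIn G Y (i - 0 + 1 + (w.length - l)) (w.getVert 0) (w.getVert w.length) :=
    ((WalkIn.of_seq (f := w.getVert) (Nat.zero_le i) (fun a _ ha => w.adj_getVert_succ (by omega))
      fun a _ _ => hYg a).trans (WalkIn.of_touch ht (hYg _) (hYg _))).trans
      (WalkIn.of_seq (f := w.getVert) hl (fun a _ ha => w.adj_getVert_succ ha) fun a _ _ => hYg a)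
  rw [w.getVert_zero, w.getVert_length] at h₁
  exact hmin _ (by omega) h₁

/-- If `v` is reachable, all distances in the definition of straightness are finite, so the
distances of a vertex to `u` and to `v` have a constant sum in `ℕ`. A shortest walk towards `v`
therefore climbs. -/
theorem isLayering_dist (hs : ∀ x, IsStraight G u v x) (hr : G.Reachable u v) :
    IsLayering G u v (G.dist u) (G.dist u v) ∧
      ∀ x, G.Reachable u x ∧ G.dist u x + G.dist x v = G.dist u v := by
  have huv := SimpleGraph.edist_ne_top_iff_reachable.2 hr
  have hreach : ∀ x, G.Reachable u x ∧ G.Reachable x v := by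
    intro x
    have h := hs x
    unfold IsStraight at h
    constructor
    · rw [← SimpleGraph.edist_ne_top_iff_reachable]
      intro h₁
      rw [h₁, top_add] at h
      exact huv h.symm
    · rw [← SimpleGraph.edist_ne_top_iff_reachable]
      intro h₁
      rw [h₁, add_top] at h
      exact huv h.symm
  have hsum : ∀ x, G.dist u x + G.dist x v = G.dist u v := by
    intro x
    have h := hs x
    unfold IsStraight at h
    rw [← (hreach x).1.coe_dist_eq_edist, ← (hreach x).2.coe_dist_eq_edist,
      ← hr.coe_dist_eq_edist] at h
    exact_mod_cast h
  have hadj : ∀ x y, G.Adj x y → G.dist u x ≤ G.dist u y + 1 := by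
    intro x y hxy
    obtain ⟨w, hw⟩ := (hreach y).1.exists_walk_length_eq_dist
    have := SimpleGraph.dist_le (w.concat hxy.symm)
    rw [SimpleGraph.Walk.length_concat] at this
    omega
  have hadj' : ∀ x y, G.Adj x y → G.dist x v ≤ G.dist y v + 1 := by
    intro x y hxy
    have h₁ := hadj y x hxy.symm
    have h₂ := hsum x
    have h₃ := hsum y
    omega
  refine ⟨⟨SimpleGraph.dist_self, fun x hx => ?_, rfl, fun x hx => ?_, fun x => ?_, hadj,
    fun x hx => ?_, fun x hx => ?_⟩, fun x => ⟨(hreach x).1, hsum x⟩⟩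
  · exact ((hreach x).1.dist_eq_zero_iff.1 hx).symm
  · have := hsum x
    exact (hreach x).2.dist_eq_zero_iff.1 (by omega)
  · have := hsum x
    omega
  · obtain ⟨w, hw⟩ := (hreach x).1.exists_walk_length_eq_dist
    have h₁ := w.adj_getVert_succ (i := w.length - 1) (by omega)
    rw [show w.length - 1 + 1 = w.length by omega, w.getVert_length] at h₁
    refine ⟨_, h₁, ?_⟩
    have h₂ := SimpleGraph.dist_le (w.take (w.length - 1))
    rw [SimpleGraph.Walk.take_length] at h₂
    have h₃ := hadj _ _ h₁.symm
    have h₄ : min (w.length - 1) w.length = w.length - 1 := by omega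
    omega
  · obtain ⟨w, hw⟩ := (hreach x).2.exists_walk_length_eq_dist
    have h₀ := hsum x
    have h₁ := w.adj_getVert_succ (i := 0) (by omega)
    rw [w.getVert_zero] at h₁
    refine ⟨_, h₁, ?_⟩
    have h₂ := SimpleGraph.dist_le (w.drop 1)
    rw [SimpleGraph.Walk.drop_length] at h₂
    have h₃ := hadj' _ _ h₁
    have h₄ := hsum (w.getVert (0 + 1))
    simp only [Nat.zero_add] at *
    omega

/-! ### Existence of a detour, and rails as a path of pairs. -/

variable {h : V → ℕ} {k : ℕ}

/-- The level changes by at most one per edge, counted from either end. For a walk with at most `k`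
edges the two bounds meet, and the walk ascends. -/
theorem IsLayering.getVert_le (hL : IsLayering G u v h k) (w : G.Walk u v) :
    ∀ i ≤ w.length, h (w.getVert i) ≤ i ∧ k ≤ h (w.getVert i) + (w.length - i) := by
  have h₁ : ∀ i, i ≤ w.length → h (w.getVert i) ≤ i := by
    intro i
    induction i with
    | zero => intro _; simp [hL.bot]
    | succ i ih =>
      intro hi
      have := hL.adj _ _ (w.adj_getVert_succ (i := i) (by omega)).symm
      have := ih (by omega)
      omega
  have h₂ : ∀ i, i ≤ w.length → k ≤ h (w.getVert (w.length - i)) + i := by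
    intro i
    induction i with
    | zero => intro _; simp [hL.top]
    | succ i ih =>
      intro hi
      have h₃ := hL.adj _ _ (w.adj_getVert_succ (i := w.length - (i + 1)) (by omega)).symm
      rw [show w.length - (i + 1) + 1 = w.length - i by omega] at h₃
      have := ih (by omega)
      omega
  intro i hi
  refine ⟨h₁ i hi, ?_⟩
  have := h₂ (w.length - i) (by omega)
  rwa [show w.length - (w.length - i) = i by omega] at this

/-- A graph that has an induced path of length more than `k` has a detour. -/
theorem IsLayering.exists_isDetour (hL : IsLayering G u v h k)
    (hw : ∃ w : G.Walk u v, w.IsPath ∧ w.IsChordless ∧ k < w.length) :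
    ∃ p m d j, IsDetour G u v h k p m d j ∧ ∃ w : G.Walk u v, w.IsPath ∧ w.length = m := by
  obtain ⟨w₀, hp₀, hc₀, hk₀⟩ := hw
  obtain ⟨m, -, ⟨w, hp, hc, hk, hwm⟩, hmin⟩ := exists_least
    (Q := fun m => ∃ w : G.Walk u v, w.IsPath ∧ w.IsChordless ∧ k < w.length ∧ w.length = m)
    ⟨w₀, hp₀, hc₀, hk₀, rfl⟩
  have hind := induced_of_isPath hp hc
  have hadj : ∀ i < m, G.Adj (w.getVert i) (w.getVert (i + 1)) :=
    fun i hi => w.adj_getVert_succ (by omega)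
  have hlast : w.getVert m = v := by rw [← hwm, w.getVert_length]
  have hv : ∀ i < m, w.getVert i ≠ v := by
    intro i hi h₁
    have := hp.getVert_injOn (show i ≤ w.length by omega) (show m ≤ w.length by omega)
      (h₁.trans hlast.symm)
    omega
  obtain ⟨d, hdm, hd, hdmax⟩ := exists_greatest
    (Q := fun d => ∀ i ≤ d, h (w.getVert i) = i) (Nat.zero_le m)
    (fun i hi => by obtain rfl : i = 0 := by omega
                    simp [hL.bot])
  have hdk : d < k := by
    by_contra hcon
    exact hv k (by omega) (hL.eq_top _ (hd k (by omega)))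
  obtain ⟨j, hjm, hj, hjmin⟩ := exists_least
    (Q := fun j => ∀ i, j ≤ i → i ≤ m → h (w.getVert i) + m = k + i) (l := m)
    (fun i h₁ h₂ => by obtain rfl : i = m := by omega
                       rw [hlast, hL.top])
  have hjm' : j < m := by
    by_contra hcon
    refine hjmin (m - 1) (by omega) fun i h₁ h₂ => ?_
    rcases Nat.lt_or_ge i m with h₃ | h₃
    · obtain rfl : i = m - 1 := by omega
      have h₄ := hL.adj _ _ (hadj (m - 1) h₃).symm
      rw [show m - 1 + 1 = m by omega, hlast, hL.top] at h₄
      have h₅ := hL.le_top (w.getVert (m - 1))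
      have h₆ : h (w.getVert (m - 1)) ≠ k := fun h₆ => hv _ h₃ (hL.eq_top _ h₆)
      omega
    · exact hj i (by omega) h₂
  refine ⟨w.getVert, m, d, j, ⟨w.getVert_zero, hlast, hadj, fun i l h₁ h₂ => hind i l h₁ (by omega),
    hd, ?_, hj, ?_, ?_, hjm', hdk, ?_⟩, w, hp, hwm⟩
  · have h₁ := hL.adj _ _ (hadj d (by omega)).symm
    rw [hd d le_rfl] at h₁
    by_contra hcon
    refine hdmax (d + 1) (by omega) (by omega) fun i hi => ?_
    rcases Nat.lt_or_ge d i with h₂ | h₂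
    · obtain rfl : i = d + 1 := by omega
      omega
    · exact hd i h₂
  · have hj0 : j ≠ 0 := by
      rintro rfl
      have := hj 0 le_rfl (by omega)
      rw [w.getVert_zero, hL.bot] at this
      omega
    obtain ⟨j, rfl⟩ : ∃ j', j = j' + 1 := ⟨j - 1, by omega⟩
    have h₁ := hL.adj _ _ (hadj j (by omega)).symm
    have h₂ := hj (j + 1) le_rfl (by omega)
    simp only [Nat.add_sub_cancel]
    by_contra hcon
    refine hjmin j (by omega) fun i h₃ h₄ => ?_
    rcases Nat.lt_or_ge j i with h₅ | h₅
    · exact hj i h₅ h₄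
    · obtain rfl : i = j := by omega
      omega
  · by_contra hcon
    have h₁ := hj d (by omega) hdm
    rw [hd d le_rfl] at h₁
    omega
  -- A shortest walk inside `Y` is an induced path with fewer than `m` edges. By the minimality of
  -- `m` it has at most `k` edges, so it ascends.
  · intro Y l hl hlm
    obtain ⟨w', hl', hY, hind'⟩ := hl.exists_induced
    obtain ⟨hp', hc'⟩ := isPath_of_induced hind'
    have hk' : w'.length ≤ k := by
      by_contra hcon
      exact hmin w'.length (by omega) ⟨w', hp', hc', by omega, rfl⟩
    have hlev := hL.getVert_le w'
    have h₀ := (hlev 0 (by omega)).2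
    rw [w'.getVert_zero, hL.bot] at h₀
    refine ⟨w'.getVert, ⟨fun i _ hi => ?_, fun i _ hi => w'.adj_getVert_succ (by omega)⟩,
      fun i _ => hY i⟩
    have := hlev i (by omega)
    omega

/-- The conditions on a pair of vertices of the same level on two paths that pass through guessed
vertices: `x` on a path through `s` and `y` on a path through `t`, `f₁` and `f₂`. -/
def Node (G : SimpleGraph V) (h : V → ℕ) (s t₀ t f₁ f₂ x y : V) : Prop :=
  (h x = h s → x = s) ∧ (h x < h s → ¬ Touch G x t₀) ∧ (h y = h t → y = t) ∧
    (h y = h f₁ → y = f₁) ∧ (h y = h f₂ → y = f₂)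

/-- If `x` is not above `s` and `y` is not below `t`, then `x` and `y` do not touch. -/
def Apart (G : SimpleGraph V) (h : V → ℕ) (s t x y : V) : Prop :=
  h x ≤ h s → h t ≤ h y → ¬ Touch G x y

/-- Both paths go up, from `x` to `x'` and from `y` to `y'`. -/
def Step (G : SimpleGraph V) (h : V → ℕ) (s t₀ t f₁ f₂ x y x' y' : V) : Prop :=
  (G.Adj x x' ∧ h x' = h x + 1) ∧ (G.Adj y y' ∧ h y' = h y + 1) ∧
    Node G h s t₀ t f₁ f₂ x y ∧ Node G h s t₀ t f₁ f₂ x' y' ∧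
    Apart G h s t x y ∧ Apart G h s t x y' ∧ Apart G h s t x' y

variable {p : ℕ → V} {m d j : ℕ} {s t₀ t f₁ f₂ : V}

/-- The vertices `s`, `t₀`, `t`, `f₁`, `f₂` of a detour. -/
def IsDetour.Guess (h : V → ℕ) (p : ℕ → V) (d j : ℕ) (s t₀ t f₁ f₂ : V) : Prop :=
  s = p d ∧ t₀ = p j ∧ t = p (j + 1) ∧
    f₁ = (if h t + 1 ≤ d then p (j + 1 + (d - 1 - h t)) else t) ∧
    f₂ = (if h t ≤ d then p (j + 1 + (d - h t)) else t)

theorem IsDetour.level_t (hP : IsDetour G u v h k p m d j) :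
    h (p (j + 1)) + m = k + j + 1 := hP.tail (j + 1) (by omega) hP.j_lt_m

theorem IsDetour.tail_level (hP : IsDetour G u v h k p m d j) {l : ℕ}
    (hl : h (p (j + 1)) ≤ l) (hlk : l ≤ k) : h (p (j + 1 + (l - h (p (j + 1))))) = l := by
  have h₁ := hP.level_t
  have h₂ := hP.tail (j + 1 + (l - h (p (j + 1)))) (by omega) (by omega)
  omega

/-- Local conditions suffice: touching vertices differ by at most one level, so the three `Apart`
conditions of a step catch all contacts between `x` up to level `d` and `y` from level `h t` on. The
`Node` conditions pin the two paths to the guessed vertices. -/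
theorem isRails_of_steps (hL : IsLayering G u v h k) (hP : IsDetour G u v h k p m d j)
    (hg : IsDetour.Guess h p d j s t₀ t f₁ f₂) {x y : ℕ → V} (hx0 : x 0 = u) (hy0 : y 0 = u)
    (hstep : ∀ i < k, Step G h s t₀ t f₁ f₂ (x i) (y i) (x (i + 1)) (y (i + 1))) :
    IsRails G h k p m d j (h t) x y := by
  obtain ⟨rfl, rfl, rfl, hf₁, hf₂⟩ := hg
  have hc := hP.level_t
  have hdk := hP.d_lt_k
  have hs := hP.head d le_rfl
  have hck := hL.le_top (p (j + 1))
  have hx : ∀ i ≤ k, h (x i) = i := by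
    intro i
    induction i with
    | zero => intro _; rw [hx0, hL.bot]
    | succ i ih => intro hi; rw [(hstep i hi).1.2, ih (by omega)]
  have hy : ∀ i ≤ k, h (y i) = i := by
    intro i
    induction i with
    | zero => intro _; rw [hy0, hL.bot]
    | succ i ih => intro hi; rw [(hstep i hi).2.1.2, ih (by omega)]
  have hnode : ∀ i ≤ k, Node G h (p d) (p j) (p (j + 1)) f₁ f₂ (x i) (y i) := by
    intro i hi
    rcases Nat.lt_or_ge i k with h₁ | h₁
    · exact (hstep i h₁).2.2.1
    · obtain ⟨i, rfl⟩ : ∃ i', i = i' + 1 := ⟨i - 1, by omega⟩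
      exact (hstep i (by omega)).2.2.2.1
  refine ⟨by omega, ⟨fun i _ hi => hx i (by omega), fun i _ hi => (hstep i (by omega)).1.1⟩,
    (hnode d (by omega)).1 (by rw [hx d (by omega), hs]),
    ⟨fun i _ hi => hy i hi, fun i _ hi => (hstep i hi).2.1.1⟩,
    (hnode _ hck).2.2.1 (hy _ hck), ?_, ?_, ?_⟩
  · intro i l hi hl hlk ht
    have h₁ := hL.touch_le ht
    have h₂ := hL.touch_le ht.symm
    rw [hx i (by omega), hy l hlk] at h₁ h₂
    rcases Nat.lt_trichotomy i l with h₃ | rfl | h₃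
    · obtain rfl : l = i + 1 := by omega
      exact (hstep i (by omega)).2.2.2.2.2.1 (by rw [hx i (by omega), hs]; omega)
        (by rw [hy _ hlk]; omega) ht
    · exact (hstep i (by omega)).2.2.2.2.1 (by rw [hx i (by omega), hs]; omega)
        (by rw [hy _ hlk]; omega) ht
    · obtain rfl : i = l + 1 := by omega
      exact (hstep l (by omega)).2.2.2.2.2.2 (by rw [hx _ (by omega), hs]; omega)
        (by rw [hy _ hlk]; omega) ht
  · rintro l hl hlk (h₁ | rfl)
    · obtain rfl : l = d - 1 := by omega
      rw [if_pos (by omega)] at hf₁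
      rw [← hf₁]
      refine (hnode _ hlk).2.2.2.1 ?_
      rw [hf₁, hP.tail_level hl hlk, hy _ hlk]
    · rw [if_pos hl] at hf₂
      rw [← hf₂]
      refine (hnode _ hlk).2.2.2.2 ?_
      rw [hf₂, hP.tail_level hl hlk, hy _ hlk]
  · intro i hi
    exact (hnode i (by omega)).2.1 (by rw [hx i (by omega), hs]; exact hi)

/-- Take `p` up to `p d`, continued by any shortest path to `v`, and the end of `p` from `p (j +
1)`, preceded by any shortest path from `u`. The added pieces only let both paths run through all
levels in step. The conditions restrict the parts on `p`, where they hold because `p` is induced. -/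
theorem IsDetour.exists_steps (hL : IsLayering G u v h k) (hP : IsDetour G u v h k p m d j)
    (hg : IsDetour.Guess h p d j s t₀ t f₁ f₂) :
    ∃ x y : ℕ → V, x 0 = u ∧ y 0 = u ∧ x k = v ∧ y k = v ∧
      ∀ i < k, Step G h s t₀ t f₁ f₂ (x i) (y i) (x (i + 1)) (y (i + 1)) := by
  obtain ⟨rfl, rfl, rfl, hf₁, hf₂⟩ := hg
  have hc := hP.level_t
  have hdk := hP.d_lt_k
  have hdj := hP.d_lt_j
  have hjm := hP.j_lt_m
  have hs := hP.head d le_rfl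
  have hck := hL.le_top (p (j + 1))
  set c := h (p (j + 1)) with hcdef
  obtain ⟨S, hS, hSd⟩ := hL.exists_ascends_from (p d)
  obtain ⟨D, hD, hDt⟩ := hL.exists_ascends_to (p (j + 1))
  rw [hs] at hS hSd
  rw [← hcdef] at hD hDt
  let x : ℕ → V := fun i => if i ≤ d then p i else S i
  let y : ℕ → V := fun i => if c ≤ i then p (j + 1 + (i - c)) else D i
  have hxa : Ascends G h x 0 k := by
    refine ⟨fun i _ hi => ?_, fun i _ hi => ?_⟩
    · by_cases hid : i ≤ d
      · simpa [x, hid] using hP.head i hid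
      · simpa [x, hid] using hS.level i (by omega) hi
    · by_cases hid : i + 1 ≤ d
      · simpa [x, hid, show i ≤ d by omega] using hP.adj i (by omega)
      · by_cases hid' : i ≤ d
        · obtain rfl : i = d := by omega
          simpa [x, hSd] using hS.adj i le_rfl hi
        · simpa [x, hid, hid'] using hS.adj i (by omega) hi
  have hya : Ascends G h y 0 k := by
    refine ⟨fun i _ hi => ?_, fun i _ hi => ?_⟩
    · by_cases hid : c ≤ i
      · simpa [y, hid] using hP.tail_level hid hi
      · simpa [y, hid] using hD.level i (by omega) (by omega)
    · by_cases hid : c ≤ i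
      · have := hP.adj (j + 1 + (i - c)) (by omega)
        simpa [y, hid, show c ≤ i + 1 by omega, show i + 1 - c = i - c + 1 by omega, ← Nat.add_assoc] using this
      · by_cases hid' : c ≤ i + 1
        · have h₁ := hD.adj i (by omega) (by omega)
          have h₂ : i + 1 = c := by omega
          rw [h₂, hDt] at h₁
          simpa [y, hid, h₂] using h₁
        · simpa [y, hid, hid'] using hD.adj i (by omega) (by omega)
  have hxs : ∀ i ≤ d, x i = p i := fun i hi => by simp [x, hi]
  have hyt : ∀ i, c ≤ i → y i = p (j + 1 + (i - c)) := fun i hi => by simp [y, hi]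
  -- If level `d - 1` lies below `c`, the guess `f₁` takes the default value `t`, for which the
  -- condition in `Node` repeats that on `t`. The same applies to `f₂` and level `d`.
  have hf₁' : y (h f₁) = f₁ := by
    rw [hf₁]
    split_ifs with h₁
    · have := hP.tail_level (l := d - 1) (by omega) (by omega)
      rw [← hcdef] at this
      rw [this, hyt _ (by omega)]
    · rw [← hcdef, hyt _ le_rfl]
      simp
  have hf₂' : y (h f₂) = f₂ := by
    rw [hf₂]
    split_ifs with h₁
    · have := hP.tail_level (l := d) (by omega) (by omega)
      rw [← hcdef] at this
      rw [this, hyt _ (by omega)]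
    · rw [← hcdef, hyt _ le_rfl]
      simp
  have hnode : ∀ i ≤ k, Node G h (p d) (p j) (p (j + 1)) f₁ f₂ (x i) (y i) := by
    intro i hi
    have h₁ := hxa.level i (by omega) hi
    have h₂ := hya.level i (by omega) hi
    refine ⟨fun h₃ => ?_, fun h₃ => ?_, fun h₃ => ?_, fun h₃ => ?_, fun h₃ => ?_⟩
    · rw [h₁, hs] at h₃
      rw [h₃, hxs d le_rfl]
    · rw [h₁, hs] at h₃
      rw [hxs i h₃.le]
      exact hP.induced _ _ (by omega) (by omega)
    · rw [h₂, ← hcdef] at h₃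
      rw [h₃, hyt c le_rfl]
      simp
    · rw [h₂] at h₃
      rw [h₃, hf₁']
    · rw [h₂] at h₃
      rw [h₃, hf₂']
  have hap : ∀ i l, i ≤ k → l ≤ k → Apart G h (p d) (p (j + 1)) (x i) (y l) := by
    intro i l hi hl h₁ h₂
    rw [hxa.level i (by omega) hi, hs] at h₁
    rw [hya.level l (by omega) hl, ← hcdef] at h₂
    rw [hxs i h₁, hyt l h₂]
    exact hP.induced _ _ (by omega) (by omega)
  refine ⟨x, y, hxa.bot hL, hya.bot hL, hxa.top hL (by omega), hya.top hL (by omega),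
    fun i hi => ⟨⟨hxa.adj i (by omega) hi, ?_⟩, ⟨hya.adj i (by omega) hi, ?_⟩, hnode i hi.le,
      hnode (i + 1) hi, hap _ _ (by omega) (by omega), hap _ _ (by omega) (by omega),
      hap _ _ (by omega) (by omega)⟩⟩
  · rw [hxa.level i (by omega) (by omega), hxa.level (i + 1) (by omega) (by omega)]
  · rw [hya.level i (by omega) (by omega), hya.level (i + 1) (by omega) (by omega)]

end Sequences

/-! ### Programs with bounded loops -/

namespace RAM

/-- The expression is true in the given memory. -/
def Expr.Holds (e : Expr) (σ : State) : Prop := e.eval σ ≠ 0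

/-- Negation. -/
def Expr.not (e : Expr) : Expr := .eq e (.const 0)

/-- Conjunction. -/
def Expr.and (e f : Expr) : Expr := .lt e.not (.lt (.const 0) f)

/-- Disjunction. -/
def Expr.or (e f : Expr) : Expr := (e.not.and f.not).not

/-- Implication. -/
def Expr.imp (e f : Expr) : Expr := (e.and f.not).not

section Holds

variable {σ : State} {e f : Expr}

@[simp] theorem Expr.holds_lt : (Expr.lt e f).Holds σ ↔ e.eval σ < f.eval σ := by
  simp [Holds, eval]

@[simp] theorem Expr.holds_eq : (Expr.eq e f).Holds σ ↔ e.eval σ = f.eval σ := by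
  simp [Holds, eval]

@[simp] theorem Expr.holds_not : e.not.Holds σ ↔ ¬ e.Holds σ := by
  by_cases h : e.eval σ = 0 <;> simp [Holds, Expr.not, eval, h]

@[simp] theorem Expr.holds_and : (e.and f).Holds σ ↔ e.Holds σ ∧ f.Holds σ := by
  by_cases h₁ : e.eval σ = 0 <;> by_cases h₂ : f.eval σ = 0 <;>
    simp [Holds, Expr.and, Expr.not, eval, h₁, h₂, Nat.pos_iff_ne_zero]

@[simp] theorem Expr.holds_or : (e.or f).Holds σ ↔ e.Holds σ ∨ f.Holds σ := by
  simp only [Expr.or, holds_not, holds_and]; tauto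

@[simp] theorem Expr.holds_imp : (e.imp f).Holds σ ↔ (e.Holds σ → f.Holds σ) := by
  simp only [Expr.imp, holds_not, holds_and]; tauto

@[simp] theorem Expr.holds_read {a : ℕ} :
    (Expr.read a e f).Holds σ ↔ σ.arr a (e.eval σ) (f.eval σ) ≠ 0 := Iff.rfl

@[simp] theorem Expr.holds_var {x : ℕ} : (Expr.var x).Holds σ ↔ σ.var x ≠ 0 := Iff.rfl

end Holds

attribute [simp] Expr.eval

@[simp] theorem State.setVar_var (σ : State) (x k : ℕ) :
    (σ.setVar x k).var = Function.update σ.var x k := rfl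

@[simp] theorem State.setVar_arr (σ : State) (x k : ℕ) : (σ.setVar x k).arr = σ.arr := rfl

@[simp] theorem State.setArr_var (σ : State) (a i j k : ℕ) : (σ.setArr a i j k).var = σ.var := rfl

@[simp] theorem State.setArr_arr (σ : State) (a i j k : ℕ) :
    (σ.setArr a i j k).arr = Function.update σ.arr a
      (Function.update (σ.arr a) i (Function.update (σ.arr a i) j k)) := rfl

/-- Programs in which every loop runs a variable from `0` up to the value of `x₀`. -/
inductive Cmd where
  | skip : Cmd
  | assign (x : ℕ) (e : Expr) : Cmd
  | store (a : ℕ) (i j e : Expr) : Cmd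
  | seq (p q : Cmd) : Cmd
  | branch (b : Expr) (p q : Cmd) : Cmd
  | rep (x : ℕ) (p : Cmd) : Cmd

namespace Cmd

/-- The program that carries out a command. -/
def toProg : Cmd → Prog
  | skip => .skip
  | assign x e => .assign x e
  | store a i j e => .store a i j e
  | seq p q => .seq p.toProg q.toProg
  | branch b p q => .branch b p.toProg q.toProg
  | rep x p => .seq (.assign x (.const 0))
      (.loop (.lt (.var x) (.var 0)) (.seq p.toProg (.assign x (.succ (.var x)))))

open Classical in
/-- The memory after a command. -/
noncomputable def run : Cmd → State → State
  | skip, σ => σ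
  | assign x e, σ => σ.setVar x (e.eval σ)
  | store a i j e, σ => σ.setArr a (i.eval σ) (j.eval σ) (e.eval σ)
  | seq p q, σ => q.run (p.run σ)
  | branch b p q, σ => if b.Holds σ then p.run σ else q.run σ
  | rep x p, σ => (fun ρ => (p.run ρ).setVar x ((p.run ρ).var x + 1))^[σ.var 0] (σ.setVar x 0)

/-- The variables to which a command assigns. -/
def vars : Cmd → List ℕ
  | skip => []
  | assign x _ => [x]
  | store _ _ _ _ => []
  | seq p q => p.vars ++ q.vars
  | branch _ p q => p.vars ++ q.vars
  | rep x p => x :: p.vars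

/-- The arrays in which a command stores. -/
def arrs : Cmd → List ℕ
  | skip => []
  | assign _ _ => []
  | store a _ _ _ => [a]
  | seq p q => p.arrs ++ q.arrs
  | branch _ p q => p.arrs ++ q.arrs
  | rep _ p => p.arrs

/-- The loop variables and the bound `x₀` are changed by the loops only. -/
def IsWF : Cmd → Prop
  | skip => True
  | assign x _ => x ≠ 0
  | store _ _ _ _ => True
  | seq p q => p.IsWF ∧ q.IsWF
  | branch _ p q => p.IsWF ∧ q.IsWF
  | rep x p => x ≠ 0 ∧ x ∉ p.vars ∧ p.IsWF

/-- The nesting depth of the loops. -/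
def depth : Cmd → ℕ
  | skip => 0
  | assign _ _ => 0
  | store _ _ _ _ => 0
  | seq p q => max p.depth q.depth
  | branch _ p q => max p.depth q.depth
  | rep _ p => p.depth + 1

/-- The constant in the bound on the number of steps. -/
def weight : Cmd → ℕ
  | skip => 1
  | assign _ e => e.cost + 1
  | store _ i j e => i.cost + j.cost + e.cost + 1
  | seq p q => p.weight + q.weight
  | branch b p q => b.cost + 1 + (p.weight + q.weight)
  | rep _ p => p.weight + 13

theorem run_var {c : Cmd} {x : ℕ} (hx : x ∉ c.vars) (σ : State) :
    (c.run σ).var x = σ.var x := by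
  induction c generalizing σ with
  | skip => rfl
  | assign y e =>
    have : x ≠ y := by simpa [vars] using hx
    simp [run, this]
  | store a i j e => rfl
  | seq p q hp hq =>
    simp only [vars, List.mem_append, not_or] at hx
    rw [run, hq hx.2, hp hx.1]
  | branch b p q hp hq =>
    simp only [vars, List.mem_append, not_or] at hx
    rw [run]
    split_ifs
    · exact hp hx.1 σ
    · exact hq hx.2 σ
  | rep y p hp =>
    simp only [vars, List.mem_cons, not_or] at hx
    rw [run]
    have : ∀ (n : ℕ) (τ : State), τ.var x = σ.var x →
        ((fun ρ => (p.run ρ).setVar y ((p.run ρ).var y + 1))^[n] τ).var x = σ.var x := by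
      intro n
      induction n with
      | zero => intro τ h; exact h
      | succ n ih =>
        intro τ h
        rw [Function.iterate_succ_apply]
        exact ih _ (by simp [hx.1, hp hx.2, h])
    exact this _ _ (by simp [hx.1])

theorem run_arr {c : Cmd} {a : ℕ} (ha : a ∉ c.arrs) (σ : State) :
    (c.run σ).arr a = σ.arr a := by
  induction c generalizing σ with
  | skip => rfl
  | assign y e => rfl
  | store b i j e =>
    have : a ≠ b := by simpa [arrs] using ha
    simp [run, this]
  | seq p q hp hq =>
    simp only [arrs, List.mem_append, not_or] at ha
    rw [run, hq ha.2, hp ha.1]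
  | branch b p q hp hq =>
    simp only [arrs, List.mem_append, not_or] at ha
    rw [run]
    split_ifs
    · exact hp ha.1 σ
    · exact hq ha.2 σ
  | rep y p hp =>
    rw [run]
    have : ∀ (n : ℕ) (τ : State), τ.arr a = σ.arr a →
        ((fun ρ => (p.run ρ).setVar y ((p.run ρ).var y + 1))^[n] τ).arr a = σ.arr a := by
      intro n
      induction n with
      | zero => intro τ h; exact h
      | succ n ih =>
        intro τ h
        rw [Function.iterate_succ_apply]
        exact ih _ (by simp [hp ha, h])
    exact this _ _ rfl

theorem IsWF.zero_notMem {c : Cmd} (hc : c.IsWF) : 0 ∉ c.vars := by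
  induction c with
  | skip => simp [vars]
  | assign x e => simpa [vars] using Ne.symm hc
  | store => simp [vars]
  | seq p q hp hq => simp [vars, hp hc.1, hq hc.2]
  | branch b p q hp hq => simp [vars, hp hc.1, hq hc.2]
  | rep x p hp => simpa [vars, hp hc.2.2] using Ne.symm hc.1

/-- The loop of a command `rep`. -/
theorem exec_loop {x n : ℕ} {p : Cmd} {T : ℕ} (hx : x ≠ 0) (hxp : x ∉ p.vars) (h0 : 0 ∉ p.vars)
    (hp : ∀ σ : State, σ.var 0 = n → ∃ t, Exec p.toProg σ t (p.run σ) ∧ t ≤ T) (i : ℕ)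
    (σ : State) (hσ : σ.var 0 = n) (hi : σ.var x + i = n) :
    ∃ t, Exec (.loop (.lt (.var x) (.var 0)) (.seq p.toProg (.assign x (.succ (.var x))))) σ t
      ((fun ρ => (p.run ρ).setVar x ((p.run ρ).var x + 1))^[i] σ) ∧ t ≤ i * (T + 7) + 4 := by
  induction i generalizing σ with
  | zero =>
    refine ⟨_, Exec.loop_false ?_, by simp [Expr.cost]⟩
    simp only [Expr.eval, hσ, ← hi, Nat.add_zero, lt_irrefl, if_false]
  | succ i ih =>
    obtain ⟨s, hs, hsT⟩ := hp σ hσ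
    have h₁ : (p.run σ).var x = σ.var x := run_var hxp σ
    obtain ⟨t, ht, htT⟩ := ih ((p.run σ).setVar x ((p.run σ).var x + 1))
      (by simp [hx.symm, run_var h0, hσ]) (by simp [h₁]; omega)
    refine ⟨_, Exec.loop_true ?_ (Exec.seq hs (Exec.assign x _ _)) ht, ?_⟩
    · have : σ.var x < n := by omega
      simp [hσ, this]
    · simp only [Expr.cost]
      rw [Nat.add_mul]
      omega

/-- A command terminates in polynomial time. -/
theorem exec (c : Cmd) (hc : c.IsWF) (σ : State) (hn : 1 ≤ σ.var 0) :
    ∃ t, Exec c.toProg σ t (c.run σ) ∧ t ≤ c.weight * σ.var 0 ^ c.depth := by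
  obtain ⟨n, hσ⟩ : ∃ n, σ.var 0 = n := ⟨_, rfl⟩
  rw [hσ] at hn ⊢
  have hmono : ∀ w d d' : ℕ, d ≤ d' → w * n ^ d ≤ w * n ^ d' :=
    fun w d d' h => Nat.mul_le_mul le_rfl (Nat.pow_le_pow_right hn h)
  induction c generalizing σ with
  | skip => exact ⟨1, Exec.skip σ, by simp [weight, depth]⟩
  | assign x e => exact ⟨_, Exec.assign x e σ, by simp [weight, depth]⟩
  | store a i j e => exact ⟨_, Exec.store a i j e σ, by simp [weight, depth]⟩
  | seq p q hp hq =>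
    obtain ⟨s, hs, hsT⟩ := hp hc.1 σ hσ
    obtain ⟨t, ht, htT⟩ := hq hc.2 (p.run σ) (by rw [run_var hc.1.zero_notMem, hσ])
    refine ⟨_, Exec.seq hs ht, ?_⟩
    have h₁ := hmono p.weight p.depth (max p.depth q.depth) (le_max_left _ _)
    have h₂ := hmono q.weight q.depth (max p.depth q.depth) (le_max_right _ _)
    rw [weight, depth, Nat.add_mul]
    omega
  | branch b p q hp hq =>
    have h₁ := hmono p.weight p.depth (max p.depth q.depth) (le_max_left _ _)
    have h₂ := hmono q.weight q.depth (max p.depth q.depth) (le_max_right _ _)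
    have h₃ := hmono (b.cost + 1) 0 (max p.depth q.depth) (Nat.zero_le _)
    rw [pow_zero, Nat.mul_one] at h₃
    rw [weight, depth, Nat.add_mul, Nat.add_mul p.weight]
    by_cases hb : b.Holds σ
    · obtain ⟨s, hs, hsT⟩ := hp hc.1 σ hσ
      rw [run, if_pos hb]
      exact ⟨_, Exec.branch_true hb hs, by omega⟩
    · obtain ⟨s, hs, hsT⟩ := hq hc.2 σ hσ
      rw [run, if_neg hb]
      exact ⟨_, Exec.branch_false (by simpa [Expr.Holds] using hb) hs, by omega⟩
  | rep x p hp =>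
    obtain ⟨hx, hxp, hpw⟩ := hc
    obtain ⟨t, ht, htT⟩ := exec_loop hx hxp hpw.zero_notMem (hp hpw) n (σ.setVar x 0)
      (by simp [hx.symm, hσ]) (by simp)
    rw [run, hσ]
    refine ⟨_, Exec.seq (Exec.assign x (.const 0) σ) ht, ?_⟩
    have h₁ : n ^ 0 ≤ n ^ p.depth := Nat.pow_le_pow_right hn (Nat.zero_le _)
    have h₂ : n ^ 0 ≤ n ^ (p.depth + 1) := Nat.pow_le_pow_right hn (Nat.zero_le _)
    have h₃ : n * 7 ≤ n ^ (p.depth + 1) * 7 := by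
      rw [pow_succ']
      exact Nat.mul_le_mul (by simpa using Nat.mul_le_mul (le_refl n) h₁) le_rfl
    have h₄ : n * (p.weight * n ^ p.depth) = p.weight * n ^ (p.depth + 1) := by
      rw [pow_succ]; ring
    -- Apart from the body, a round costs 7 steps for the test and the increment. The last test
    -- costs 4 and the initial assignment 2, which makes 13 in all.
    rw [weight, depth, Nat.add_mul p.weight]
    rw [Nat.mul_add, h₄] at htT
    simp only [Expr.cost]
    simp only [pow_zero] at h₂
    omega

/-- Induction along a loop. -/
theorem rep_induction {x : ℕ} {c : Cmd} {σ : State} (hc : (rep x c).IsWF) (I : ℕ → State → Prop)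
    (init : I 0 (σ.setVar x 0))
    (step : ∀ i < σ.var 0, ∀ ρ : State, (∀ a ∉ c.arrs, ρ.arr a = σ.arr a) →
      (∀ z ∉ c.vars, z ≠ x → ρ.var z = σ.var z) → ρ.var x = i → I i ρ →
      I (i + 1) ((c.run ρ).setVar x (i + 1))) :
    I (σ.var 0) ((rep x c).run σ) := by
  have key : ∀ n ≤ σ.var 0, ∀ τ, τ =
      (fun ρ => (c.run ρ).setVar x ((c.run ρ).var x + 1))^[n] (σ.setVar x 0) →
      (∀ a ∉ c.arrs, τ.arr a = σ.arr a) ∧ (∀ z ∉ c.vars, z ≠ x → τ.var z = σ.var z) ∧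
      τ.var x = n ∧ I n τ := by
    intro n
    induction n with
    | zero =>
      rintro - τ rfl
      exact ⟨fun _ _ => rfl, fun z _ hz => by simp [hz], by simp, init⟩
    | succ n ih =>
      rintro hn τ rfl
      rw [Function.iterate_succ_apply']
      obtain ⟨h₁, h₂, h₃, h₄⟩ := ih (by omega) _ rfl
      have h₅ := run_var hc.2.1 ((fun ρ => (c.run ρ).setVar x ((c.run ρ).var x + 1))^[n]
        (σ.setVar x 0))
      refine ⟨fun a ha => ?_, fun z hz hzx => ?_, ?_, ?_⟩
      · rw [← h₁ a ha]
        exact run_arr ha _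
      · rw [← h₂ z hz hzx]
        simp [hzx, run_var hz]
      · simp [h₅, h₃]
      · simp only [h₅, h₃]
        exact step n (by omega) _ h₁ h₂ h₃ h₄
  rw [run]
  exact (key _ le_rfl _ rfl).2.2.2

/-- A loop that changes an array step by step along a relation `R`. -/
theorem rep_relation {x a : ℕ} {c : Cmd} {σ : State} (hc : (rep x c).IsWF)
    {R : (ℕ → ℕ → ℕ) → (ℕ → ℕ → ℕ) → Prop} (hrefl : ∀ f, R f f)
    (htrans : ∀ f g h, R f g → R g h → R f h) {Inv : (ℕ → ℕ → ℕ) → Prop}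
    {Q : ℕ → (ℕ → ℕ → ℕ) → Prop} (hQ : ∀ i f g, R f g → Q i f → Q i g)
    (init : Inv (σ.arr a))
    (step : ∀ i < σ.var 0, ∀ ρ : State, (∀ b ∉ c.arrs, ρ.arr b = σ.arr b) →
      (∀ z ∉ c.vars, z ≠ x → ρ.var z = σ.var z) → ρ.var x = i → Inv (ρ.arr a) →
      R (ρ.arr a) ((c.run ρ).arr a) ∧ Inv ((c.run ρ).arr a) ∧ Q i ((c.run ρ).arr a)) :
    R (σ.arr a) (((rep x c).run σ).arr a) ∧ Inv (((rep x c).run σ).arr a) ∧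
      ∀ i < σ.var 0, Q i (((rep x c).run σ).arr a) := by
  refine rep_induction hc (fun i ρ => R (σ.arr a) (ρ.arr a) ∧ Inv (ρ.arr a) ∧
    ∀ i' < i, Q i' (ρ.arr a)) ⟨hrefl _, init, fun i hi => by omega⟩ ?_
  rintro i hi ρ h₁ h₂ h₃ ⟨h₄, h₅, h₆⟩
  obtain ⟨h₇, h₈, h₉⟩ := step i hi ρ h₁ h₂ h₃ h₅
  refine ⟨htrans _ _ _ h₄ h₇, h₈, fun i' hi' => ?_⟩
  rcases Nat.lt_or_ge i' i with h | h
  · exact hQ _ _ _ h₇ (h₆ i' h)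
  · obtain rfl : i' = i := by omega
    exact h₉

end Cmd
end RAM

/-! ### Breadth-first search in a digraph on pairs of numbers -/

namespace RAM

/-- The expression `e` tests for the edge from the pair in `x₂₁, x₂₂` to the pair in `x₂₃, x₂₄`
in the digraph `E`, in all memories that agree with `σ` in the arrays of `A` and the variables
below `x₂₀`. -/
def Tests (A : List ℕ) (σ : State) (e : Expr) (E : ℕ → ℕ → ℕ → ℕ → Prop) : Prop :=
  ∀ ρ : State, (∀ b ∈ A, ρ.arr b = σ.arr b) → (∀ z < 20, ρ.var z = σ.var z) →
    (e.Holds ρ ↔ E (ρ.var 21) (ρ.var 22) (ρ.var 23) (ρ.var 24))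

/-- The state of a search for the distances to `(v, v)` after all pairs at distance at most `r`
have been found: `f x y - 1` is the distance of the pair, and `f x y = 0` for pairs not found. -/
structure IsStage (n v : ℕ) (E : ℕ → ℕ → ℕ → ℕ → Prop) (r b : ℕ) (f : ℕ → ℕ → ℕ) : Prop where
  target : f v v = 1
  eq_one : ∀ x < n, ∀ y < n, f x y = 1 → x = v ∧ y = v
  next : ∀ x < n, ∀ y < n, ∀ l, f x y = l + 2 → ∃ x' < n, ∃ y' < n, E x y x' y' ∧ f x' y' = l + 1
  le : ∀ x < n, ∀ y < n, f x y ≤ b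
  relax : ∀ x < n, ∀ y < n, ∀ x' < n, ∀ y' < n, E x y x' y' → f x' y' ≠ 0 → f x' y' ≤ r →
    f x y ≠ 0 ∧ f x y ≤ f x' y' + 1

namespace Cmd

/-- Assign a label to the pair `(x₂₁, x₂₂)` if it has a labelled successor `(x₂₃, x₂₄)`. -/
def label (a : ℕ) (e : Expr) : Cmd :=
  branch (((Expr.read a (.var 21) (.var 22)).not.and
    (.eq (.read a (.var 23) (.var 24)) (.succ (.var 20)))).and e)
    (store a (.var 21) (.var 22) (.succ (.succ (.var 20)))) skip

/-- One round of a search. -/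
def round (a : ℕ) (e : Expr) : Cmd := rep 21 (rep 22 (rep 23 (rep 24 (label a e))))

/-- Search backwards from the pair `(x₂, x₂)`, with labels in the array `a`. -/
def search (a : ℕ) (e : Expr) : Cmd :=
  seq (rep 21 (rep 22 (store a (.var 21) (.var 22) (.const 0))))
    (seq (store a (.var 2) (.var 2) (.const 1)) (rep 20 (round a e)))

theorem label_vars (a : ℕ) (e : Expr) : (label a e).vars = [] := rfl

theorem label_arrs (a : ℕ) (e : Expr) : (label a e).arrs = [a] := rfl

theorem label_isWF (a : ℕ) (e : Expr) : (label a e).IsWF := ⟨trivial, trivial⟩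

theorem round_isWF (a : ℕ) (e : Expr) : (round a e).IsWF := by
  exact ⟨by simp, by simp [vars, label_vars], by simp, by simp [vars, label_vars], by simp,
    by simp [vars, label_vars], by simp, by simp [label_vars], label_isWF a e⟩

theorem search_isWF (a : ℕ) (e : Expr) : (search a e).IsWF := by
  simp [search, IsWF, vars, round, label_vars, label_isWF]

theorem search_arrs (a b : ℕ) (e : Expr) (h : b ≠ a) : b ∉ (search a e).arrs := by
  simp [search, arrs, round, label_arrs, h]

theorem search_vars (z : ℕ) (a : ℕ) (e : Expr) (h : z < 20) : z ∉ (search a e).vars := by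
  simp [search, vars, round, label_vars]; omega

variable {A : List ℕ} {σ : State} {e : Expr} {E : ℕ → ℕ → ℕ → ℕ → Prop} {n v r a : ℕ}

/-- Some pairs without a label get the label `r + 2`. -/
def Labels (r : ℕ) (f g : ℕ → ℕ → ℕ) : Prop :=
  ∀ x y, g x y = f x y ∨ f x y = 0 ∧ g x y = r + 2

theorem Labels.refl (f : ℕ → ℕ → ℕ) : Labels r f f := fun _ _ => Or.inl rfl

theorem Labels.trans (f g h : ℕ → ℕ → ℕ) (h₁ : Labels r f g) (h₂ : Labels r g h) :
    Labels r f h := by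
  intro x y
  have := h₁ x y
  have := h₂ x y
  omega

/-- An unlabelled pair has no successor with a label from `1` to `r`, by `relax`. So `r + 2` is not
too large for a predecessor of a pair with label `r + 1`, and the stage is preserved. -/
theorem label_spec (he : Tests A σ e E) {ρ : State}
    (hA : ∀ b ∈ A, ρ.arr b = σ.arr b) (hz : ∀ z < 20, ρ.var z = σ.var z) {x y x' y' : ℕ}
    (hr : ρ.var 20 = r) (hx : ρ.var 21 = x) (hy : ρ.var 22 = y) (hx' : ρ.var 23 = x')
    (hy' : ρ.var 24 = y') (hxn : x < n) (hyn : y < n) (hxn' : x' < n) (hyn' : y' < n)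
    (hS : IsStage n v E r (r + 2) (ρ.arr a)) :
    Labels r (ρ.arr a) (((label a e).run ρ).arr a) ∧
      IsStage n v E r (r + 2) (((label a e).run ρ).arr a) ∧
      (E x y x' y' → ((label a e).run ρ).arr a x' y' = r + 1 →
        ((label a e).run ρ).arr a x y ≠ 0) := by
  have hE := he ρ hA hz
  rw [hx, hy, hx', hy'] at hE
  have hH : (((Expr.read a (.var 21) (.var 22)).not.and
      (.eq (.read a (.var 23) (.var 24)) (.succ (.var 20)))).and e).Holds ρ ↔
      (ρ.arr a x y = 0 ∧ ρ.arr a x' y' = r + 1) ∧ E x y x' y' := by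
    simp [hr, hx, hy, hx', hy', hE]
  rw [label]
  by_cases hcond : (ρ.arr a x y = 0 ∧ ρ.arr a x' y' = r + 1) ∧ E x y x' y'
  · rw [run, if_pos (hH.2 hcond)]
    obtain ⟨⟨h₁, h₂⟩, h₃⟩ := hcond
    simp only [run, Expr.eval, hr, hx, hy, State.setArr_arr, Function.update_self]
    set f := ρ.arr a with hf
    have hg : ∀ i l, Function.update f x (Function.update (f x) y (r + 1 + 1)) i l =
        if i = x ∧ l = y then r + 2 else f i l := by
      intro i l
      by_cases hi : i = x
      · subst hi
        by_cases hl : l = y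
        · simp [hl]
        · simp [hl]
      · simp [hi]
    have hlab : Labels r f (Function.update f x (Function.update (f x) y (r + 1 + 1))) := by
      intro i l
      rw [hg]
      split_ifs with h
      · exact Or.inr ⟨by rw [h.1, h.2, h₁], rfl⟩
      · exact Or.inl rfl
    refine ⟨hlab, ⟨?_, ?_, ?_, ?_, ?_⟩, fun _ _ => by simp⟩
    · rw [hg, if_neg, hS.target]
      rintro ⟨rfl, rfl⟩
      rw [hS.target] at h₁
      omega
    · intro i hi l hl h
      rw [hg] at h
      split_ifs at h with h₄
      · omega
      · exact hS.eq_one i hi l hl h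
    · intro i hi l hl k h
      rw [hg] at h
      split_ifs at h with h₄
      · obtain ⟨rfl, rfl⟩ := h₄
        refine ⟨x', hxn', y', hyn', h₃, ?_⟩
        rw [hg, if_neg, h₂]
        · omega
        · rintro ⟨rfl, rfl⟩
          omega
      · obtain ⟨i', hi', l', hl', h₅, h₆⟩ := hS.next i hi l hl k h
        refine ⟨i', hi', l', hl', h₅, ?_⟩
        rw [hg, if_neg, h₆]
        rintro ⟨rfl, rfl⟩
        omega
    · intro i hi l hl
      rw [hg]
      split_ifs
      · exact le_rfl
      · exact hS.le i hi l hl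
    · intro i hi l hl i' hi' l' hl' h₄ h₅ h₆
      have h₇ := hlab i' l'
      have h₈ := hlab i l
      have h₉ := hS.relax i hi l hl i' hi' l' hl' h₄
      omega
  · rw [run, if_neg (fun h => hcond (hH.1 h)), run]
    refine ⟨Labels.refl _, hS, fun h₁ h₂ h₃ => hcond ⟨⟨h₃, h₂⟩, h₁⟩⟩

/-- Once `Q` holds for an edge, it remains true: no label is erased, and new labels are `r + 2`,
never `r + 1`. So it accumulates through the four nested loops, and finally it yields `relax` for
the label `r + 1`. -/
theorem round_spec (ha : a ∉ A) (he : Tests A σ e E) {ρ : State}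
    (hA : ∀ b ∈ A, ρ.arr b = σ.arr b) (hz : ∀ z < 20, ρ.var z = σ.var z) (hn : σ.var 0 = n)
    (hr : ρ.var 20 = r) (hS : IsStage n v E r (r + 1) (ρ.arr a)) :
    IsStage n v E (r + 1) (r + 2) (((round a e).run ρ).arr a) := by
  have hS' : IsStage n v E r (r + 2) (ρ.arr a) :=
    ⟨hS.target, hS.eq_one, hS.next, fun x hx y hy => (hS.le x hx y hy).trans (Nat.le_succ _),
      hS.relax⟩
  let Q : ℕ → ℕ → ℕ → ℕ → (ℕ → ℕ → ℕ) → Prop :=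
    fun x y x' y' f => E x y x' y' → f x' y' = r + 1 → f x y ≠ 0
  have hQ : ∀ x y x' y' f g, Labels r f g → Q x y x' y' f → Q x y x' y' g := by
    intro x y x' y' f g h h₁ h₂ h₃ h₄
    have h₅ := h x y
    have h₆ := h x' y'
    exact h₁ h₂ (by omega) (by omega)
  have hw := round_isWF a e
  have hne : ∀ b ∈ A, b ≠ a := fun b hb h => ha (h ▸ hb)
  have h0 : ρ.var 0 = n := by rw [hz 0 (by omega), hn]
  obtain ⟨-, h₁, h₂⟩ := rep_relation (a := a) hw (R := Labels r) Labels.refl Labels.trans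
    (Inv := IsStage n v E r (r + 2)) (Q := fun x f => ∀ y < n, ∀ x' < n, ∀ y' < n, Q x y x' y' f)
    (fun x f g h h₁ y hy x' hx' y' hy' => hQ _ _ _ _ _ _ h (h₁ y hy x' hx' y' hy')) hS'
    (fun x hx ρ₁ hA₁ hv₁ hx₁ hS₁ => by
      have h0₁ : ρ₁.var 0 = n := by rw [hv₁ 0 (by simp [vars, label_vars]) (by simp), h0]
      obtain ⟨h₁, h₂, h₃⟩ := rep_relation (a := a) hw.2.2 (R := Labels r) Labels.refl Labels.trans
        (Inv := IsStage n v E r (r + 2)) (Q := fun y f => ∀ x' < n, ∀ y' < n, Q x y x' y' f)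
        (fun y f g h h₁ x' hx' y' hy' => hQ _ _ _ _ _ _ h (h₁ x' hx' y' hy')) hS₁
        (fun y hy ρ₂ hA₂ hv₂ hy₂ hS₂ => by
          have h0₂ : ρ₂.var 0 = n := by rw [hv₂ 0 (by simp [vars, label_vars]) (by simp), h0₁]
          obtain ⟨h₁, h₂, h₃⟩ := rep_relation (a := a) hw.2.2.2.2 (R := Labels r) Labels.refl
            Labels.trans (Inv := IsStage n v E r (r + 2))
            (Q := fun x' f => ∀ y' < n, Q x y x' y' f)
            (fun x' f g h h₁ y' hy' => hQ _ _ _ _ _ _ h (h₁ y' hy')) hS₂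
            (fun x' hx' ρ₃ hA₃ hv₃ hx₃ hS₃ => by
              have h0₃ : ρ₃.var 0 = n := by
                rw [hv₃ 0 (by simp [vars, label_vars]) (by simp), h0₂]
              obtain ⟨h₁, h₂, h₃⟩ := rep_relation (a := a) hw.2.2.2.2.2.2 (R := Labels r)
                Labels.refl Labels.trans (Inv := IsStage n v E r (r + 2))
                (Q := fun y' f => Q x y x' y' f)
                (fun y' f g h h₁ => hQ _ _ _ _ _ _ h h₁) hS₃
                (fun y' hy' ρ₄ hA₄ hv₄ hy₄ hS₄ => by
                  refine label_spec he (fun b hb => ?_) (fun z hz' => ?_) ?_ ?_ ?_ ?_ hy₄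
                    (h0 ▸ hx) (h0₁ ▸ hy) (h0₂ ▸ hx') (h0₃ ▸ hy') hS₄
                  · have hb' : ∀ c : Cmd, c.arrs = [a] → b ∉ c.arrs := by
                      intro c hc
                      simpa [hc] using hne b hb
                    rw [hA₄ b (hb' _ rfl), hA₃ b (hb' _ rfl), hA₂ b (hb' _ rfl),
                      hA₁ b (hb' _ rfl), hA b hb]
                  · rw [hv₄ z (by simp [label_vars]) (by omega),
                      hv₃ z (by simp [vars, label_vars]; omega) (by omega),
                      hv₂ z (by simp [vars, label_vars]; omega) (by omega),
                      hv₁ z (by simp [vars, label_vars]; omega) (by omega), hz z hz']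
                  · rw [hv₄ 20 (by simp [label_vars]) (by omega),
                      hv₃ 20 (by simp [vars, label_vars]) (by omega),
                      hv₂ 20 (by simp [vars, label_vars]) (by omega),
                      hv₁ 20 (by simp [vars, label_vars]) (by omega), hr]
                  · rw [hv₄ 21 (by simp [label_vars]) (by omega),
                      hv₃ 21 (by simp [vars, label_vars]) (by omega),
                      hv₂ 21 (by simp [vars, label_vars]) (by omega), hx₁]
                  · rw [hv₄ 22 (by simp [label_vars]) (by omega),
                      hv₃ 22 (by simp [vars, label_vars]) (by omega), hy₂]
                  · rw [hv₄ 23 (by simp [label_vars]) (by omega), hx₃])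
              exact ⟨h₁, h₂, fun y' hy' => h₃ y' (by omega)⟩)
          exact ⟨h₁, h₂, fun x' hx' => h₃ x' (by omega)⟩)
      exact ⟨h₁, h₂, fun y hy => h₃ y (by omega)⟩)
  refine ⟨h₁.target, h₁.eq_one, h₁.next, h₁.le, fun x hx y hy x' hx' y' hy' h₃ h₄ h₅ => ?_⟩
  rcases Nat.lt_or_ge r ((((round a e).run ρ).arr a) x' y') with h₆ | h₆
  · have h₇ : (((round a e).run ρ).arr a) x' y' = r + 1 := by omega
    exact ⟨h₂ x (h0 ▸ hx) y hy x' hx' y' hy' h₃ h₇, by rw [h₇]; exact h₁.le x hx y hy⟩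
  · exact h₁.relax x hx y hy x' hx' y' hy' h₃ h₄ h₆

/-- The array may still hold labels from the search for an earlier guess. -/
theorem clear_spec {ρ : State} (hn : ρ.var 0 = n) : ∀ x < n, ∀ y < n,
    ((rep 21 (rep 22 (store a (.var 21) (.var 22) (.const 0)))).run ρ).arr a x y = 0 := by
  have hw : (rep 21 (rep 22 (store a (.var 21) (.var 22) (.const 0)))).IsWF := by
    simp [IsWF, vars]
  let R : (ℕ → ℕ → ℕ) → (ℕ → ℕ → ℕ) → Prop := fun f g => ∀ x y, f x y = 0 → g x y = 0
  have h₁ := (rep_relation (a := a) (σ := ρ) hw (R := R) (fun f x y h => h)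
    (fun f g h h₁ h₂ x y h₃ => h₂ x y (h₁ x y h₃)) (Inv := fun _ => True)
    (Q := fun x f => ∀ y < n, f x y = 0) (fun x f g h h₁ y hy => h x y (h₁ y hy)) trivial
    (fun x hx ρ₁ _ hv₁ hx₁ _ => by
      have h0₁ : ρ₁.var 0 = n := by rw [hv₁ 0 (by simp [vars]) (by simp), hn]
      obtain ⟨h₁, -, h₃⟩ := rep_relation (a := a) (σ := ρ₁) hw.2.2 (R := R) (fun f x y h => h)
        (fun f g h h₁ h₂ x y h₃ => h₂ x y (h₁ x y h₃)) (Inv := fun _ => True)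
        (Q := fun y f => f x y = 0) (fun y f g h h₁ => h x y h₁) trivial
        (fun y hy ρ₂ _ hv₂ hy₂ _ => by
          have hx₂ : ρ₂.var 21 = x := by rw [hv₂ 21 (by simp [vars]) (by simp), hx₁]
          simp only [run, Expr.eval, State.setArr_arr, Function.update_self, hx₂, hy₂, true_and]
          refine ⟨fun i l h => ?_, trivial⟩
          by_cases hi : i = x
          · subst hi
            by_cases hl : l = y
            · simp [hl]
            · simpa [hl] using h
          · simpa [hi] using h)
      exact ⟨h₁, trivial, fun y hy => h₃ y (by omega)⟩)).2.2
  exact fun x hx y hy => h₁ x (by omega) y hy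

/-- Each round settles one more distance. In a digraph on pairs distances can exceed `n`, but `n`
rounds are enough for the paths that matter, which have fewer than `n` edges. -/
theorem search_spec (ha : a ∉ A) (he : Tests A σ e E) (hn : σ.var 0 = n) (hv : σ.var 2 = v)
    (hvn : v < n) : IsStage n v E n (n + 1) (((search a e).run σ).arr a) := by
  have hne : ∀ b ∈ A, b ≠ a := fun b hb h => ha (h ▸ hb)
  rw [search, run, run]
  set σ₁ := (rep 21 (rep 22 (store a (.var 21) (.var 22) (.const 0)))).run σ with hσ₁
  have hA₁ : ∀ b ∈ A, σ₁.arr b = σ.arr b := fun b hb => run_arr (by simp [arrs, hne b hb]) σ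
  have hv₁ : ∀ z < 20, σ₁.var z = σ.var z := fun z hz => run_var (by simp [vars]; omega) σ
  have hc₁ : ∀ x < n, ∀ y < n, σ₁.arr a x y = 0 := clear_spec hn
  set σ₂ := (store a (.var 2) (.var 2) (.const 1)).run σ₁ with hσ₂
  have hA₂ : ∀ b ∈ A, σ₂.arr b = σ.arr b := fun b hb => by
    rw [hσ₂, run_arr (by simp [arrs, hne b hb]), hA₁ b hb]
  have hv₂ : ∀ z < 20, σ₂.var z = σ.var z := hv₁
  have hf : ∀ x < n, ∀ y < n, σ₂.arr a x y = if x = v ∧ y = v then 1 else 0 := by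
    intro x hx y hy
    simp only [hσ₂, run, Expr.eval, State.setArr_arr, Function.update_self, hv₁ 2 (by omega), hv]
    by_cases hi : x = v
    · subst hi
      by_cases hl : y = x
      · simp [hl]
      · simp [hl, hc₁ x hx y hy]
    · simp [hi, hc₁ x hx y hy]
  -- At the start `relax` is vacuous, since a nonzero label is not at most `0`.
  have h0 : IsStage n v E 0 1 (σ₂.arr a) := by
    refine ⟨by rw [hf v hvn v hvn]; simp, fun x hx y hy h => ?_, fun x hx y hy l h => ?_,
      fun x hx y hy => ?_, fun x hx y hy x' hx' y' hy' _ h h' => by omega⟩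
    all_goals rw [hf x hx y hy] at *
    all_goals split_ifs at *
    all_goals first | assumption | omega
  have hn₂ : σ₂.var 0 = n := by rw [hv₂ 0 (by omega), hn]
  have := rep_induction (σ := σ₂) (x := 20) (c := round a e)
    ⟨by simp, by simp [round, vars, label_vars], round_isWF a e⟩
    (fun r ρ => IsStage n v E r (r + 1) (ρ.arr a)) h0 (fun r hr ρ hA hz hρ hS => by
      refine round_spec ha he (fun b hb => ?_) (fun z hz' => ?_) hn hρ hS
      · rw [hA b (by simp [round, arrs, label_arrs, hne b hb]), hA₂ b hb]
      · rw [hz z (by simp [round, vars, label_vars]; omega) (by omega), hv₂ z hz'])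
  rwa [hn₂] at this

end Cmd
end RAM

/-! ### Tracing a shortest path along the labels, and marking vertices. -/

namespace RAM
namespace Cmd

variable {A : List ℕ} {σ : State} {e : Expr} {E : ℕ → ℕ → ℕ → ℕ → Prop} {n v r a w w' : ℕ}

/-- The pair `(p, q)` is a successor of `(c, c')` in the digraph `E` that is closer to the target
according to the labels `f`. -/
def Closer (n : ℕ) (E : ℕ → ℕ → ℕ → ℕ → Prop) (f : ℕ → ℕ → ℕ) (c c' p q : ℕ) : Prop :=
  p < n ∧ q < n ∧ E c c' p q ∧ f p q ≠ 0 ∧ f p q + 1 = f c c'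

/-- Copy the pair `(x₂₃, x₂₄)` to `(x₂₇, x₂₈)` if it is a closer successor of `(x₂₁, x₂₂)`. -/
def pick (a : ℕ) (e : Expr) : Cmd :=
  branch ((e.and (.read a (.var 23) (.var 24))).and
    (.eq (.succ (.read a (.var 23) (.var 24))) (.read a (.var 21) (.var 22))))
    (seq (assign 27 (.var 23)) (assign 28 (.var 24))) skip

/-- Move from the pair `(x₂₁, x₂₂)` to a closer successor. -/
def advance (a : ℕ) (e : Expr) : Cmd :=
  seq (seq (assign 27 (.var 21)) (assign 28 (.var 22)))
    (seq (rep 23 (rep 24 (pick a e))) (seq (assign 21 (.var 27)) (assign 22 (.var 28))))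

/-- Write the pairs on a shortest path from the pair `(x₂₁, x₂₂)` to the target of a search into
the arrays `w` and `w'`. -/
def trace (a : ℕ) (e : Expr) (w w' : ℕ) : Cmd :=
  rep 20 (seq (seq (store w (.var 20) (.const 0) (.var 21))
    (store w' (.var 20) (.const 0) (.var 22))) (advance a e))

theorem pick_vars (a : ℕ) (e : Expr) : (pick a e).vars = [27, 28] := rfl

theorem pick_arrs (a : ℕ) (e : Expr) : (pick a e).arrs = [] := rfl

theorem pick_isWF (a : ℕ) (e : Expr) : (pick a e).IsWF := by simp [pick, IsWF]

theorem picks_isWF (a : ℕ) (e : Expr) : (rep 23 (rep 24 (pick a e))).IsWF :=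
  ⟨by simp, by simp [vars, pick_vars], by simp, by simp [pick_vars], pick_isWF a e⟩

theorem advance_vars (a : ℕ) (e : Expr) :
    (advance a e).vars = [27, 28, 23, 24, 27, 28, 21, 22] := rfl

theorem advance_arrs (a : ℕ) (e : Expr) : (advance a e).arrs = [] := rfl

theorem trace_isWF (a : ℕ) (e : Expr) (w w' : ℕ) : (trace a e w w').IsWF :=
  ⟨by simp, by simp [vars, advance_vars], ⟨trivial, trivial⟩, ⟨by simp [IsWF], picks_isWF a e,
    by simp [IsWF]⟩⟩

theorem trace_arrs (b a : ℕ) (e : Expr) (w w' : ℕ) (h : b ≠ w) (h' : b ≠ w') :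
    b ∉ (trace a e w w').arrs := by
  simp [trace, arrs, advance_arrs, h, h']

theorem trace_vars (z a : ℕ) (e : Expr) (w w' : ℕ) (h : z < 20) :
    z ∉ (trace a e w w').vars := by
  simp [trace, vars, advance_vars]; omega

theorem pick_spec (he : Tests A σ e E) {ρ : State} (hA : ∀ b ∈ A, ρ.arr b = σ.arr b)
    (hz : ∀ z < 20, ρ.var z = σ.var z) {c c' p q : ℕ} (hc : ρ.var 21 = c) (hc' : ρ.var 22 = c')
    (hp : ρ.var 23 = p) (hq : ρ.var 24 = q) (hpn : p < n) (hqn : q < n) :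
    (Closer n E (ρ.arr a) c c' p q ∧ ((pick a e).run ρ).var 27 = p ∧
      ((pick a e).run ρ).var 28 = q) ∨
    (¬ Closer n E (ρ.arr a) c c' p q ∧ ((pick a e).run ρ).var 27 = ρ.var 27 ∧
      ((pick a e).run ρ).var 28 = ρ.var 28) := by
  have hE := he ρ hA hz
  rw [hc, hc', hp, hq] at hE
  have hH : ((e.and (.read a (.var 23) (.var 24))).and
      (.eq (.succ (.read a (.var 23) (.var 24))) (.read a (.var 21) (.var 22)))).Holds ρ ↔
      Closer n E (ρ.arr a) c c' p q := by
    simp [Closer, hc, hc', hp, hq, hE, hpn, hqn, and_assoc]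
  rw [pick]
  by_cases hcl : Closer n E (ρ.arr a) c c' p q
  · rw [run, if_pos (hH.2 hcl)]
    exact Or.inl ⟨hcl, by simp [run, hp], by simp [run, hq]⟩
  · rw [run, if_neg (fun h => hcl (hH.1 h))]
    exact Or.inr ⟨hcl, rfl, rfl⟩

/-- The invariant has two cases: a closer successor has been copied, possibly over an earlier one,
or none has been met and `x₂₇, x₂₈` still hold the current pair. -/
theorem picks_spec (he : Tests A σ e E) {ρ : State} (hA : ∀ b ∈ A, ρ.arr b = σ.arr b)
    (hz : ∀ z < 20, ρ.var z = σ.var z) (hn : σ.var 0 = n) {c c' : ℕ} (hc : ρ.var 21 = c)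
    (hc' : ρ.var 22 = c') (hi : ρ.var 27 = c) (hi' : ρ.var 28 = c') {τ : State}
    (hτ : τ = (rep 23 (rep 24 (pick a e))).run ρ) :
    Closer n E (ρ.arr a) c c' (τ.var 27) (τ.var 28) ∨
      (τ.var 27 = c ∧ τ.var 28 = c' ∧ ∀ p q, ¬ Closer n E (ρ.arr a) c c' p q) := by
  have hw := picks_isWF a e
  have h0 : ρ.var 0 = n := by rw [hz 0 (by omega), hn]
  have key := rep_induction (σ := ρ) hw (fun i τ =>
    Closer n E (ρ.arr a) c c' (τ.var 27) (τ.var 28) ∨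
      (τ.var 27 = c ∧ τ.var 28 = c' ∧ ∀ p < i, ∀ q, ¬ Closer n E (ρ.arr a) c c' p q))
    (Or.inr ⟨by simp [hi], by simp [hi'], fun p hp => by omega⟩) (by
      intro i hin ρ₁ ha₁ hv₁ hi₁ hI
      have h0₁ : ρ₁.var 0 = n := by rw [hv₁ 0 (by simp [vars, pick_vars]) (by simp), h0]
      have := rep_induction (σ := ρ₁) hw.2.2 (fun l τ =>
        Closer n E (ρ.arr a) c c' (τ.var 27) (τ.var 28) ∨
          (τ.var 27 = c ∧ τ.var 28 = c' ∧ (∀ p < i, ∀ q, ¬ Closer n E (ρ.arr a) c c' p q) ∧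
            ∀ q < l, ¬ Closer n E (ρ.arr a) c c' i q))
        (hI.imp (by simp) (by simp +contextual)) (by
          intro l hln ρ₂ ha₂ hv₂ hl₂ hJ
          have hav : ∀ b, ρ₂.arr b = ρ.arr b := fun b => by
            rw [ha₂ b (by simp [pick_arrs]), ha₁ b (by simp [arrs, pick_arrs])]
          have hsp := pick_spec (a := a) (n := n) he (ρ := ρ₂) (c := c) (c' := c') (p := i) (q := l)
            (fun b hb => by rw [hav, hA b hb])
            (fun z hz' => by
              rw [hv₂ z (by simp [pick_vars]; omega) (by omega),
                hv₁ z (by simp [vars, pick_vars]; omega) (by omega), hz z hz'])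
            (by rw [hv₂ 21 (by simp [pick_vars]) (by omega),
              hv₁ 21 (by simp [vars, pick_vars]) (by omega), hc])
            (by rw [hv₂ 22 (by simp [pick_vars]) (by omega),
              hv₁ 22 (by simp [vars, pick_vars]) (by omega), hc'])
            (by rw [hv₂ 23 (by simp [pick_vars]) (by omega), hi₁]) hl₂ (by omega) (by omega)
          rw [hav a] at hsp
          simp only [State.setVar_var, ne_eq, Nat.reduceEqDiff, not_false_eq_true,
            Function.update_of_ne]
          rcases hsp with ⟨h₁, h₂, h₃⟩ | ⟨h₁, h₂, h₃⟩
          · rw [h₂, h₃]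
            exact Or.inl h₁
          · rw [h₂, h₃]
            refine hJ.imp id fun ⟨h₄, h₅, h₆, h₇⟩ => ⟨h₄, h₅, h₆, fun q hq => ?_⟩
            rcases Nat.lt_or_ge q l with h₈ | h₈
            · exact h₇ q h₈
            · obtain rfl : q = l := by omega
              exact h₁)
      rw [h0₁] at this
      simp only [State.setVar_var, ne_eq, Nat.reduceEqDiff, not_false_eq_true,
        Function.update_of_ne]
      refine this.imp id fun ⟨h₄, h₅, h₆, h₇⟩ => ⟨h₄, h₅, fun p hp q => ?_⟩
      rcases Nat.lt_or_ge p i with h₈ | h₈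
      · exact h₆ p h₈ q
      · obtain rfl : p = i := by omega
        exact fun h => h₇ q h.2.1 h)
  rw [← hτ, h0] at key
  exact key.imp id fun ⟨h₁, h₂, h₃⟩ => ⟨h₁, h₂, fun p q h => h₃ p h.1 q h⟩

/-- The current pair is copied first and serves as the default, so the search stays where it is if
there is no closer successor. -/
theorem advance_spec (he : Tests A σ e E) {ρ : State} (hA : ∀ b ∈ A, ρ.arr b = σ.arr b)
    (hz : ∀ z < 20, ρ.var z = σ.var z) (hn : σ.var 0 = n) {c c' : ℕ} (hc : ρ.var 21 = c)
    (hc' : ρ.var 22 = c') {τ : State} (hτ : τ = (advance a e).run ρ) :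
    Closer n E (ρ.arr a) c c' (τ.var 21) (τ.var 22) ∨
      (τ.var 21 = c ∧ τ.var 22 = c' ∧ ∀ p q, ¬ Closer n E (ρ.arr a) c c' p q) := by
  rw [advance, run, run] at hτ
  set ρ₁ := (seq (assign 27 (.var 21)) (assign 28 (.var 22))).run ρ with hρ₁
  have hv : ∀ z, z ≠ 27 → z ≠ 28 → ρ₁.var z = ρ.var z := fun z h h' =>
    run_var (by simp [vars, h, h']) ρ
  have h := picks_spec (a := a) he (ρ := ρ₁) (c := c) (c' := c') hA
    (fun z hz' => by rw [hv z (by omega) (by omega), hz z hz']) hn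
    (by rw [hv 21 (by simp) (by simp), hc]) (by rw [hv 22 (by simp) (by simp), hc'])
    (by simp [hρ₁, run, hc]) (by simp [hρ₁, run, hc']) rfl
  have h₁ : ρ₁.arr = ρ.arr := rfl
  rw [h₁] at h
  rw [hτ]
  generalize (rep 23 (rep 24 (pick a e))).run ρ₁ = ρ₂ at h ⊢
  simpa [run] using h

/-- Each move lowers the label by one until the target is reached, and from then on the target is
repeated; hence the minimum in the invariant. Only the cells `0, …, n - 1` are written, so a
complete record of the path requires `l < n`. -/
theorem trace_spec (he : Tests A σ e E) (hn : σ.var 0 = n) (hw : w ∉ A) (hw' : w' ∉ A)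
    (hww : w ≠ w') (hwa : a ≠ w) (hwa' : a ≠ w') {x₀ y₀ l b : ℕ} (hx₀ : σ.var 21 = x₀)
    (hy₀ : σ.var 22 = y₀) (hxn : x₀ < n) (hyn : y₀ < n) (hS : IsStage n v E n b (σ.arr a))
    (hl : σ.arr a x₀ y₀ = l + 1) (hln : l < n) :
    ∃ X Y : ℕ → ℕ, X 0 = x₀ ∧ Y 0 = y₀ ∧
      (∀ i ≤ l, X i < n ∧ Y i < n ∧ σ.arr a (X i) (Y i) + i = l + 1) ∧
      (∀ i < l, E (X i) (Y i) (X (i + 1)) (Y (i + 1))) ∧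
      (∀ i < n, l ≤ i → X i = v ∧ Y i = v) ∧
      ∀ i < n, ((trace a e w w').run σ).arr w i 0 = X i ∧
        ((trace a e w w').run σ).arr w' i 0 = Y i := by
  have key := rep_induction (σ := σ) (trace_isWF a e w w') (fun i ρ => ∃ X Y : ℕ → ℕ,
    X 0 = x₀ ∧ Y 0 = y₀ ∧ (∀ k ≤ i, X k < n ∧ Y k < n ∧ σ.arr a (X k) (Y k) + min k l = l + 1) ∧
    (∀ k < i, k < l → E (X k) (Y k) (X (k + 1)) (Y (k + 1))) ∧
    ρ.var 21 = X i ∧ ρ.var 22 = Y i ∧ ∀ k < i, ρ.arr w k 0 = X k ∧ ρ.arr w' k 0 = Y k)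
    ⟨fun _ => x₀, fun _ => y₀, rfl, rfl, fun k hk => ⟨hxn, hyn, by
        obtain rfl : k = 0 := by omega
        simpa using hl⟩, fun k hk => by omega, by simp [hx₀], by simp [hy₀],
        fun k hk => by omega⟩ (by
    rintro i hi ρ ha hv hρ ⟨X, Y, hX₀, hY₀, hlab, hE, hX, hY, hst⟩
    set τ := ((seq (seq (store w (.var 20) (.const 0) (.var 21))
      (store w' (.var 20) (.const 0) (.var 22))) (advance a e)).run ρ) with hτ
    rw [run] at hτ
    set ρ₁ := (seq (store w (.var 20) (.const 0) (.var 21))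
      (store w' (.var 20) (.const 0) (.var 22))).run ρ with hρ₁
    have hv₁ : ∀ z, ρ₁.var z = ρ.var z := fun z => run_var (by simp [vars]) ρ
    have ha₁ : ∀ b, b ≠ w → b ≠ w' → ρ₁.arr b = σ.arr b := fun b h h' => by
      rw [hρ₁, run_arr (by simp [arrs, h, h']),
        ha b (by simp [arrs, advance_arrs, h, h'])]
    have hst₁ : ∀ k < i + 1, τ.arr w k 0 = X k ∧ τ.arr w' k 0 = Y k := by
      intro k hk
      have hτa : ∀ b, τ.arr b = ρ₁.arr b := fun b => by rw [hτ, run_arr (by simp [advance_arrs])]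
      rw [hτa, hτa, hρ₁]
      simp only [run, Expr.eval, State.setArr_arr, State.setArr_var, Function.update_self,
        Function.update_of_ne hww, Function.update_of_ne hww.symm, hρ, hX, hY]
      by_cases hki : k = i
      · subst hki
        simp
      · simpa [hki] using hst k (by omega)
    have hadv := advance_spec (a := a) he (ρ := ρ₁) (c := X i) (c' := Y i)
      (fun b hb => ha₁ b (fun h => hw (h ▸ hb)) (fun h => hw' (h ▸ hb)))
      (fun z hz => by rw [hv₁, hv z (by simp [vars, advance_vars]; omega) (by omega)]) hn
      (by rw [hv₁, hX]) (by rw [hv₁, hY]) hτ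
    rw [ha₁ a hwa hwa'] at hadv
    obtain ⟨h₁, h₂, h₃⟩ := hlab i le_rfl
    simp only [State.setVar_var, State.setVar_arr, ne_eq, Nat.reduceEqDiff, not_false_eq_true,
      Function.update_of_ne]
    rcases hadv with ⟨h₄, h₅, h₆, h₇, h₈⟩ | ⟨h₄, h₅, h₆⟩
    · have hil : i < l := by omega
      refine ⟨fun k => if k ≤ i then X k else τ.var 21, fun k => if k ≤ i then Y k else τ.var 22,
        by simp [hX₀], by simp [hY₀], fun k hk => ?_, fun k hk hkl => ?_, by simp, by simp,
        fun k hk => ?_⟩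
      · by_cases hki : k ≤ i
        · simpa [hki] using hlab k hki
        · simp only [hki, if_false]
          exact ⟨h₄, h₅, by omega⟩
      · by_cases hki : k + 1 ≤ i
        · simpa [hki, show k ≤ i by omega] using hE k (by omega) hkl
        · obtain rfl : k = i := by omega
          simpa using h₆
      · simpa [show k ≤ i by omega] using hst₁ k hk
    -- A pair whose label exceeds `1` has a closer successor by `next`, so the trace can stop only
    -- at the target.
    · have hil : l ≤ i := by
        by_contra hcon
        obtain ⟨p, hp, q, hq, h₇, h₈⟩ := hS.next (X i) h₁ (Y i) h₂ (l - i - 1) (by omega)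
        exact h₆ p q ⟨hp, hq, h₇, by omega, by omega⟩
      refine ⟨fun k => if k ≤ i then X k else X i, fun k => if k ≤ i then Y k else Y i,
        by simp [hX₀], by simp [hY₀], fun k hk => ?_, fun k hk hkl => ?_, by simp [h₄],
        by simp [h₅], fun k hk => ?_⟩
      · by_cases hki : k ≤ i
        · simpa [hki] using hlab k hki
        · simp only [hki, if_false]
          exact ⟨h₁, h₂, by omega⟩
      · simpa [show k + 1 ≤ i by omega, show k ≤ i by omega] using hE k (by omega) hkl
      · simpa [show k ≤ i by omega] using hst₁ k hk)
  rw [hn] at key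
  obtain ⟨X, Y, hX₀, hY₀, hlab, hE, -, -, hst⟩ := key
  refine ⟨X, Y, hX₀, hY₀, fun i hi => ?_, fun i hi => hE i (by omega) hi, fun i hi hli => ?_, hst⟩
  · obtain ⟨h₁, h₂, h₃⟩ := hlab i (by omega)
    exact ⟨h₁, h₂, by omega⟩
  · obtain ⟨h₁, h₂, h₃⟩ := hlab i (by omega)
    exact hS.eq_one _ h₁ _ h₂ (by omega)

/-- Mark in the array `a` all numbers `x₂₁` for which `e` holds with some value of `x₂₀`. -/
def mark (a : ℕ) (e : Expr) : Cmd :=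
  seq (rep 21 (store a (.var 21) (.const 0) (.const 0)))
    (rep 20 (rep 21 (branch e (store a (.var 21) (.const 0) (.const 1)) skip)))

theorem mark_isWF (a : ℕ) (e : Expr) : (mark a e).IsWF := by
  simp [mark, IsWF, vars]

theorem mark_arrs (b a : ℕ) (e : Expr) (h : b ≠ a) : b ∉ (mark a e).arrs := by
  simp [mark, arrs, h]

theorem mark_vars (z a : ℕ) (e : Expr) (h : z < 20) : z ∉ (mark a e).vars := by
  simp [mark, vars]; omega

/-- Marks are cleared once and afterwards only set, so the loops compute an existential quantifier.
As `a` is not in `A`, setting a mark does not change the truth of `e`. -/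
theorem mark_spec (ha : a ∉ A) {F : ℕ → ℕ → Prop}
    (he : ∀ ρ : State, (∀ b ∈ A, ρ.arr b = σ.arr b) → (∀ z < 20, ρ.var z = σ.var z) →
      (e.Holds ρ ↔ F (ρ.var 20) (ρ.var 21))) (hn : σ.var 0 = n) :
    ∀ z < n, ((mark a e).run σ).arr a z 0 ≠ 0 ↔ ∃ i < n, F i z := by
  have hne : ∀ b ∈ A, b ≠ a := fun b hb h => ha (h ▸ hb)
  rw [mark, run]
  set σ₁ := (rep 21 (store a (.var 21) (.const 0) (.const 0))).run σ with hσ₁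
  have hA₁ : ∀ b ∈ A, σ₁.arr b = σ.arr b := fun b hb => run_arr (by simp [arrs, hne b hb]) σ
  have hv₁ : ∀ z < 20, σ₁.var z = σ.var z := fun z hz => run_var (by simp [vars]; omega) σ
  have h0₁ : σ₁.var 0 = n := by rw [hv₁ 0 (by omega), hn]
  have hc₁ : ∀ z < n, σ₁.arr a z 0 = 0 := by
    have h := (rep_relation (a := a) (σ := σ) (x := 21)
      (c := store a (.var 21) (.const 0) (.const 0)) (by simp [IsWF, vars])
      (R := fun f g => ∀ z, f z 0 = 0 → g z 0 = 0) (fun f z h => h)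
      (fun f g h h₁ h₂ z h₃ => h₂ z (h₁ z h₃)) (Inv := fun _ => True)
      (Q := fun z f => f z 0 = 0) (fun z f g h h₁ => h z h₁) trivial
      (fun z hz ρ _ _ hρ _ => by
        simp only [run, Expr.eval, State.setArr_arr, Function.update_self, hρ, true_and]
        refine ⟨fun i h => ?_, trivial⟩
        by_cases hi : i = z
        · simp [hi]
        · simpa [hi] using h)).2.2
    rwa [hn] at h
  have hw : (rep 20 (rep 21 (branch e (store a (.var 21) (.const 0) (.const 1)) skip))).IsWF := by
    simp [IsWF, vars]
  let R : (ℕ → ℕ → ℕ) → (ℕ → ℕ → ℕ) → Prop := fun f g => ∀ z, f z 0 ≠ 0 → g z 0 ≠ 0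
  have h := rep_relation (a := a) (σ := σ₁) hw (R := R) (fun f z h => h)
    (fun f g h h₁ h₂ z h₃ => h₂ z (h₁ z h₃))
    (Inv := fun f => ∀ z < n, f z 0 ≠ 0 → ∃ i < n, F i z)
    (Q := fun i f => ∀ z < n, F i z → f z 0 ≠ 0) (fun i f g h h₁ z hz hF => h z (h₁ z hz hF))
    (fun z hz h => absurd (hc₁ z hz) h)
    (fun i hi ρ₁ hA₂ hv₂ hi₁ hI => by
      have h0₂ : ρ₁.var 0 = n := by rw [hv₂ 0 (by simp [vars]) (by simp), h0₁]
      obtain ⟨h₁, h₂, h₃⟩ := rep_relation (a := a) (σ := ρ₁) hw.2.2 (R := R) (fun f z h => h)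
        (fun f g h h₁ h₂ z h₃ => h₂ z (h₁ z h₃))
        (Inv := fun f => ∀ z < n, f z 0 ≠ 0 → ∃ i < n, F i z)
        (Q := fun z f => F i z → f z 0 ≠ 0) (fun i f g h h₁ hF => h _ (h₁ hF)) hI
        (fun z hz ρ₂ hA₃ hv₃ hz₂ hI₂ => by
          have hi₂ : ρ₂.var 20 = i := by rw [hv₃ 20 (by simp [vars]) (by simp), hi₁]
          have hH := he ρ₂ (fun b hb => by
              rw [hA₃ b (by simp [arrs, hne b hb]), hA₂ b (by simp [arrs, hne b hb]), hA₁ b hb])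
            (fun y hy => by
              rw [hv₃ y (by simp [vars]) (by omega), hv₂ y (by simp [vars]; omega) (by omega),
                hv₁ y hy])
          rw [hi₂, hz₂] at hH
          by_cases hF : F i z
          · rw [run, if_pos (hH.2 hF)]
            simp only [run, Expr.eval, State.setArr_arr, Function.update_self, hz₂]
            refine ⟨fun y h => ?_, fun y hy h => ?_, fun _ => by simp⟩
            · by_cases hyz : y = z
              · simp [hyz]
              · simpa [hyz] using h
            · by_cases hyz : y = z
              · exact ⟨i, by omega, hyz ▸ hF⟩
              · exact hI₂ y hy (by simpa [hyz] using h)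
          · rw [run, if_neg (fun h => hF (hH.1 h))]
            exact ⟨fun _ h => h, hI₂, fun h => absurd h hF⟩)
      exact ⟨h₁, h₂, fun z hz => h₃ z (by omega)⟩)
  intro z hz
  exact ⟨h.2.1 z hz, fun ⟨i, hi, hF⟩ => h.2.2 i (by omega) z hz hF⟩

end Cmd
end RAM

/-! ### Searches in graphs -/

namespace RAM

section Stage

variable {n v r b l : ℕ} {E : ℕ → ℕ → ℕ → ℕ → Prop} {f : ℕ → ℕ → ℕ}

theorem IsStage.exists_path (hS : IsStage n v E r b f) {x y : ℕ} (hx : x < n) (hy : y < n)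
    (hl : f x y = l + 1) : ∃ X Y : ℕ → ℕ, X 0 = x ∧ Y 0 = y ∧ X l = v ∧ Y l = v ∧
      (∀ i ≤ l, X i < n ∧ Y i < n ∧ f (X i) (Y i) + i = l + 1) ∧
      ∀ i < l, E (X i) (Y i) (X (i + 1)) (Y (i + 1)) := by
  induction l generalizing x y with
  | zero =>
    obtain ⟨h₁, h₂⟩ := hS.eq_one x hx y hy hl
    exact ⟨fun _ => x, fun _ => y, rfl, rfl, h₁, h₂, fun i hi => ⟨hx, hy, by
      obtain rfl : i = 0 := by omega
      exact hl⟩, fun i hi => by omega⟩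
  | succ l ih =>
    obtain ⟨x', hx', y', hy', hE, h₁⟩ := hS.next x hx y hy l hl
    obtain ⟨X, Y, rfl, rfl, hXl, hYl, h₂, h₃⟩ := ih hx' hy' h₁
    refine ⟨fun i => if i = 0 then x else X (i - 1), fun i => if i = 0 then y else Y (i - 1),
      by simp, by simp, by simpa, by simpa, fun i hi => ?_, fun i hi => ?_⟩
    · rcases i with _ | i
      · simp [hx, hy, hl]
      · have := h₂ i (by omega)
        simp only [Nat.add_eq_zero_iff, one_ne_zero, and_false, if_false, Nat.add_sub_cancel]
        omega
    · rcases i with _ | i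
      · simpa using hE
      · simpa using h₃ i (by omega)

/-- Go backwards from the target with `relax`. It applies throughout because the labels on the way
are at most `l ≤ n`. -/
theorem IsStage.le_of_path (hS : IsStage n v E n b f) {X Y : ℕ → ℕ} (hln : l ≤ n)
    (hX : ∀ i ≤ l, X i < n ∧ Y i < n) (hXl : X l = v) (hYl : Y l = v)
    (hE : ∀ i < l, E (X i) (Y i) (X (i + 1)) (Y (i + 1))) :
    f (X 0) (Y 0) ≠ 0 ∧ f (X 0) (Y 0) ≤ l + 1 := by
  have key : ∀ i ≤ l, f (X (l - i)) (Y (l - i)) ≠ 0 ∧ f (X (l - i)) (Y (l - i)) ≤ i + 1 := by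
    intro i
    induction i with
    | zero =>
      intro _
      rw [Nat.sub_zero, hXl, hYl, hS.target]
      simp
    | succ i ih =>
      intro hi
      obtain ⟨h₁, h₂⟩ := ih (by omega)
      have h₃ := hE (l - (i + 1)) (by omega)
      rw [show l - (i + 1) + 1 = l - i by omega] at h₃
      obtain ⟨h₄, h₅⟩ := hX (l - (i + 1)) (by omega)
      obtain ⟨h₆, h₇⟩ := hX (l - i) (by omega)
      have h₈ := hS.relax _ h₄ _ h₅ _ h₆ _ h₇ h₃ h₁ (by omega)
      exact ⟨h₈.1, by omega⟩
  have := key l le_rfl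
  rwa [Nat.sub_self] at this

end Stage

/-- The relation `R` as a relation on all natural numbers. -/
def OnNat {n : ℕ} (R : Fin n → Fin n → Prop) (i j : ℕ) : Prop :=
  ∃ (hi : i < n) (hj : j < n), R ⟨i, hi⟩ ⟨j, hj⟩

section OnNat

variable {n : ℕ} {R : Fin n → Fin n → Prop} {f : ℕ → ℕ → ℕ} {b l : ℕ} {u v : Fin n}

@[simp] theorem onNat_val (x y : Fin n) : OnNat R x y ↔ R x y :=
  ⟨fun ⟨_, _, h⟩ => h, fun h => ⟨x.2, y.2, h⟩⟩

/-- The digraph on pairs in which the first component moves along `R`. -/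
def Mono (R : Fin n → Fin n → Prop) (x y x' y' : ℕ) : Prop := OnNat R x x' ∧ y = y'

theorem exists_seq_of_nat {X : ℕ → ℕ} (hX : ∀ i ≤ l, X i < n) :
    ∃ p : ℕ → Fin n, ∀ i ≤ l, (p i : ℕ) = X i :=
  ⟨fun i => if h : X i < n then ⟨X i, h⟩ else ⟨X 0, hX 0 (Nat.zero_le l)⟩,
    fun i hi => by simp [hX i hi]⟩

/-- A path in a digraph with a constant second component. -/
theorem Mono.exists_seq {X Y : ℕ → ℕ} (hY0 : Y 0 = v)
    (hX : ∀ i ≤ l, X i < n ∧ Y i < n ∧ f (X i) (Y i) + i = l + 1)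
    (hE : ∀ i < l, Mono R (X i) (Y i) (X (i + 1)) (Y (i + 1))) :
    ∃ p : ℕ → Fin n, (∀ i ≤ l, (p i : ℕ) = X i) ∧ (∀ i ≤ l, f (p i) v + i = l + 1) ∧
      ∀ i < l, R (p i) (p (i + 1)) := by
  obtain ⟨p, hp⟩ := exists_seq_of_nat fun i hi => (hX i hi).1
  have hY : ∀ i ≤ l, Y i = v := by
    intro i
    induction i with
    | zero => exact fun _ => hY0
    | succ i ih => exact fun hi => by rw [← (hE i hi).2, ih (by omega)]
  refine ⟨p, hp, fun i hi => ?_, fun i hi => ?_⟩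
  · rw [hp i hi, ← hY i hi]
    exact (hX i hi).2.2
  · have := (hE i hi).1
    rwa [← hp i hi.le, ← hp (i + 1) hi, onNat_val] at this

theorem IsStage.exists_seq (hS : IsStage n v (Mono R) n b f) (hl : f u v = l + 1) :
    ∃ p : ℕ → Fin n, p 0 = u ∧ p l = v ∧ (∀ i ≤ l, f (p i) v + i = l + 1) ∧
      ∀ i < l, R (p i) (p (i + 1)) := by
  obtain ⟨X, Y, hX0, hY0, hXl, -, h₁, h₂⟩ := hS.exists_path u.2 v.2 hl
  obtain ⟨p, hp, h₃, h₄⟩ := Mono.exists_seq hY0 h₁ h₂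
  exact ⟨p, Fin.ext (by rw [hp 0 (Nat.zero_le l), hX0]), Fin.ext (by rw [hp l le_rfl, hXl]), h₃, h₄⟩

theorem IsStage.le_of_seq (hS : IsStage n v (Mono R) n b f) {p : ℕ → Fin n} (hln : l ≤ n)
    (hpl : p l = v) (hR : ∀ i < l, R (p i) (p (i + 1))) :
    f (p 0) v ≠ 0 ∧ f (p 0) v ≤ l + 1 :=
  hS.le_of_path (X := fun i => p i) (Y := fun _ => v) hln (fun i _ => ⟨(p i).2, v.2⟩) (by rw [hpl])
    rfl fun i hi => ⟨(onNat_val _ _).2 (hR i hi), rfl⟩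

variable {G : SimpleGraph (Fin n)}

theorem dist_lt_of_reachable (h : G.Reachable u v) : G.dist u v < n := by
  obtain ⟨w, hp, hw⟩ := h.exists_path_of_dist
  have := hp.length_lt
  rw [Fintype.card_fin] at this
  omega

theorem IsStage.eq_dist (hS : IsStage n v (Mono G.Adj) n b f) (h : G.Reachable u v) :
    f u v = G.dist u v + 1 := by
  obtain ⟨w, hw⟩ := h.exists_walk_length_eq_dist
  have h₁ := hS.le_of_seq (p := w.getVert) (dist_lt_of_reachable h).le
    (by rw [← hw, w.getVert_length]) fun i hi => w.adj_getVert_succ (by omega)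
  rw [w.getVert_zero] at h₁
  obtain ⟨l, hl⟩ : ∃ l, f u v = l + 1 := ⟨f u v - 1, by omega⟩
  obtain ⟨p, rfl, rfl, -, hR⟩ := hS.exists_seq hl
  obtain ⟨w', hw', -⟩ := exists_walk_of_seq p l hR
  have := SimpleGraph.dist_le w'
  omega

/-- The labels of a search in an induced subgraph lead to an induced path. -/
theorem IsStage.exists_isPath {X : Set (Fin n)}
    (hS : IsStage n v (Mono fun x y => G.Adj x y ∧ x ∈ X ∧ y ∈ X) n b f) (hln : l ≤ n)
    {p : ℕ → Fin n} (hp0 : p 0 = u) (hpl : p l = v) (hf : ∀ i ≤ l, f (p i) v + i = l + 1)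
    (hR : ∀ i < l, G.Adj (p i) (p (i + 1)) ∧ p i ∈ X ∧ p (i + 1) ∈ X) :
    ∃ w : G.Walk u v, w.IsPath ∧ w.IsChordless ∧ w.length = l ∧ ∀ i ≤ l, w.getVert i = p i := by
  subst hp0 hpl
  obtain ⟨w, hw, hg⟩ := exists_walk_of_seq p l fun i hi => (hR i hi).1
  obtain ⟨h₁, h₂⟩ := isPath_of_induced (w := w) fun i j hij hj ht => by
    rw [hw] at hj
    rw [hg i (by omega), hg j hj] at ht
    have h₁ := hf i (by omega)
    have h₂ := hf j hj
    rcases ht with ht | ht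
    · rw [ht] at h₁
      omega
    · have h₃ : p j ∈ X := by
        have := (hR (j - 1) (by omega)).2.2
        rwa [show j - 1 + 1 = j by omega] at this
      -- A chord between `p i` and `p j` with `i + 1 < j` is an edge inside `X`, and it would force
      -- the label of `p i` below `l + 1 - i`.
      have := hS.relax (p i) (p i).2 (p l) (p l).2 (p j) (p j).2 (p l) (p l).2
        ⟨(onNat_val _ _).2 ⟨ht, (hR i (by omega)).2.1, h₃⟩, rfl⟩ (by omega) (by omega)
      omega
  exact ⟨w, h₁, h₂, hw, hg⟩

end OnNat

/-! ### The algorithm -/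

/-- The label of a vertex in a search for the distances to the vertex in `x₂`. -/
def labelOf (x : Expr) : Expr := .read 2 x (.var 2)

/-- The two vertices are equal or adjacent. -/
def touch (x y : Expr) : Expr := (Expr.eq x y).or (.read 0 x y)

/-- The expression for the relation `Node`, with the guesses in the variables `x₃, …, x₇`. -/
def nodeExpr (x y : Expr) : Expr :=
  ((Expr.eq (labelOf x) (labelOf (.var 3))).imp (.eq x (.var 3))).and
    (((Expr.lt (labelOf (.var 3)) (labelOf x)).imp (touch x (.var 4)).not).and
      (((Expr.eq (labelOf y) (labelOf (.var 5))).imp (.eq y (.var 5))).and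
        (((Expr.eq (labelOf y) (labelOf (.var 6))).imp (.eq y (.var 6))).and
          ((Expr.eq (labelOf y) (labelOf (.var 7))).imp (.eq y (.var 7))))))

/-- The expression for the relation `Apart`. -/
def apartExpr (x y : Expr) : Expr :=
  (Expr.lt (labelOf x) (labelOf (.var 3))).not.imp
    ((Expr.lt (labelOf (.var 5)) (labelOf y)).not.imp (touch x y).not)

/-- The expression for an edge from `x` up to `x'`. -/
def upExpr (x x' : Expr) : Expr :=
  (Expr.read 0 x x').and (.eq (.succ (labelOf x')) (labelOf x))

/-- The expression for the relation `Step` from the pair in `x₂₁, x₂₂` to the pair in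
`x₂₃, x₂₄`. -/
def stepExpr : Expr :=
  (upExpr (.var 21) (.var 23)).and ((upExpr (.var 22) (.var 24)).and
    ((nodeExpr (.var 21) (.var 22)).and ((nodeExpr (.var 23) (.var 24)).and
      ((apartExpr (.var 21) (.var 22)).and ((apartExpr (.var 21) (.var 24)).and
        (apartExpr (.var 23) (.var 22)))))))

/-- The vertex `x₂₁` is not allowed because of the pair with index `x₂₀` on the rails. -/
def badExpr : Expr :=
  ((Expr.lt (labelOf (.var 3)) (labelOf (.read 4 (.var 20) (.const 0)))).and
      (touch (.read 4 (.var 20) (.const 0)) (.var 21))).or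
    (((Expr.lt (labelOf (.read 5 (.var 20) (.const 0))) (labelOf (.var 5))).and
      (touch (.read 5 (.var 20) (.const 0)) (.var 21))).or
    ((Expr.read 0 (.var 3) (.var 21)).and (.lt (labelOf (.var 21)) (labelOf (.var 3)))))

/-- The vertex `x₂₁` is in the pair with index `x₂₀` on the rails. -/
def goodExpr : Expr :=
  ((Expr.lt (labelOf (.read 4 (.var 20) (.const 0))) (labelOf (.var 3))).not.and
      (.eq (.read 4 (.var 20) (.const 0)) (.var 21))).or
    ((Expr.lt (labelOf (.var 5)) (labelOf (.read 5 (.var 20) (.const 0)))).not.and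
      (.eq (.read 5 (.var 20) (.const 0)) (.var 21)))

/-- The vertex is allowed according to the marks in the arrays `A₆` and `A₇`. -/
def allowed (x : Expr) : Expr := (Expr.read 7 x (.const 0)).or (Expr.read 6 x (.const 0)).not

/-- Edges of the graph, with a constant second component. -/
def adjExpr : Expr := (Expr.read 0 (.var 21) (.var 23)).and (.eq (.var 22) (.var 24))

/-- Edges of the subgraph of all allowed vertices, with a constant second component. -/
def corridorExpr : Expr :=
  ((Expr.read 0 (.var 21) (.var 23)).and ((allowed (.var 21)).and (allowed (.var 23)))).and
    (.eq (.var 22) (.var 24))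

namespace Cmd

/-- Find the rails and mark the allowed vertices. -/
def rails : Cmd :=
  seq (seq (assign 21 (.var 1)) (assign 22 (.var 1)))
    (seq (trace 3 stepExpr 4 5) (seq (mark 6 badExpr) (mark 7 goodExpr)))

/-- Write the path that was found into the output. -/
def output : Cmd :=
  seq (seq (assign 21 (.var 1)) (assign 22 (.var 2)))
    (seq (trace 8 corridorExpr 1 9)
      (seq (assign 8 (.const 1)) (assign 9 (.pred (.read 8 (.var 1) (.var 2))))))

/-- Look for a non-shortest path in the corridor between the rails. -/
def probe : Cmd :=
  seq (search 8 corridorExpr)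
    (branch (.lt (.read 2 (.var 1) (.var 2)) (.read 8 (.var 1) (.var 2))) output skip)

/-- Look for a non-shortest path with the guesses in the variables `x₃, …, x₇`. -/
def attempt : Cmd :=
  seq (search 3 stepExpr) (branch (.read 3 (.var 1) (.var 1)) (seq rails probe) skip)

/-- Try a guess if no path has been found yet. -/
def test : Cmd := branch (.var 8) skip attempt

/-- Search for a non-shortest path. -/
def full : Cmd :=
  seq (search 2 adjExpr) (rep 3 (rep 4 (rep 5 (rep 6 (rep 7 test)))))

theorem rails_vars (z : ℕ) (h : z < 20) : z ∉ rails.vars := by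
  simp [rails, vars, trace_vars z _ _ _ _ h, mark_vars z _ _ h]; omega

theorem rails_arrs (b : ℕ) (h : b < 4) : b ∉ rails.arrs := by
  simp only [rails, arrs, List.mem_append, not_or, List.not_mem_nil, not_false_eq_true, true_and]
  exact ⟨trace_arrs _ _ _ _ _ (by omega) (by omega), mark_arrs _ _ _ (by omega),
    mark_arrs _ _ _ (by omega)⟩

theorem output_vars (z : ℕ) (h : z < 8) : z ∉ output.vars := by
  simp [output, vars, trace_vars z _ _ _ _ (show z < 20 by omega)]; omega

theorem output_arrs (b : ℕ) (h : b ≠ 1) (h' : b ≠ 9) : b ∉ output.arrs := by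
  simp [output, arrs, trace_arrs b _ _ _ _ h h']

theorem probe_vars (z : ℕ) (h : z < 8) : z ∉ probe.vars := by
  simp [probe, vars, search_vars z _ _ (show z < 20 by omega), output_vars z h]

theorem probe_arrs (b : ℕ) (h : b ≠ 1) (h' : b < 8) : b ∉ probe.arrs := by
  simp [probe, arrs, search_arrs _ b _ (show b ≠ 8 by omega), output_arrs b h (by omega)]

theorem attempt_vars (z : ℕ) (h : z < 8) : z ∉ attempt.vars := by
  simp [attempt, vars, search_vars z _ _ (show z < 20 by omega),
    rails_vars z (show z < 20 by omega), probe_vars z h]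

theorem test_vars (z : ℕ) (h : z < 8) : z ∉ test.vars := by
  simp [test, vars, attempt_vars z h]

theorem full_isWF : full.IsWF := by
  simp [full, test, attempt, probe, output, rails, IsWF, search_isWF, trace_isWF, mark_isWF,
    vars, search_vars, trace_vars, mark_vars]

/-- The depth is in fact ten: five loops over the guesses and, inside them, a search with one loop
over the rounds and four over the two pairs. -/
theorem full_depth : full.depth ≤ 16 := by decide

end Cmd
end RAM

/-! ### Invariants of the memory, and soundness for every guess. -/

namespace RAM

variable {n : ℕ} {G : SimpleGraph (Fin n)} {u v : Fin n} {σ τ ρ : State}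

/-- The memory holds the graph and the labels of the search for the distances to `v`. -/
structure Ready (G : SimpleGraph (Fin n)) (u v : Fin n) (σ : State) : Prop where
  size : σ.var 0 = n
  source : σ.var 1 = u
  target : σ.var 2 = v
  adj : ∀ i j, σ.arr 0 i j ≠ 0 ↔ OnNat G.Adj i j
  label : ∀ x : Fin n, G.Reachable x v → σ.arr 2 x v = G.dist x v + 1

theorem Ready.congr (h : Ready G u v σ) (hv : ∀ z < 3, τ.var z = σ.var z)
    (h₀ : τ.arr 0 = σ.arr 0) (h₂ : τ.arr 2 = σ.arr 2) : Ready G u v τ :=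
  ⟨by rw [hv 0 (by omega), h.size], by rw [hv 1 (by omega), h.source],
    by rw [hv 2 (by omega), h.target], by rw [h₀]; exact h.adj, by rw [h₂]; exact h.label⟩

/-- The vertices that are allowed according to the marks in the arrays `A₆` and `A₇`. -/
def Allowed (n : ℕ) (σ : State) : Set (Fin n) := {z | σ.arr 7 z 0 ≠ 0 ∨ σ.arr 6 z 0 = 0}

theorem tests_corridorExpr (hσ : Ready G u v σ) :
    Tests [0, 6, 7] σ corridorExpr
      (Mono fun x y => G.Adj x y ∧ x ∈ Allowed n σ ∧ y ∈ Allowed n σ) := by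
  intro ρ hA _
  have h₀ := hA 0 (by simp)
  have h₆ := hA 6 (by simp)
  have h₇ := hA 7 (by simp)
  simp only [corridorExpr, allowed, Expr.holds_and, Expr.holds_or, Expr.holds_not,
    Expr.holds_read, Expr.holds_eq, Expr.eval, h₀, h₆, h₇, hσ.adj, Mono, OnNat, Allowed,
    Set.mem_ofPred_eq, not_not]
  constructor
  · rintro ⟨⟨⟨h₁, h₂, h₃⟩, h₄⟩, h₅⟩
    exact ⟨⟨h₁, h₂, h₃, h₄⟩, h₅⟩
  · rintro ⟨⟨h₁, h₂, h₃, h₄⟩, h₅⟩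
    exact ⟨⟨⟨h₁, h₂, h₃⟩, h₄⟩, h₅⟩

/-- The memory holds a non-shortest path. -/
def Found (G : SimpleGraph (Fin n)) (u v : Fin n) (σ : State) : Prop :=
  σ.var 8 = 1 ∧ ∃ w : G.Walk u v, IsNSP G w ∧ σ.var 9 = w.length ∧
    ∀ i ≤ w.length, σ.arr 1 i 0 = (w.getVert i : ℕ)

/-- The property of the memory that is kept throughout the algorithm. -/
def Sound (G : SimpleGraph (Fin n)) (u v : Fin n) (σ : State) : Prop :=
  Ready G u v σ ∧ (σ.var 8 = 0 ∨ Found G u v σ)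

namespace Cmd

theorem ready_input :
    Ready G u v ((search 2 adjExpr).run (input G u v)) := by
  have hadj : ∀ i j, (input G u v).arr 0 i j ≠ 0 ↔ OnNat G.Adj i j := by
    intro i j
    simp [input, OnNat]
  have hS : IsStage n v (Mono G.Adj) n (n + 1) (((search 2 adjExpr).run (input G u v)).arr 2) := by
    refine search_spec (A := [0]) (by simp) (fun ρ hA _ => ?_) (by simp [input]) (by simp [input])
      v.2
    simp [adjExpr, hA 0 (by simp), hadj, Mono]
  have hv : ∀ z < 3, ((search 2 adjExpr).run (input G u v)).var z = (input G u v).var z :=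
    fun z hz => run_var (search_vars z _ _ (by omega)) _
  have h₀ : ((search 2 adjExpr).run (input G u v)).arr 0 = (input G u v).arr 0 :=
    run_arr (search_arrs _ _ _ (by simp)) _
  exact ⟨by rw [hv 0 (by omega)]; simp [input], by rw [hv 1 (by omega)]; simp [input],
    by rw [hv 2 (by omega)]; simp [input], by rw [h₀]; exact hadj, fun x hx => hS.eq_dist hx⟩

theorem isStage_corridor (hσ : Ready G u v σ) :
    IsStage n v (Mono fun x y => G.Adj x y ∧ x ∈ Allowed n σ ∧ y ∈ Allowed n σ) n (n + 1)
      (((search 8 corridorExpr).run σ).arr 8) :=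
  search_spec (by simp) (tests_corridorExpr hσ) hσ.size hσ.target v.2

/-- A path along decreasing labels is induced in the graph, and a label above that in `A₂` says that
it is longer than the distance. The marks may be arbitrary, so soundness depends neither on the
guess nor on straightness. -/
theorem output_found (hσ : Ready G u v σ)
    (hS : IsStage n v (Mono fun x y => G.Adj x y ∧ x ∈ Allowed n σ ∧ y ∈ Allowed n σ) n (n + 1)
      (σ.arr 8)) (hlt : σ.arr 2 u v < σ.arr 8 u v) : Found G u v (output.run σ) := by
  obtain ⟨l, hl⟩ : ∃ l, σ.arr 8 u v = l + 1 := ⟨σ.arr 8 u v - 1, by omega⟩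
  have hln : l ≤ n := by
    have := hS.le u u.2 v v.2
    omega
  -- The labels give only `l ≤ n`. The strict inequality, which `trace_spec` needs, holds because
  -- the labelled path has distinct vertices.
  have hlt' : l < n := by
    obtain ⟨p, hp0, hpl, hf, hR⟩ := hS.exists_seq hl
    obtain ⟨w, hw, -, rfl, -⟩ := hS.exists_isPath hln hp0 hpl hf hR
    simpa using hw.length_lt
  set σ₁ := (seq (assign 21 (.var 1)) (assign 22 (.var 2))).run σ with hσ₁
  have hv₁ : ∀ z < 20, σ₁.var z = σ.var z := fun z hz => run_var (by simp [vars]; omega) σ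
  have hR₁ : Ready G u v σ₁ := hσ.congr (fun z hz => hv₁ z (by omega)) rfl rfl
  obtain ⟨X, Y, hX0, hY0, hX, hE, hlast, hst⟩ := trace_spec (σ := σ₁) (a := 8) (w := 1) (w' := 9)
    (tests_corridorExpr hR₁) hR₁.size (by simp) (by simp) (by simp) (by simp) (by simp)
    (x₀ := u) (y₀ := v) (by simp [hσ₁, run, hσ.source]) (by simp [hσ₁, run, hσ.target]) u.2 v.2
    hS hl hlt'
  obtain ⟨p, hp, hf, hR⟩ := Mono.exists_seq hY0 hX hE
  obtain ⟨w, hw₁, hw₂, hw₃, hw₄⟩ := hS.exists_isPath (u := u) hln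
    (Fin.ext (by rw [hp 0 (Nat.zero_le l), hX0]))
    (Fin.ext (by rw [hp l le_rfl, (hlast l hlt' le_rfl).1])) hf hR
  have hτ : output.run σ = (seq (assign 8 (.const 1))
    (assign 9 (.pred (.read 8 (.var 1) (.var 2))))).run ((trace 8 corridorExpr 1 9).run σ₁) := rfl
  have hv₂ : ∀ z < 20, ((trace 8 corridorExpr 1 9).run σ₁).var z = σ.var z := fun z hz => by
    rw [run_var (trace_vars z _ _ _ _ hz), hv₁ z hz]
  have ha₂ : ((trace 8 corridorExpr 1 9).run σ₁).arr 8 = σ.arr 8 :=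
    run_arr (trace_arrs _ _ _ _ _ (by simp) (by simp)) σ₁
  rw [hτ]
  generalize (trace 8 corridorExpr 1 9).run σ₁ = σ₂ at hst hv₂ ha₂
  refine ⟨by simp [run], w, ⟨hw₁, hw₂, ?_⟩, ?_, fun i hi => ?_⟩
  · have hr : G.Reachable u v := ⟨w⟩
    rw [← hr.coe_dist_eq_edist]
    have := hσ.label u hr
    exact_mod_cast (by omega : G.dist u v < w.length)
  · simp [run, ha₂, hv₂, hσ.source, hσ.target, hl, hw₃]
  · rw [hw₄ i (by omega), hp i (by omega)]
    exact (hst i (by omega)).1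

theorem probe_sound (hσ : Ready G u v σ) (h₈ : σ.var 8 = 0) : Sound G u v (probe.run σ) := by
  refine ⟨hσ.congr (fun z hz => run_var (probe_vars z (by omega)) σ)
    (run_arr (probe_arrs 0 (by simp) (by simp)) σ)
    (run_arr (probe_arrs 2 (by simp) (by simp)) σ), ?_⟩
  have hS := isStage_corridor hσ
  have hv : ∀ z < 20, ((search 8 corridorExpr).run σ).var z = σ.var z :=
    fun z hz => run_var (search_vars z _ _ hz) σ
  have ha : ∀ b, b ≠ 8 → ((search 8 corridorExpr).run σ).arr b = σ.arr b :=
    fun b hb => run_arr (search_arrs _ _ _ hb) σ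
  rw [probe, run]
  generalize (search 8 corridorExpr).run σ = ρ at hS hv ha
  rw [run]
  have hρ : Ready G u v ρ :=
    hσ.congr (fun z hz => hv z (by omega)) (ha 0 (by simp)) (ha 2 (by simp))
  split_ifs with h
  · rw [Expr.holds_lt] at h
    simp only [Expr.eval, hρ.source, hρ.target] at h
    have : Allowed n ρ = Allowed n σ := by
      rw [Allowed, Allowed, ha 6 (by simp), ha 7 (by simp)]
    rw [← this] at hS
    exact Or.inr (output_found hρ hS h)
  · exact Or.inl (by rw [run, hv 8 (by omega), h₈])

theorem probe_finds (hσ : Ready G u v σ)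
    (h : σ.arr 2 u v < ((search 8 corridorExpr).run σ).arr 8 u v) : (probe.run σ).var 8 ≠ 0 := by
  have hv : ∀ z < 20, ((search 8 corridorExpr).run σ).var z = σ.var z :=
    fun z hz => run_var (search_vars z _ _ hz) σ
  have ha : ∀ b, b ≠ 8 → ((search 8 corridorExpr).run σ).arr b = σ.arr b :=
    fun b hb => run_arr (search_arrs _ _ _ hb) σ
  rw [probe, run, run, if_pos]
  · rw [output, run, run, run]
    generalize (trace 8 corridorExpr 1 9).run _ = ρ
    simp [run]
  · rw [Expr.holds_lt]
    simpa [hv, ha, hσ.source, hσ.target] using h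

theorem test_sound (hσ : Sound G u v σ) : Sound G u v (test.run σ) := by
  obtain ⟨h₁, h₂⟩ := hσ
  rw [test, run]
  split_ifs with h
  · exact ⟨h₁, h₂⟩
  have h₈ : σ.var 8 = 0 := by simpa using h
  have hv : ∀ z < 20, ((search 3 stepExpr).run σ).var z = σ.var z :=
    fun z hz => run_var (search_vars z _ _ hz) σ
  have ha : ∀ b, b ≠ 3 → ((search 3 stepExpr).run σ).arr b = σ.arr b :=
    fun b hb => run_arr (search_arrs _ _ _ hb) σ
  rw [attempt, run]
  generalize (search 3 stepExpr).run σ = ρ at hv ha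
  have hρ : Ready G u v ρ :=
    h₁.congr (fun z hz => hv z (by omega)) (ha 0 (by simp)) (ha 2 (by simp))
  rw [run]
  split_ifs
  · rw [run]
    exact probe_sound (hρ.congr (fun z hz => run_var (rails_vars z (by omega)) ρ)
      (run_arr (rails_arrs 0 (by simp)) ρ) (run_arr (rails_arrs 2 (by simp)) ρ))
      (by rw [run_var (rails_vars 8 (by simp)), hv 8 (by simp), h₈])
  · exact ⟨hρ, Or.inl (by rw [run, hv 8 (by simp), h₈])⟩

end Cmd

/-- The memory holds a guess for the vertices `s`, `t₀`, `t`, `f₁`, `f₂` of a detour. -/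
structure Guessed (G : SimpleGraph (Fin n)) (u v : Fin n) (h : Fin n → ℕ) (k : ℕ)
    (s t₀ t f₁ f₂ : Fin n) (σ : State) : Prop extends Ready G u v σ where
  level : ∀ x : Fin n, σ.arr 2 x v + h x = k + 1
  var₃ : σ.var 3 = s
  var₄ : σ.var 4 = t₀
  var₅ : σ.var 5 = t
  var₆ : σ.var 6 = f₁
  var₇ : σ.var 7 = f₂

section Guessed

variable {h : Fin n → ℕ} {k : ℕ} {s t₀ t f₁ f₂ a b a' b' : Fin n} {x y x' y' : Expr}

theorem Guessed.congr (hσ : Guessed G u v h k s t₀ t f₁ f₂ σ)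
    (hv : ∀ z < 20, τ.var z = σ.var z) (h₀ : τ.arr 0 = σ.arr 0) (h₂ : τ.arr 2 = σ.arr 2) :
    Guessed G u v h k s t₀ t f₁ f₂ τ :=
  ⟨hσ.toReady.congr (fun z hz => hv z (by omega)) h₀ h₂, by rw [h₂]; exact hσ.level,
    by rw [hv 3 (by omega), hσ.var₃], by rw [hv 4 (by omega), hσ.var₄],
    by rw [hv 5 (by omega), hσ.var₅], by rw [hv 6 (by omega), hσ.var₆],
    by rw [hv 7 (by omega), hσ.var₇]⟩

theorem Ready.holds_touch (hσ : Ready G u v σ) (hx : x.eval σ = a) (hy : y.eval σ = b) :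
    (touch x y).Holds σ ↔ Touch G a b := by
  simp [touch, hx, hy, hσ.adj, Touch, Fin.ext_iff]

namespace Guessed

/-- Labels measure the distance to `v` and levels the distance from `u`, so the order is reversed: a
smaller label means a higher level. This is why the expressions compare labels with the arguments
exchanged. -/
theorem eval_labelOf (hσ : Guessed G u v h k s t₀ t f₁ f₂ σ)
    (hx : x.eval σ = a) : (labelOf x).eval σ + h a = k + 1 := by
  simp [labelOf, hx, hσ.target, hσ.level]

theorem holds_eq (hσ : Guessed G u v h k s t₀ t f₁ f₂ σ)
    (hx : x.eval σ = a) (hy : y.eval σ = b) :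
    (Expr.eq (labelOf x) (labelOf y)).Holds σ ↔ h a = h b := by
  have h₁ := hσ.eval_labelOf hx
  have h₂ := hσ.eval_labelOf hy
  rw [Expr.holds_eq]
  omega

theorem holds_lt (hσ : Guessed G u v h k s t₀ t f₁ f₂ σ)
    (hx : x.eval σ = a) (hy : y.eval σ = b) :
    (Expr.lt (labelOf x) (labelOf y)).Holds σ ↔ h b < h a := by
  have h₁ := hσ.eval_labelOf hx
  have h₂ := hσ.eval_labelOf hy
  rw [Expr.holds_lt]
  omega

theorem holds_upExpr (hσ : Guessed G u v h k s t₀ t f₁ f₂ σ)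
    (hx : x.eval σ = a) (hx' : x'.eval σ = a') :
    (upExpr x x').Holds σ ↔ G.Adj a a' ∧ h a' = h a + 1 := by
  have h₁ := hσ.eval_labelOf hx
  have h₂ := hσ.eval_labelOf hx'
  rw [upExpr, Expr.holds_and, Expr.holds_read, Expr.holds_eq, hx, hx', hσ.adj, onNat_val,
    Expr.eval]
  exact and_congr_right fun _ => by omega

theorem holds_nodeExpr (hσ : Guessed G u v h k s t₀ t f₁ f₂ σ)
    (hx : x.eval σ = a) (hy : y.eval σ = b) :
    (nodeExpr x y).Holds σ ↔ Node G h s t₀ t f₁ f₂ a b := by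
  simp only [nodeExpr, Expr.holds_and, Expr.holds_imp, Expr.holds_not,
    hσ.holds_eq hx (y := .var 3) hσ.var₃, hσ.holds_lt (x := .var 3) hσ.var₃ hx,
    hσ.holds_touch hx (y := .var 4) hσ.var₄, hσ.holds_eq hy (y := .var 5) hσ.var₅,
    hσ.holds_eq hy (y := .var 6) hσ.var₆, hσ.holds_eq hy (y := .var 7) hσ.var₇]
  simp [hx, hy, hσ.var₃, hσ.var₅, hσ.var₆, hσ.var₇, Node, Fin.ext_iff]

theorem holds_apartExpr (hσ : Guessed G u v h k s t₀ t f₁ f₂ σ)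
    (hx : x.eval σ = a) (hy : y.eval σ = b) :
    (apartExpr x y).Holds σ ↔ Apart G h s t a b := by
  simp only [apartExpr, Expr.holds_imp, Expr.holds_not, hσ.holds_lt hx (y := .var 3) hσ.var₃,
    hσ.holds_lt (x := .var 5) hσ.var₅ hy, hσ.holds_touch hx hy, not_lt, Apart]

theorem holds_stepExpr (hσ : Guessed G u v h k s t₀ t f₁ f₂ σ)
    (h₁ : σ.var 21 = a) (h₂ : σ.var 22 = b) (h₃ : σ.var 23 = a')
    (h₄ : σ.var 24 = b') : stepExpr.Holds σ ↔ Step G h s t₀ t f₁ f₂ a b a' b' := by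
  have h₁' : (Expr.var 21).eval σ = a := h₁
  have h₂' : (Expr.var 22).eval σ = b := h₂
  have h₃' : (Expr.var 23).eval σ = a' := h₃
  have h₄' : (Expr.var 24).eval σ = b' := h₄
  simp only [stepExpr, Expr.holds_and, hσ.holds_upExpr h₁' h₃', hσ.holds_upExpr h₂' h₄',
    hσ.holds_nodeExpr h₁' h₂', hσ.holds_nodeExpr h₃' h₄', hσ.holds_apartExpr h₁' h₂',
    hσ.holds_apartExpr h₁' h₄', hσ.holds_apartExpr h₃' h₂', Step]

end Guessed

/-- The relation `Step` on natural numbers. -/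
def StepOnNat (G : SimpleGraph (Fin n)) (h : Fin n → ℕ) (s t₀ t f₁ f₂ : Fin n)
    (x y x' y' : ℕ) : Prop :=
  ∃ a b a' b' : Fin n, x = a ∧ y = b ∧ x' = a' ∧ y' = b' ∧ Step G h s t₀ t f₁ f₂ a b a' b'

theorem Guessed.tests_stepExpr (hσ : Guessed G u v h k s t₀ t f₁ f₂ σ) :
    Tests [0, 2] σ stepExpr (StepOnNat G h s t₀ t f₁ f₂) := by
  intro ρ hA hz
  have hρ := hσ.congr hz (hA 0 (by simp)) (hA 2 (by simp))
  constructor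
  · intro hH
    -- The four variables need not hold vertices in an arbitrary memory. That they do follows from
    -- the reads of the adjacency matrix, which is zero outside its range.
    have h₁ : OnNat G.Adj (ρ.var 21) (ρ.var 23) ∧ OnNat G.Adj (ρ.var 22) (ρ.var 24) := by
      simp only [stepExpr, upExpr, Expr.holds_and, Expr.holds_read, hρ.adj] at hH
      exact ⟨hH.1.1, hH.2.1.1⟩
    obtain ⟨⟨h₂, h₃, -⟩, h₄, h₅, -⟩ := h₁
    exact ⟨⟨_, h₂⟩, ⟨_, h₄⟩, ⟨_, h₃⟩, ⟨_, h₅⟩, rfl, rfl, rfl, rfl,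
      (hρ.holds_stepExpr rfl rfl rfl rfl).1 hH⟩
  · rintro ⟨a, b, a', b', h₁, h₂, h₃, h₄, h₅⟩
    exact (hρ.holds_stepExpr h₁ h₂ h₃ h₄).2 h₅

end Guessed
end RAM

/-! ### A right guess leads to a path. -/

namespace RAM

variable {n : ℕ} {G : SimpleGraph (Fin n)} {u v : Fin n} {σ τ ρ : State} {h : Fin n → ℕ} {k : ℕ}
  {s t₀ t f₁ f₂ : Fin n}

theorem Guessed.holds_badExpr (hσ : Guessed G u v h k s t₀ t f₁ f₂ σ) {a b z : Fin n}
    (ha : σ.arr 4 (σ.var 20) 0 = a) (hb : σ.arr 5 (σ.var 20) 0 = b) (hz : σ.var 21 = z) :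
    badExpr.Holds σ ↔ (h a < h s ∧ Touch G a z) ∨ (h t < h b ∧ Touch G b z) ∨
      (G.Adj s z ∧ h s < h z) := by
  have ha' : (Expr.read 4 (.var 20) (.const 0)).eval σ = a := ha
  have hb' : (Expr.read 5 (.var 20) (.const 0)).eval σ = b := hb
  have hz' : (Expr.var 21).eval σ = z := hz
  simp only [badExpr, Expr.holds_and, Expr.holds_or, hσ.holds_lt (x := .var 3) hσ.var₃ ha',
    hσ.holds_lt hb' (y := .var 5) hσ.var₅, hσ.holds_lt hz' (y := .var 3) hσ.var₃,
    hσ.holds_touch ha' hz', hσ.holds_touch hb' hz', Expr.holds_read, Expr.eval, hz, hσ.var₃,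
    hσ.adj, onNat_val]

theorem Guessed.holds_goodExpr (hσ : Guessed G u v h k s t₀ t f₁ f₂ σ) {a b z : Fin n}
    (ha : σ.arr 4 (σ.var 20) 0 = a) (hb : σ.arr 5 (σ.var 20) 0 = b) (hz : σ.var 21 = z) :
    goodExpr.Holds σ ↔ (h a ≤ h s ∧ a = z) ∨ (h t ≤ h b ∧ b = z) := by
  have ha' : (Expr.read 4 (.var 20) (.const 0)).eval σ = a := ha
  have hb' : (Expr.read 5 (.var 20) (.const 0)).eval σ = b := hb
  simp only [goodExpr, Expr.holds_and, Expr.holds_or, Expr.holds_not,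
    hσ.holds_lt ha' (y := .var 3) hσ.var₃, hσ.holds_lt (x := .var 5) hσ.var₅ hb',
    Expr.holds_eq, Expr.eval, ha, hb, hz, not_lt, Fin.ext_iff]

/-- The vertices that survive the marking form the corridor between the rails. -/
theorem mem_corridor_iff {x y : ℕ → Fin n} (hkn : k < n) (hs : h s < k) (hxs : x (h s) = s)
    (hx : ∀ i ≤ k, h (x i) = i) (hy : ∀ i ≤ k, h (y i) = i)
    (hxk : ∀ i < n, k ≤ i → x i = x k) (hyk : ∀ i < n, k ≤ i → y i = y k) (z : Fin n) :
    ((∃ i < n, (h (x i) ≤ h s ∧ x i = z) ∨ (h t ≤ h (y i) ∧ y i = z)) ∨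
      ¬ ∃ i < n, (h (x i) < h s ∧ Touch G (x i) z) ∨ (h t < h (y i) ∧ Touch G (y i) z) ∨
        (G.Adj s z ∧ h s < h z)) ↔ z ∈ Corridor G h k (h s) (h t) x y := by
  -- The traces repeat their last vertex from index `k` on. The copies on `x` lie above `h s`, by `h
  -- s < k`, and those on `y` add nothing to `y k`.
  have hxi : ∀ i < n, h (x i) ≤ h s → i ≤ h s := by
    intro i hi h₁
    rcases Nat.lt_or_ge i k with h₂ | h₂
    · rwa [hx i h₂.le] at h₁
    · rw [hxk i hi h₂, hx k le_rfl] at h₁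
      omega
  have hyi : ∀ i < n, ∃ l ≤ k, y i = y l ∧ h (y i) = l := by
    intro i hi
    rcases Nat.lt_or_ge i k with h₂ | h₂
    · exact ⟨i, h₂.le, rfl, hy i h₂.le⟩
    · exact ⟨k, le_rfl, hyk i hi h₂, by rw [hyk i hi h₂, hy k le_rfl]⟩
  unfold Corridor
  rw [Set.mem_ofPred_eq, hxs]
  constructor
  · rintro (⟨i, hi, ⟨h₁, h₂⟩ | ⟨h₁, h₂⟩⟩ | h₁)
    · exact Or.inl ⟨i, hxi i hi h₁, h₂⟩
    · obtain ⟨l, hl, h₃, h₄⟩ := hyi i hi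
      exact Or.inr (Or.inl ⟨l, by omega, hl, h₃ ▸ h₂⟩)
    · refine Or.inr (Or.inr ⟨fun i hi ht => h₁ ⟨i, by omega, Or.inl ⟨?_, ht⟩⟩,
        fun l hl hlk ht => h₁ ⟨l, by omega, Or.inr (Or.inl ⟨?_, ht⟩)⟩,
        fun ht => h₁ ⟨0, by omega, Or.inr (Or.inr ht)⟩⟩)
      · rwa [hx i (by omega)]
      · rwa [hy l hlk]
  · rintro (⟨i, hi, h₁⟩ | ⟨l, hl, hlk, h₁⟩ | ⟨h₁, h₂, h₃⟩)
    · exact Or.inl ⟨i, by omega, Or.inl ⟨by rwa [hx i (by omega)], h₁⟩⟩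
    · exact Or.inl ⟨l, by omega, Or.inr ⟨by rwa [hy l hlk], h₁⟩⟩
    · refine Or.inr ?_
      rintro ⟨i, hi, ⟨h₄, h₅⟩ | ⟨h₄, h₅⟩ | h₄⟩
      · have h₆ := hxi i hi h₄.le
        rw [hx i (by omega)] at h₄
        exact h₁ i h₄ h₅
      · obtain ⟨l, hl, h₆, h₇⟩ := hyi i hi
        rw [h₆] at h₅
        exact h₂ l (by omega) hl h₅
      · exact h₃ h₄

theorem stepOnNat_val {a b a' b' : Fin n} (hE : StepOnNat G h s t₀ t f₁ f₂ a b a' b') :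
    Step G h s t₀ t f₁ f₂ a b a' b' := by
  obtain ⟨c, d, c', d', h₁, h₂, h₃, h₄, h₅⟩ := hE
  rwa [Fin.ext h₁, Fin.ext h₂, Fin.ext h₃, Fin.ext h₄]

namespace Cmd

theorem rails_spec (hσ : Guessed G u v h k s t₀ t f₁ f₂ σ) (hu : h u = 0) (hk : k < n)
    (hs : h s < k)
    (hS : IsStage n v (StepOnNat G h s t₀ t f₁ f₂) n (n + 1) (σ.arr 3))
    (hl : σ.arr 3 u u = k + 1) :
    ∃ x y : ℕ → Fin n, x 0 = u ∧ y 0 = u ∧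
      (∀ i < k, Step G h s t₀ t f₁ f₂ (x i) (y i) (x (i + 1)) (y (i + 1))) ∧
      Allowed n (rails.run σ) = Corridor G h k (h s) (h t) x y := by
  set σ₁ := (seq (assign 21 (.var 1)) (assign 22 (.var 1))).run σ with hσ₁
  have hG₁ : Guessed G u v h k s t₀ t f₁ f₂ σ₁ :=
    hσ.congr (fun z hz => run_var (by simp [vars]; omega) σ) rfl rfl
  obtain ⟨X, Y, hX0, hY0, hX, hE, hlast, hst⟩ := trace_spec (σ := σ₁) (a := 3) (w := 4) (w' := 5)
    hG₁.tests_stepExpr hG₁.size (by simp) (by simp) (by simp) (by simp) (by simp)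
    (x₀ := u) (y₀ := u) (by simp [hσ₁, run, hσ.source]) (by simp [hσ₁, run, hσ.source]) u.2 u.2
    hS hl hk
  have hX' : ∀ i ≤ n - 1, X i < n ∧ Y i < n := by
    intro i hi
    rcases Nat.lt_or_ge i k with h₁ | h₁
    · exact ⟨(hX i h₁.le).1, (hX i h₁.le).2.1⟩
    · rw [(hlast i (by omega) h₁).1, (hlast i (by omega) h₁).2]
      exact ⟨v.2, v.2⟩
  obtain ⟨x, hx⟩ := exists_seq_of_nat fun i hi => (hX' i hi).1
  obtain ⟨y, hy⟩ := exists_seq_of_nat fun i hi => (hX' i hi).2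
  have hx0 : x 0 = u := Fin.ext (by rw [hx 0 (by omega), hX0])
  have hy0 : y 0 = u := Fin.ext (by rw [hy 0 (by omega), hY0])
  have hxv : ∀ i < n, k ≤ i → x i = v :=
    fun i hi hki => Fin.ext (by rw [hx i (by omega), (hlast i hi hki).1])
  have hyv : ∀ i < n, k ≤ i → y i = v :=
    fun i hi hki => Fin.ext (by rw [hy i (by omega), (hlast i hi hki).2])
  have hstep : ∀ i < k, Step G h s t₀ t f₁ f₂ (x i) (y i) (x (i + 1)) (y (i + 1)) := by
    intro i hi
    refine stepOnNat_val ?_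
    rw [hx i (by omega), hy i (by omega), hx (i + 1) (by omega), hy (i + 1) (by omega)]
    exact hE i hi
  have hxl : ∀ i ≤ k, h (x i) = i := by
    intro i
    induction i with
    | zero => intro _; rw [hx0, hu]
    | succ i ih => intro hi; rw [(hstep i hi).1.2, ih (by omega)]
  have hyl : ∀ i ≤ k, h (y i) = i := by
    intro i
    induction i with
    | zero => intro _; rw [hy0, hu]
    | succ i ih => intro hi; rw [(hstep i hi).2.1.2, ih (by omega)]
  have hxs : x (h s) = s := (hstep (h s) hs).2.2.1.1 (hxl _ hs.le)
  refine ⟨x, y, hx0, hy0, hstep, ?_⟩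
  set σ₂ := (trace 3 stepExpr 4 5).run σ₁ with hσ₂
  have hG₂ : Guessed G u v h k s t₀ t f₁ f₂ σ₂ :=
    hG₁.congr (fun z hz => run_var (trace_vars z _ _ _ _ hz) σ₁)
      (run_arr (trace_arrs _ _ _ _ _ (by simp) (by simp)) σ₁)
      (run_arr (trace_arrs _ _ _ _ _ (by simp) (by simp)) σ₁)
  set σ₃ := (mark 6 badExpr).run σ₂ with hσ₃
  have ha₃ : ∀ b, b ≠ 6 → σ₃.arr b = σ₂.arr b := fun b hb => run_arr (mark_arrs _ _ _ hb) σ₂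
  have hG₃ : Guessed G u v h k s t₀ t f₁ f₂ σ₃ :=
    hG₂.congr (fun z hz => run_var (mark_vars z _ _ hz) σ₂) (ha₃ 0 (by simp)) (ha₃ 2 (by simp))
  have hat : ∀ ρ : State, Guessed G u v h k s t₀ t f₁ f₂ ρ → ∀ i z,
      Guessed G u v h k s t₀ t f₁ f₂ ((ρ.setVar 20 i).setVar 21 z) := fun ρ hρ i z =>
    hρ.congr (fun l hl => by
      simp [show l ≠ 20 by omega, show l ≠ 21 by omega]) rfl rfl
  -- The predicate `F` is the expression itself, evaluated in one fixed memory for each pair of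
  -- counters. Its meaning for the graph is available only when the index and the vertex are in
  -- range, so it is inserted afterwards.
  have h₆ := mark_spec (σ := σ₂) (a := 6) (e := badExpr) (A := [0, 2, 4, 5]) (by simp)
    (F := fun i z => badExpr.Holds ((σ₂.setVar 20 i).setVar 21 z)) (fun ρ hA hz => by
      simp only [badExpr, labelOf, touch, Expr.holds_and, Expr.holds_or, Expr.holds_lt,
        Expr.holds_eq, Expr.holds_read, Expr.eval, State.setVar_var, State.setVar_arr,
        hA 0 (by simp), hA 2 (by simp), hA 4 (by simp), hA 5 (by simp), hz 2 (by simp),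
        hz 3 (by simp), hz 5 (by simp)]
      simp) hG₂.size
  have h₇ := mark_spec (σ := σ₃) (a := 7) (e := goodExpr) (A := [0, 2, 4, 5]) (by simp)
    (F := fun i z => goodExpr.Holds ((σ₃.setVar 20 i).setVar 21 z)) (fun ρ hA hz => by
      simp only [goodExpr, labelOf, Expr.holds_and, Expr.holds_or, Expr.holds_lt, Expr.holds_not,
        Expr.holds_eq, Expr.eval, State.setVar_var, State.setVar_arr,
        hA 2 (by simp), hA 4 (by simp), hA 5 (by simp), hz 2 (by simp),
        hz 3 (by simp), hz 5 (by simp)]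
      simp) hG₃.size
  ext z
  rw [← mem_corridor_iff hk hs hxs hxl hyl
    (fun i hi hki => by rw [hxv i hi hki, hxv k hk le_rfl])
    (fun i hi hki => by rw [hyv i hi hki, hyv k hk le_rfl])]
  have h₄ : (rails.run σ).arr 7 z 0 ≠ 0 ↔
      ∃ i < n, (h (x i) ≤ h s ∧ x i = z) ∨ (h t ≤ h (y i) ∧ y i = z) := by
    refine (h₇ z z.2).trans (exists_congr fun i => and_congr_right fun hi => ?_)
    refine (hat σ₃ hG₃ i z).holds_goodExpr ?_ ?_ ?_
    · simpa [ha₃, hx i (by omega)] using (hst i hi).1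
    · simpa [ha₃, hy i (by omega)] using (hst i hi).2
    · simp
  have h₅ : (rails.run σ).arr 6 z 0 ≠ 0 ↔
      ∃ i < n, (h (x i) < h s ∧ Touch G (x i) z) ∨ (h t < h (y i) ∧ Touch G (y i) z) ∨
        (G.Adj s z ∧ h s < h z) := by
    have h₈ : (rails.run σ).arr 6 = σ₃.arr 6 := run_arr (mark_arrs 6 7 goodExpr (by simp)) σ₃
    rw [h₈]
    refine (h₆ z z.2).trans (exists_congr fun i => and_congr_right fun hi => ?_)
    refine (hat σ₂ hG₂ i z).holds_badExpr ?_ ?_ ?_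
    · simpa [hx i (by omega)] using (hst i hi).1
    · simpa [hy i (by omega)] using (hst i hi).2
    · simp
  rw [← h₄, ← h₅, not_not, Allowed, Set.mem_ofPred_eq]

/-- The labels of the rails have the right length. -/
theorem label_rails (hL : IsLayering G u v h k) (hk : k < n) {f : ℕ → ℕ → ℕ} {b : ℕ}
    (hS : IsStage n v (StepOnNat G h s t₀ t f₁ f₂) n b f) {x y : ℕ → Fin n} (hx0 : x 0 = u)
    (hy0 : y 0 = u) (hxk : x k = v) (hyk : y k = v)
    (hstep : ∀ i < k, Step G h s t₀ t f₁ f₂ (x i) (y i) (x (i + 1)) (y (i + 1))) :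
    f u u = k + 1 := by
  have h₁ := (hS.le_of_path (X := fun i => x i) (Y := fun i => y i) hk.le
    (fun i _ => ⟨(x i).2, (y i).2⟩) (by rw [hxk]) (by rw [hyk])
    fun i hi => ⟨_, _, _, _, rfl, rfl, rfl, rfl, hstep i hi⟩).1
  rw [hx0, hy0] at h₁
  obtain ⟨l, hl⟩ : ∃ l, f u u = l + 1 := ⟨f u u - 1, by omega⟩
  obtain ⟨X, Y, hX0, -, hXl, -, -, hE⟩ := hS.exists_path u.2 u.2 hl
  -- Every step raises the level by one, so all paths from `(u, u)` to `(v, v)` have the same number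
  -- of steps, `k`.
  have key : ∀ i ≤ l, ∀ a : Fin n, X i = a → h a = i := by
    intro i
    induction i with
    | zero =>
      intro _ a ha
      rw [← Fin.ext (hX0.symm.trans ha), hL.bot]
    | succ i ih =>
      intro hi a ha
      obtain ⟨c, _, c', _, h₂, _, h₃, _, h₄⟩ := hE i hi
      rw [Fin.ext (ha.symm.trans h₃), h₄.1.2, ih (by omega) c h₂]
  have := key l le_rfl v hXl
  rw [hL.top] at this
  omega

variable {p : ℕ → Fin n} {m d j : ℕ}

/-- The algorithm succeeds when the guess is right. -/
theorem test_finds (hσ : Guessed G u v h k s t₀ t f₁ f₂ σ) (hL : IsLayering G u v h k)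
    (hP : IsDetour G u v h k p m d j) (hg : IsDetour.Guess h p d j s t₀ t f₁ f₂) (hmn : m < n)
    (hkn : k < n) : (test.run σ).var 8 ≠ 0 := by
  rw [test, run]
  split_ifs with h₈
  · exact h₈
  have hS := search_spec (a := 3) (by simp) hσ.tests_stepExpr hσ.size hσ.target v.2
  have hv : ∀ z < 20, ((search 3 stepExpr).run σ).var z = σ.var z :=
    fun z hz => run_var (search_vars z _ _ hz) σ
  have ha : ∀ b, b ≠ 3 → ((search 3 stepExpr).run σ).arr b = σ.arr b :=
    fun b hb => run_arr (search_arrs _ _ _ hb) σ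
  rw [attempt, run]
  generalize (search 3 stepExpr).run σ = ρ at hS hv ha
  have hρ := hσ.congr hv (ha 0 (by simp)) (ha 2 (by simp))
  have hl : ρ.arr 3 u u = k + 1 := by
    obtain ⟨x, y, hx0, hy0, hxk, hyk, hstep⟩ := hP.exists_steps hL hg
    exact label_rails hL hkn hS hx0 hy0 hxk hyk hstep
  have hds : h s = d := by rw [hg.1, hP.head d le_rfl]
  obtain ⟨x, y, hx0, hy0, hstep, hall⟩ := rails_spec hρ hL.bot hkn (by rw [hds]; exact hP.d_lt_k)
    hS hl
  have hR := isRails_of_steps hL hP hg hx0 hy0 hstep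
  rw [run, if_pos (by simp [hρ.source, hl]), run]
  have hτ : Ready G u v (rails.run ρ) :=
    hρ.toReady.congr (fun z hz => run_var (rails_vars z (by omega)) ρ)
      (run_arr (rails_arrs 0 (by simp)) ρ) (run_arr (rails_arrs 2 (by simp)) ρ)
  have hτ₂ : (rails.run ρ).arr 2 u v = k + 1 := by
    have := hρ.level u
    rw [hL.bot] at this
    rw [run_arr (rails_arrs 2 (by simp)) ρ, ← this, Nat.add_zero]
  refine probe_finds hτ ?_
  have hT := isStage_corridor hτ
  rw [hall, hds] at hT
  rw [hτ₂]
  generalize ((search 8 corridorExpr).run (rails.run ρ)).arr 8 = f at hT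
  -- The corridor contains a walk with at most `m < n` edges, so the last search labels `u`.
  obtain ⟨w, hwm, hw⟩ := hR.walkIn_corridor hL hP
  have h₀ := (hT.le_of_seq (p := w.getVert) (l := w.length) (by omega) w.getVert_length
    fun i hi => ⟨w.adj_getVert_succ hi, hw _ (w.getVert_mem_support i),
      hw _ (w.getVert_mem_support (i + 1))⟩).1
  rw [w.getVert_zero] at h₀
  -- A label of at most `k + 1` would give a walk with at most `k` edges in the corridor. Such a
  -- walk ascends, and the corridor contains no ascending path from `u` to `v`.
  by_contra hlt
  obtain ⟨l, hl'⟩ : ∃ l, f u v = l + 1 := ⟨f u v - 1, by omega⟩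
  obtain ⟨q, rfl, rfl, -, hq⟩ := hT.exists_seq hl'
  obtain ⟨w', hw', hg'⟩ := exists_walk_of_seq q l fun i hi => (hq i hi).1
  have hlev := hL.getVert_le w'
  have hk' : w'.length = k := by
    have := (hlev 0 (by omega)).2
    rw [w'.getVert_zero, hL.bot] at this
    omega
  obtain rfl : l = k := hw'.symm.trans hk'
  rw [hw'] at hlev
  have hdk := hP.d_lt_k
  refine not_ascends_corridor hL hdk hR.x_asc hR.apart (f := q) ⟨fun i _ hi => ?_, fun i _ hi =>
    (hq i hi).1⟩ fun i hi => ?_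
  · have := hlev i hi
    rw [hg' i hi] at this
    omega
  · rcases Nat.lt_or_ge i l with h₁ | h₁
    · exact (hq i h₁).2.1
    · have := (hq (l - 1) (by omega)).2.2
      rwa [show l - 1 + 1 = i by omega] at this

/-- A loop keeps a property that does not depend on the loop variable. -/
theorem rep_keeps {x : ℕ} {c : Cmd} {I : State → Prop} (hI : ∀ σ i, I σ → I (σ.setVar x i))
    (hc : ∀ σ, I σ → I (c.run σ)) (hσ : I σ) : I ((rep x c).run σ) := by
  rw [run]
  exact Function.Iterate.rec I (hI _ _ hσ) (fun ρ hρ => hI _ _ (hc _ hρ)) _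

/-- A loop finds what one of its rounds finds. -/
theorem rep_finds {x g : ℕ} {c : Cmd} (hw : (rep x c).IsWF) {I D : State → Prop}
    (hI : ∀ σ i, I σ → I (σ.setVar x i)) (hcI : ∀ σ, I σ → I (c.run σ))
    (hD : ∀ σ i, D σ → D (σ.setVar x i)) (hcD : ∀ σ, D σ → D (c.run σ)) (hσ : I σ)
    (hg : g < σ.var 0) (hfind : ∀ ρ, I ρ → (∀ z ∉ c.vars, z ≠ x → ρ.var z = σ.var z) →
      ρ.var x = g → D (c.run ρ)) : D ((rep x c).run σ) := by
  refine (rep_induction hw (fun i ρ => I ρ ∧ (g < i → D ρ)) ⟨hI _ _ hσ, fun h => by omega⟩ ?_).2 hg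
  rintro i hi ρ - hv hρ ⟨h₁, h₂⟩
  refine ⟨hI _ _ (hcI _ h₁), fun hgi => hD _ _ ?_⟩
  rcases Nat.lt_or_ge g i with h₃ | h₃
  · exact hcD _ (h₂ h₃)
  · exact hfind ρ h₁ hv (by omega)

end Cmd
end RAM

/-! ### The loops over all guesses. -/

namespace RAM

variable {n : ℕ} {G : SimpleGraph (Fin n)} {u v : Fin n} {σ : State}

theorem Sound.setVar (hσ : Sound G u v σ) {x : ℕ} (hx : 3 ≤ x) (hx' : x < 8) (i : ℕ) :
    Sound G u v (σ.setVar x i) := by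
  refine ⟨hσ.1.congr (fun z hz => ?_) rfl rfl, ?_⟩
  · simp [show z ≠ x by omega]
  · simpa [Found, show 8 ≠ x by omega, show 9 ≠ x by omega] using hσ.2

namespace Cmd

/-- The algorithm reports correct paths only. -/
theorem full_sound : Sound G u v (full.run (input G u v)) := by
  have h₀ : Sound G u v ((search 2 adjExpr).run (input G u v)) :=
    ⟨ready_input, Or.inl (by rw [run_var (search_vars 8 _ _ (by simp))]; simp [input])⟩
  rw [full, run]
  refine rep_keeps (fun σ i h => h.setVar (by simp) (by simp) i) (fun σ h => ?_) h₀
  refine rep_keeps (fun σ i h => h.setVar (by simp) (by simp) i) (fun σ h => ?_) h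
  refine rep_keeps (fun σ i h => h.setVar (by simp) (by simp) i) (fun σ h => ?_) h
  refine rep_keeps (fun σ i h => h.setVar (by simp) (by simp) i) (fun σ h => ?_) h
  exact rep_keeps (fun σ i h => h.setVar (by simp) (by simp) i) (fun σ h => test_sound h) h

/-- The algorithm finds a path if there is one. -/
theorem full_finds (hs : ∀ x, IsStraight G u v x) (hw : ∃ w : G.Walk u v, IsNSP G w) :
    (full.run (input G u v)).var 8 ≠ 0 := by
  obtain ⟨w, hw₁, hw₂, hw₃⟩ := hw
  have hr : G.Reachable u v := ⟨w⟩
  rw [← hr.coe_dist_eq_edist] at hw₃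
  obtain ⟨hL, hdist⟩ := isLayering_dist hs hr
  obtain ⟨p, m, d, j, hP, w', hw', hwm⟩ :=
    hL.exists_isDetour ⟨w, hw₁, hw₂, by exact_mod_cast hw₃⟩
  have hmn : m < n := by
    have := hw'.length_lt
    rw [Fintype.card_fin] at this
    omega
  obtain ⟨s, t₀, t, f₁, f₂, hg⟩ :
      ∃ s t₀ t f₁ f₂, IsDetour.Guess (G.dist u) p d j s t₀ t f₁ f₂ :=
    ⟨_, _, _, _, _, rfl, rfl, rfl, rfl, rfl⟩
  have hready : Ready G u v ((search 2 adjExpr).run (input G u v)) := ready_input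
  have hI : ∀ (x : ℕ), 3 ≤ x → x < 8 → ∀ σ i, Sound G u v σ → Sound G u v (σ.setVar x i) :=
    fun x h h' σ i hσ => hσ.setVar h h' i
  have hD : ∀ (x : ℕ), x < 8 → ∀ (σ : State) i, σ.var 8 ≠ 0 → (σ.setVar x i).var 8 ≠ 0 :=
    fun x hx σ i h => by simpa [show 8 ≠ x by omega] using h
  have c₀ : ∀ σ, Sound G u v σ → Sound G u v (test.run σ) := fun σ h => test_sound h
  have d₀ : ∀ σ : State, σ.var 8 ≠ 0 → (test.run σ).var 8 ≠ 0 := fun σ h => by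
    rw [test, run, if_pos (Expr.holds_var.2 h)]
    exact h
  have c₁ := fun σ hσ => rep_keeps (σ := σ) (hI 7 (by simp) (by simp)) c₀ hσ
  have d₁ := fun σ hσ => rep_keeps (σ := σ) (hD 7 (by simp)) d₀ hσ
  have c₂ := fun σ hσ => rep_keeps (σ := σ) (hI 6 (by simp) (by simp)) c₁ hσ
  have d₂ := fun σ hσ => rep_keeps (σ := σ) (hD 6 (by simp)) d₁ hσ
  have c₃ := fun σ hσ => rep_keeps (σ := σ) (hI 5 (by simp) (by simp)) c₂ hσ
  have d₃ := fun σ hσ => rep_keeps (σ := σ) (hD 5 (by simp)) d₂ hσ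
  have c₄ := fun σ hσ => rep_keeps (σ := σ) (hI 4 (by simp) (by simp)) c₃ hσ
  have d₄ := fun σ hσ => rep_keeps (σ := σ) (hD 4 (by simp)) d₃ hσ
  have hw := full_isWF.2
  have hlt : ∀ {σ : State} (x : Fin n), Sound G u v σ → (x : ℕ) < σ.var 0 := fun x hσ => by
    rw [hσ.1.size]
    exact x.2
  have h₀ : Sound G u v ((search 2 adjExpr).run (input G u v)) :=
    ⟨hready, Or.inl (by rw [run_var (search_vars 8 _ _ (by simp))]; simp [input])⟩
  rw [full, run]
  -- In each of the five loops, consider the round whose counter is the right guess. Once `x₈` is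
  -- nonzero it remains so, because `test` then does nothing.
  refine rep_finds hw (D := fun σ => σ.var 8 ≠ 0) (hI 3 (by simp) (by simp)) c₄ (hD 3 (by simp)) d₄
    h₀ (hlt s h₀) fun σ₁ h₁ _ e₃ => ?_
  refine rep_finds hw.2.2 (D := fun σ => σ.var 8 ≠ 0) (hI 4 (by simp) (by simp)) c₃
    (hD 4 (by simp)) d₃ h₁ (hlt t₀ h₁) fun σ₂ h₂ v₂ e₄ => ?_
  refine rep_finds hw.2.2.2.2 (D := fun σ => σ.var 8 ≠ 0) (hI 5 (by simp) (by simp)) c₂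
    (hD 5 (by simp)) d₂ h₂ (hlt t h₂) fun σ₃ h₃ v₃ e₅ => ?_
  refine rep_finds hw.2.2.2.2.2.2 (D := fun σ => σ.var 8 ≠ 0) (hI 6 (by simp) (by simp)) c₁
    (hD 6 (by simp)) d₁ h₃ (hlt f₁ h₃) fun σ₄ h₄ v₄ e₆ => ?_
  refine rep_finds hw.2.2.2.2.2.2.2.2 (D := fun σ => σ.var 8 ≠ 0) (hI 7 (by simp) (by simp)) c₀
    (hD 7 (by simp)) d₀ h₄ (hlt f₂ h₄) fun σ₅ h₅ v₅ e₇ => ?_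
  have w₂ : ∀ z < 4, σ₂.var z = σ₁.var z := fun z hz =>
    v₂ z (by simp [vars, test_vars z (show z < 8 by omega)]; omega) (by omega)
  have w₃ : ∀ z < 5, σ₃.var z = σ₂.var z := fun z hz =>
    v₃ z (by simp [vars, test_vars z (show z < 8 by omega)]; omega) (by omega)
  have w₄ : ∀ z < 6, σ₄.var z = σ₃.var z := fun z hz =>
    v₄ z (by simp [vars, test_vars z (show z < 8 by omega)]; omega) (by omega)
  have w₅ : ∀ z < 7, σ₅.var z = σ₄.var z := fun z hz =>
    v₅ z (test_vars z (by omega)) (by omega)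
  have hG : Guessed G u v (G.dist u) (G.dist u v) s t₀ t f₁ f₂ σ₅ := by
    refine ⟨h₅.1, fun x => ?_, ?_, ?_, ?_, ?_, e₇⟩
    · rw [h₅.1.label x ((hdist x).1.symm.trans hr)]
      have := (hdist x).2
      omega
    · rw [w₅ 3 (by simp), w₄ 3 (by simp), w₃ 3 (by simp), w₂ 3 (by simp), e₃]
    · rw [w₅ 4 (by simp), w₄ 4 (by simp), w₃ 4 (by simp), e₄]
    · rw [w₅ 5 (by simp), w₄ 5 (by simp), e₅]
    · rw [w₅ 6 (by simp), e₆]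
  exact test_finds hG hL hP hg hmn (dist_lt_of_reachable hr)

end Cmd
end RAM

theorem theorem3p2 :
    ∃ (P : RAM.Prog) (C : ℕ), ∀ (n : ℕ) (G : SimpleGraph (Fin n)) (u v : Fin n),
      (∀ x : Fin n, IsStraight G u v x) →
        ∃ (t : ℕ) (σ : RAM.State),
          RAM.Exec P (RAM.input G u v) t σ ∧ σ.AnswersNSP G u v ∧ t ≤ C * n ^ 16 := by
  -- During the search `x₀` bounds the loops and `x₁` holds `u`. So the answer is collected in `x₈`
  -- and `x₉` and moved at the end by two assignments of 2 steps each, which accounts for the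
  -- summand 4.
  refine ⟨.seq RAM.Cmd.full.toProg (.seq (.assign 1 (.var 9)) (.assign 0 (.var 8))),
    RAM.Cmd.full.weight + 4, fun n G u v hs => ?_⟩
  have hn : 1 ≤ n := u.pos
  have h0 : (RAM.input G u v).var 0 = n := by simp [RAM.input]
  obtain ⟨t, ht, htT⟩ := RAM.Cmd.full.exec RAM.Cmd.full_isWF (RAM.input G u v) (by rw [h0]; exact hn)
  refine ⟨_, _, .seq ht (.seq (.assign 1 (.var 9) _) (.assign 0 (.var 8) _)), ?_, ?_⟩
  · have hsound := RAM.Cmd.full_sound (G := G) (u := u) (v := v)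
    have hfinds := RAM.Cmd.full_finds (G := G) (u := u) (v := v) hs
    generalize RAM.Cmd.full.run (RAM.input G u v) = σ at hsound hfinds
    rcases hsound.2 with h₈ | ⟨h₈, w, hw, h₉, h₁⟩
    · exact Or.inr ⟨by simpa using h₈, fun hw => hfinds hw h₈⟩
    · exact Or.inl ⟨by simpa using h₈, w, hw, by simpa using h₉, h₁⟩
  · rw [h0] at htT
    have h₁ : n ^ RAM.Cmd.full.depth ≤ n ^ 16 := Nat.pow_le_pow_right hn RAM.Cmd.full_depth
    have h₂ := Nat.mul_le_mul (le_refl RAM.Cmd.full.weight) h₁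
    have h₃ : 1 ≤ n ^ 16 := Nat.one_le_pow _ _ hn
    simp only [RAM.Expr.cost]
    rw [Nat.add_mul]
    omega
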